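/- Let $T>0$, let $V\in C^2(\mathbb R)$ with $V'\le 0$, and let $q_0\in L^\infty(\mathbb R)$ with $q_0\ge 0$ a.e. and finite total variation $|q_0|_{TV(\mathbb R)}<\infty$, where for $f\in L^1_{loc}(\mathbb R)$ $$|f|_{TV(\mathbb R)}=\sup\Big\{\int_{\mathbb R} f\varphi'\,dx:\ \varphi\in C^1_c(\mathbb R),\ |\varphi|\le 1\Big\}.$$ For $\eta>0$ put $W_\eta[V(q)](t,x)=\frac1\eta\int_x^\infty e^{\frac{x-y}{\eta}}\,V(q(t,y))\,dy$ (exponential kernel), and let $q_\eta\in C([0,T];L^1_{loc}(\mathbb R))\cap L^\infty((0,T);L^\infty(\mathbb R)\cap TV(\mathbb R))$ be a weak solution of $$\partial_t q+\partial_x\big(W_\eta[V(q)]\,q\big)=0\ \text{ on }(0,T)\times\mathbb R,\qquad q(0,\cdot)=q_0,$$ that is, $W_\eta[V(q_\eta)]\in C([0,T];L^1_{loc}(\mathbb R))$ and, for all $\phi\in C^1_c((-42,T)\times\mathbb R)$, $$\int_0^T\!\!\int_{\mathbb R} q_\eta\big(\partial_t\phi+W_\eta[V(q_\eta)]\,\partial_x\phi\big)\,dx\,dt+\int_{\mathbb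 R}q_0(x)\phi(0,x)\,dx=0 .$$ Assume that $$V'(x)x-V(x)+V\big(\operatorname{ess\,inf} q_0\big)\le 0\qquad\text{for all } x\in\big(\operatorname{ess\,inf} q_0,\ \|q_0\|_{L^\infty(\mathbb R)}\big).$$ Then, for every $\eta>0$ and every such $q_\eta$, the map $t\mapsto |W_\eta[V(q_\eta)](t,\cdot)|_{TV(\mathbb R)}$ is nonincreasing on $[0,T]$; in particular, for all $t\in[0,T]$, $$|W_\eta[V(q_\eta)](t,\cdot)|_{TV(\mathbb R)}\le |W_\eta[V(q_\eta)](0,\cdot)|_{TV(\mathbb R)}\le \|V'\|_{L^\infty((0,\|q_0\|_{L^\infty(\mathbb R)}))}\,|q_0|_{TV(\mathbb R)},$$ a bound independent of $\eta$ and $t$. -/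

import Mathlib

open MeasureTheory Set Filter Topology
open scoped ENNReal

noncomputable section

namespace NonlocalVelocity

/-- The total variation `|f|_{TV(ℝ)}` of (the a.e. class of) a locally integrable function
`f : ℝ → ℝ`: the supremum of `∫ f φ'` over the `φ ∈ C¹_c(ℝ)` with `|φ| ≤ 1`. -/
def totalVariation (f : ℝ → ℝ) : ℝ≥0∞ :=
  ⨆ (φ : ℝ → ℝ) (_ : ContDiff ℝ 1 φ ∧ HasCompactSupport φ ∧ ∀ x, |φ x| ≤ 1),
    ENNReal.ofReal (∫ x, f x * deriv φ x)

/-- The space `C([0,T]; L¹_loc(ℝ))`; only the a.e. class of each `u t`, `t ∈ [0,T]`, matters. -/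
def ContinuousInL1loc (T : ℝ) (u : ℝ → ℝ → ℝ) : Prop :=
  (∀ t ∈ Icc 0 T, LocallyIntegrable (u t) volume) ∧
  ∀ K : Set ℝ, IsCompact K → ∀ t ∈ Icc 0 T,
    Tendsto (fun s => ∫⁻ x in K, ‖u s x - u t x‖ₑ) (𝓝[Icc 0 T] t) (𝓝 0)

/-- Membership in `L^∞((0,T); L^∞(ℝ) ∩ TV(ℝ))`: the `L^∞`-norm and the total variation of `u t`
are essentially bounded in `t ∈ (0,T)`. -/
def EssBoundedLinftyTV (T : ℝ) (u : ℝ → ℝ → ℝ) : Prop :=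
  ∃ C : ℝ, ∀ᵐ t ∂(volume.restrict (Ioo 0 T)),
    eLpNorm (u t) ⊤ volume ≤ ENNReal.ofReal C ∧ totalVariation (u t) ≤ ENNReal.ofReal C

/-- The nonlocal velocity
`𝒲_η[V(q), γ](t, x) = (1/η) ∫_x^∞ γ((y - x)/η) V(q(t, y)) dy`. -/
def velocity (γ : ℝ → ℝ) (η : ℝ) (V : ℝ → ℝ) (q : ℝ → ℝ → ℝ) (t x : ℝ) : ℝ :=
  (1 / η) * ∫ y in Ioi x, γ ((y - x) / η) * V (q t y)

/-- The exponential kernel `γ(z) = e^{-z}`. -/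
def expKernel (z : ℝ) : ℝ := Real.exp (-z)

/-- Weak solutions on `(0,T) × ℝ` of the conservation law with nonlocal velocity
`∂_t q + ∂_x (𝒲_η[V(q), γ] q) = 0`, `q(0, ·) = q₀`. The test functions are those of
`C¹_c((-42, T) × ℝ)`, extended by zero. -/
structure IsWeakSolution (γ : ℝ → ℝ) (η T : ℝ) (V q₀ : ℝ → ℝ) (q : ℝ → ℝ → ℝ) : Prop where
  continuous_solution : ContinuousInL1loc T q
  bounded_solution : EssBoundedLinftyTV T q
  continuous_velocity : ContinuousInL1loc T (velocity γ η V q)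
  weak_equation : ∀ φ : ℝ × ℝ → ℝ, ContDiff ℝ 1 φ → HasCompactSupport φ →
    tsupport φ ⊆ Ioo (-42) T ×ˢ univ →
    (∫ t in Ioo 0 T, ∫ x, q t x *
        (deriv (fun s => φ (s, x)) t + velocity γ η V q t x * deriv (fun y => φ (t, y)) x))
      + ∫ x, q₀ x * φ (0, x) = 0

end NonlocalVelocity

end

/-! Write `W` for the velocity, `u` for the density and `p = ∂ₓ W`. For the exponential kernel `W`
is the average of `V(u)` over exponentially distributed shifts, so that `η p = W - V(u)`
(`avg_expLaw_sub`). Hence `W` is Lipschitz in space and its total variation is the `L¹` norm of `p`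
(`totalVariation_le_lintegral`, `lintegral_le_totalVariation`). It remains to see that `∫ |p|` does
not increase.

Because the velocity is Lipschitz, a bounded weak solution may be renormalized
(`BalanceLaw.renormalize`). Taking `V` as the renormalizing function gives `∂ₜ V(u) + ∂ₓ (W V(u)) =
W p - N` with `N = (V'(u) u - V(u) + W) p`. The relation between `W`, `p` and `V(u)` turns this into
a closed equation for the slope, `∂ₜ p + ∂ₓ (W p) = (N - 𝒲 N) / η`, where `𝒲` is the exponential
average (`BalanceLaw.slope`).

A maximum principle (`BalanceLaw.one_sided_bound`) keeps `u` between `m = ess inf q₀` and `M =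
‖q₀‖_∞`. Since `V` is nonincreasing, `W ≤ V(m)`, and the structural assumption yields `N = a p` with
`a ≤ 0`. Formally, `sgn(p) N = -|N|`, while `𝒲` preserves the integral of `|N|`, so `d/dt ∫ |p| ≤
η⁻¹ (-∫ |N| + ∫ 𝒲 |N|) = 0`. `BalanceLaw.integral_abs_le` makes this rigorous with a smoothed
absolute value and spreading cutoffs.

At the initial time, averaging contracts `L¹` and `V` is Lipschitz on `[0, M]`. The `L¹` translation
modulus of `W` is therefore controlled by that of `q₀`, that is, by its total variation
(`lintegral_le_mul_totalVariation`). -/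

noncomputable section

namespace NonlocalVelocity

/-! ### Bounded families continuous in time in weighted `L¹` -/

/-- A time-dependent family of uniformly bounded measurable functions of `x`, continuous in time
with respect to every `L¹` norm with integrable weight. -/
structure BddCont (u : ℝ → ℝ → ℝ) : Prop where
  meas : ∀ t, AEStronglyMeasurable (u t) volume
  bdd : ∃ C, 0 ≤ C ∧ ∀ t, ∀ᵐ x, |u t x| ≤ C
  tendsto : ∀ ψ : ℝ → ℝ, Integrable ψ → ∀ t,
    Tendsto (fun s => ∫ x, |u s x - u t x| * |ψ x|) (𝓝 t) (𝓝 0)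

lemma integrable_bdd_mul {f ψ : ℝ → ℝ} {C : ℝ} (hf : AEStronglyMeasurable f volume)
    (hC : ∀ᵐ x, |f x| ≤ C) (hψ : Integrable ψ) : Integrable (fun x => f x * ψ x) :=
  hψ.bdd_mul hf (by simpa using hC)

lemma locallyIntegrable_of_bdd {f : ℝ → ℝ} {C : ℝ} (hf : AEStronglyMeasurable f volume)
    (hC : ∀ᵐ x, |f x| ≤ C) : LocallyIntegrable f volume := by
  refine (locallyIntegrable_const C).mono hf ?_
  filter_upwards [hC] with x hx
  simpa using hx.trans (le_abs_self C)

lemma intervalIntegrable_of_locallyIntegrable {f : ℝ → ℝ} (hf : LocallyIntegrable f volume)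
    (a b : ℝ) : IntervalIntegrable f volume a b :=
  intervalIntegrable_iff.mpr <|
    (hf.integrableOn_isCompact isCompact_uIcc).mono_set uIoc_subset_uIcc

namespace BddCont

variable {u v : ℝ → ℝ → ℝ}

lemma integrable_mul (hu : BddCont u) {ψ : ℝ → ℝ} (hψ : Integrable ψ) (t : ℝ) :
    Integrable (fun x => u t x * ψ x) := by
  obtain ⟨C, -, hC⟩ := hu.bdd
  exact integrable_bdd_mul (hu.meas t) (hC t) hψ

lemma integrable_abs_sub_mul (hu : BddCont u) {ψ : ℝ → ℝ} (hψ : Integrable ψ) (s t : ℝ) :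
    Integrable (fun x => |u s x - u t x| * |ψ x|) := by
  have := ((hu.integrable_mul hψ s).sub (hu.integrable_mul hψ t)).abs
  refine this.congr (ae_of_all _ fun x => ?_)
  simp only [Pi.sub_apply, ← sub_mul, abs_mul]

lemma locallyIntegrable (hu : BddCont u) (t : ℝ) : LocallyIntegrable (u t) volume := by
  obtain ⟨C, -, hC⟩ := hu.bdd
  exact locallyIntegrable_of_bdd (hu.meas t) (hC t)

/-- Pointwise domination of increments carries weighted `L¹` convergence over from `u` and `v` to
`w`. Sums, products and Lipschitz compositions are all instances. -/
lemma of_le (hu : BddCont u) (hv : BddCont v) {w : ℝ → ℝ → ℝ}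
    (meas : ∀ t, AEStronglyMeasurable (w t) volume)
    (bdd : ∃ C, 0 ≤ C ∧ ∀ t, ∀ᵐ x, |w t x| ≤ C) {L : ℝ}
    (h : ∀ s t, ∀ᵐ x, |w s x - w t x| ≤ L * (|u s x - u t x| + |v s x - v t x|)) :
    BddCont w := by
  refine ⟨meas, bdd, fun ψ hψ t => ?_⟩
  have hlim := ((hu.tendsto ψ hψ t).add (hv.tendsto ψ hψ t)).const_mul L
  rw [add_zero, mul_zero] at hlim
  refine squeeze_zero (fun s => integral_nonneg fun x => by positivity) (fun s => ?_) hlim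
  rw [← integral_add (hu.integrable_abs_sub_mul hψ s t) (hv.integrable_abs_sub_mul hψ s t),
    ← integral_const_mul]
  refine integral_mono_of_nonneg (ae_of_all _ fun x => by positivity)
    (((hu.integrable_abs_sub_mul hψ s t).add (hv.integrable_abs_sub_mul hψ s t)).const_mul L) ?_
  filter_upwards [h s t] with x hx
  calc |w s x - w t x| * |ψ x| ≤ (L * (|u s x - u t x| + |v s x - v t x|)) * |ψ x| := by gcongr
    _ = _ := by ring

lemma const {f : ℝ → ℝ} {C : ℝ} (hf : AEStronglyMeasurable f volume)
    (hC : ∀ᵐ x, |f x| ≤ C) : BddCont fun _ => f := by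
  refine ⟨fun _ => hf, ⟨|C|, abs_nonneg _, fun _ => ?_⟩, fun ψ _ t => by simp⟩
  filter_upwards [hC] with x hx using hx.trans (le_abs_self C)

lemma add (hu : BddCont u) (hv : BddCont v) : BddCont fun t x => u t x + v t x := by
  refine of_le hu hv (L := 1) (fun t => (hu.meas t).add (hv.meas t)) ?_ fun s t =>
    ae_of_all _ fun x => ?_
  · obtain ⟨C, h0, hC⟩ := hu.bdd
    obtain ⟨D, h1, hD⟩ := hv.bdd
    refine ⟨C + D, by positivity, fun t => ?_⟩
    filter_upwards [hC t, hD t] with x h1 h2 using (abs_add_le _ _).trans (add_le_add h1 h2)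
  · rw [one_mul, show u s x + v s x - (u t x + v t x) = (u s x - u t x) + (v s x - v t x) by ring]
    exact abs_add_le _ _

lemma mul (hu : BddCont u) (hv : BddCont v) : BddCont fun t x => u t x * v t x := by
  obtain ⟨C, h0, hC⟩ := hu.bdd
  obtain ⟨D, h1, hD⟩ := hv.bdd
  refine of_le hu hv (L := C + D) (fun t => (hu.meas t).mul (hv.meas t)) ?_ fun s t => ?_
  · refine ⟨C * D, by positivity, fun t => ?_⟩
    filter_upwards [hC t, hD t] with x h1 h2
    rw [abs_mul]
    gcongr
  · filter_upwards [hC s, hD t] with x h3 h4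
    calc |u s x * v s x - u t x * v t x|
        = |u s x * (v s x - v t x) + (u s x - u t x) * v t x| := by ring_nf
      _ ≤ |u s x| * |v s x - v t x| + |u s x - u t x| * |v t x| := by
          rw [← abs_mul, ← abs_mul]; exact abs_add_le _ _
      _ ≤ C * |v s x - v t x| + |u s x - u t x| * D := by gcongr
      _ ≤ (C + D) * (|u s x - u t x| + |v s x - v t x|) := by
          nlinarith [abs_nonneg (u s x - u t x), abs_nonneg (v s x - v t x),
            mul_nonneg h0 (abs_nonneg (u s x - u t x)), mul_nonneg h1 (abs_nonneg (v s x - v t x))]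

lemma const_mul (hu : BddCont u) (c : ℝ) : BddCont fun t x => c * u t x :=
  (const (f := fun _ => c) (C := |c|) aestronglyMeasurable_const (by simp)).mul hu

lemma neg (hu : BddCont u) : BddCont fun t x => -u t x := by simpa using hu.const_mul (-1)

lemma sub (hu : BddCont u) (hv : BddCont v) : BddCont fun t x => u t x - v t x := by
  simpa only [sub_eq_add_neg] using hu.add hv.neg

end BddCont

lemma exists_lipschitz_bound {f : ℝ → ℝ} (hf : LocallyLipschitz f) (C : ℝ) :
    ∃ L : ℝ, 0 ≤ L ∧ ∀ a b, |a| ≤ C → |b| ≤ C → |f a - f b| ≤ L * |a - b| := by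
  obtain ⟨K, hK⟩ := (hf.locallyLipschitzOn (s := Icc (-C) C)).exists_lipschitzOnWith_of_compact
    isCompact_Icc
  exact ⟨K, K.2, fun a b ha hb => by
    simpa [Real.dist_eq] using hK.dist_le_mul a (abs_le.mp ha) b (abs_le.mp hb)⟩

lemma exists_bound_of_continuous {f : ℝ → ℝ} (hf : Continuous f) (C : ℝ) :
    ∃ M : ℝ, 0 ≤ M ∧ ∀ a, |a| ≤ C → |f a| ≤ M := by
  obtain ⟨M, hM⟩ := (isCompact_Icc (a := -C) (b := C)).exists_bound_of_continuousOn
    hf.continuousOn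
  exact ⟨|M|, abs_nonneg _, fun a ha => (hM a (abs_le.mp ha)).trans (le_abs_self M)⟩

namespace BddCont

variable {u v : ℝ → ℝ → ℝ}

lemma comp (hu : BddCont u) {f : ℝ → ℝ} (hf : LocallyLipschitz f) :
    BddCont fun t x => f (u t x) := by
  obtain ⟨C, h0, hC⟩ := hu.bdd
  obtain ⟨L, hL0, hL⟩ := exists_lipschitz_bound hf C
  obtain ⟨M, hM0, hM⟩ := exists_bound_of_continuous hf.continuous C
  refine of_le hu hu (L := L) (fun t => hf.continuous.comp_aestronglyMeasurable (hu.meas t))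
    ⟨M, hM0, fun t => ?_⟩ fun s t => ?_
  · filter_upwards [hC t] with x hx using hM _ hx
  · filter_upwards [hC s, hC t] with x hs ht
    refine (hL _ _ hs ht).trans ?_
    gcongr
    linarith [abs_nonneg (u s x - u t x)]

lemma translate (hu : BddCont u) (a : ℝ) : BddCont fun t x => u t (x + a) := by
  have hmp := measurePreserving_add_right volume a
  refine ⟨fun t => (hu.meas t).comp_measurePreserving hmp, ?_, fun ψ hψ t => ?_⟩
  · obtain ⟨C, h0, hC⟩ := hu.bdd
    exact ⟨C, h0, fun t => hmp.quasiMeasurePreserving.ae (hC t)⟩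
  · refine (hu.tendsto (fun x => ψ (x - a)) (hψ.comp_sub_right a) t).congr fun s => ?_
    rw [← integral_add_right_eq_self (fun x => |u s x - u t x| * |ψ (x - a)|) a]
    simp

/-- Integrals of a `BddCont` family against boundedly converging factors converge. -/
lemma tendsto_integral (hu : BddCont u) {ι : Type*} {l : Filter ι} [l.IsCountablyGenerated]
    {r : ι → ℝ} {t : ℝ} (hr : Tendsto r l (𝓝 t)) {B : ι → ℝ → ℝ} {B₀ : ℝ → ℝ} {M : ℝ}
    (hB : ∀ᶠ i in l, AEStronglyMeasurable (B i) volume) (hM : ∀ᶠ i in l, ∀ᵐ x, |B i x| ≤ M)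
    (hlim : ∀ᵐ x, Tendsto (fun i => B i x) l (𝓝 (B₀ x))) {ψ : ℝ → ℝ} (hψ : Integrable ψ) :
    Tendsto (fun i => ∫ x, u (r i) x * (B i x * ψ x)) l (𝓝 (∫ x, u t x * (B₀ x * ψ x))) := by
  obtain ⟨C, h0, hC⟩ := hu.bdd
  -- With the time of the family frozen at `t`, dominated convergence treats the factors `B i`.
  -- Unfreezing the time costs at most `M` times a weighted `L¹` distance that tends to zero.
  have h1 : Tendsto (fun i => ∫ x, u t x * (B i x * ψ x)) l (𝓝 (∫ x, u t x * (B₀ x * ψ x))) := by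
    refine tendsto_integral_filter_of_dominated_convergence (fun x => C * (M * |ψ x|)) ?_ ?_
      ((hψ.abs.const_mul M).const_mul C) ?_
    · filter_upwards [hB] with i hi using (hu.meas t).mul (hi.mul hψ.1)
    · filter_upwards [hM] with i hi
      filter_upwards [hi, hC t] with x h1 h2
      rw [Real.norm_eq_abs, abs_mul, abs_mul]
      gcongr
    · filter_upwards [hlim] with x hx using (hx.mul_const _).const_mul _
  have h2 : Tendsto (fun i => (∫ x, u (r i) x * (B i x * ψ x)) - ∫ x, u t x * (B i x * ψ x)) l
      (𝓝 0) := by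
    have h3 := ((hu.tendsto ψ hψ t).comp hr).const_mul M
    rw [mul_zero] at h3
    refine squeeze_zero_norm' ?_ h3
    filter_upwards [hB, hM] with i hi hi'
    have hint : ∀ s, Integrable fun x => u s x * (B i x * ψ x) := fun s =>
      hu.integrable_mul (integrable_bdd_mul hi hi' hψ) s
    rw [← integral_sub (hint _) (hint _), Function.comp_apply, ← integral_const_mul]
    refine (norm_integral_le_integral_norm _).trans (integral_mono_of_nonneg
      (ae_of_all _ fun x => norm_nonneg _)
      ((hu.integrable_abs_sub_mul hψ _ _).const_mul M) ?_)
    filter_upwards [hi'] with x hx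
    rw [Real.norm_eq_abs, ← sub_mul, abs_mul, abs_mul]
    calc _ ≤ |u (r i) x - u t x| * (M * |ψ x|) := by gcongr
      _ = _ := by ring
  simpa using h2.add h1

lemma continuous_integral (hu : BddCont u) {ψ : ℝ → ℝ} (hψ : Integrable ψ) :
    Continuous fun t => ∫ x, u t x * ψ x := by
  refine continuous_iff_continuousAt.mpr fun t => ?_
  have := hu.tendsto_integral (r := fun s => s) (t := t) tendsto_id (B := fun _ _ => 1)
    (B₀ := fun _ => 1) (M := 1) (.of_forall fun _ => aestronglyMeasurable_const) (by simp)
    (by simp) hψ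
  simpa [ContinuousAt] using this

end BddCont

/-! ### Averages over random shifts and their adjoints -/

section Averaging

variable (μ : Measure ℝ)

/-- The average of the translates of `f` by `μ`-distributed shifts to the right. -/
def avg (f : ℝ → ℝ) (x : ℝ) : ℝ := ∫ a, f (x + a) ∂μ

/-- The formal adjoint of `avg μ`. -/
def adj (ψ : ℝ → ℝ) (y : ℝ) : ℝ := ∫ a, ψ (y - a) ∂μ

variable {μ} [IsProbabilityMeasure μ] {f ψ : ℝ → ℝ} {C : ℝ}

/-- The shear `(x, a) ↦ (x + a, a)` preserves `volume.prod μ`, so null sets of the line pull back to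
null sets of the product. No density of `μ` is needed. -/
lemma aestronglyMeasurable_add_prod (hf : AEStronglyMeasurable f volume) :
    AEStronglyMeasurable (fun z : ℝ × ℝ => f (z.1 + z.2)) (volume.prod μ) :=
  hf.comp_quasiMeasurePreserving
    (Measure.quasiMeasurePreserving_fst.comp
      (measurePreserving_add_prod volume μ).quasiMeasurePreserving)

lemma aestronglyMeasurable_avg (hf : AEStronglyMeasurable f volume) :
    AEStronglyMeasurable (avg μ f) volume :=
  (aestronglyMeasurable_add_prod hf).integral_prod_right'

lemma ae_ae_add (hf : ∀ᵐ x, |f x| ≤ C) : ∀ᵐ x, ∀ᵐ a ∂μ, |f (x + a)| ≤ C :=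
  Measure.ae_ae_of_ae_prod ((Measure.quasiMeasurePreserving_fst.comp
      (measurePreserving_add_prod volume μ).quasiMeasurePreserving).ae hf)

lemma abs_integral_le_of_ae_le {g : ℝ → ℝ} (hg : ∀ᵐ a ∂μ, |g a| ≤ C) : |∫ a, g a ∂μ| ≤ C := by
  simpa using norm_integral_le_of_norm_le_const (μ := μ) (f := g) (C := C) (by simpa using hg)

lemma abs_avg_le (hf : ∀ᵐ x, |f x| ≤ C) : ∀ᵐ x, |avg μ f x| ≤ C := by
  filter_upwards [ae_ae_add (μ := μ) hf] with x hx using abs_integral_le_of_ae_le hx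

lemma integrable_sub_prod (hψ : Integrable ψ) :
    Integrable (fun z : ℝ × ℝ => ψ (z.1 - z.2)) (volume.prod μ) :=
  (measurePreserving_sub_prod volume μ).integrable_comp_of_integrable (hψ.comp_fst μ)

lemma integrable_adj (hψ : Integrable ψ) : Integrable (adj μ ψ) :=
  (integrable_sub_prod hψ).integral_prod_left

/-- Fubini combined with the measure-preserving shear `(x, a) ↦ (x + a, a)`. -/
lemma integral_avg_mul (hf : AEStronglyMeasurable f volume) (hC : ∀ᵐ x, |f x| ≤ C)
    (hψ : Integrable ψ) : ∫ x, avg μ f x * ψ x = ∫ x, f x * adj μ ψ x := by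
  have hmp := measurePreserving_add_prod (volume : Measure ℝ) μ
  have hG : Integrable (fun z : ℝ × ℝ => f z.1 * ψ (z.1 - z.2)) (volume.prod μ) :=
    (integrable_sub_prod hψ).bdd_mul (c := C) hf.comp_fst
      (Measure.quasiMeasurePreserving_fst.ae (by simpa using hC))
  have hF : Integrable (fun z : ℝ × ℝ => f (z.1 + z.2) * ψ z.1) (volume.prod μ) := by
    simpa [Function.comp_def] using hmp.integrable_comp_of_integrable hG
  calc ∫ x, avg μ f x * ψ x = ∫ x, ∫ a, f (x + a) * ψ x ∂μ := by
        simp only [avg, integral_mul_const]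
    _ = ∫ z : ℝ × ℝ, f (z.1 + z.2) * ψ z.1 ∂(volume.prod μ) := (integral_prod _ hF).symm
    _ = ∫ z : ℝ × ℝ, f z.1 * ψ (z.1 - z.2) ∂(volume.prod μ) := by
        conv_rhs => rw [← hmp.map_eq]
        rw [integral_map hmp.measurable.aemeasurable (by rw [hmp.map_eq]; exact hG.1)]
        simp
    _ = ∫ y, ∫ a, f y * ψ (y - a) ∂μ := integral_prod _ hG
    _ = ∫ y, f y * adj μ ψ y := by simp only [adj, integral_const_mul]

/-- Tonelli and translation invariance: an average of translates cannot have larger `L¹` norm. -/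
lemma lintegral_avg_le (hf : AEStronglyMeasurable f volume) :
    ∫⁻ x, ‖avg μ f x‖ₑ ≤ ∫⁻ x, ‖f x‖ₑ := by
  calc ∫⁻ x, ‖avg μ f x‖ₑ ≤ ∫⁻ x, ∫⁻ a, ‖f (x + a)‖ₑ ∂μ :=
        lintegral_mono fun x => enorm_integral_le_lintegral_enorm _
    _ = ∫⁻ a, (∫⁻ x, ‖f (x + a)‖ₑ) ∂μ := by
        exact lintegral_lintegral_swap (f := fun x a => ‖f (x + a)‖ₑ)
          (aestronglyMeasurable_add_prod (μ := μ) hf).enorm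
    _ = ∫⁻ x, ‖f x‖ₑ := by
        have h (a : ℝ) : ∫⁻ x, ‖f (x + a)‖ₑ = ∫⁻ x, ‖f x‖ₑ :=
          lintegral_add_right_eq_self (fun x => ‖f x‖ₑ) a
        simp only [h, lintegral_const, measure_univ, mul_one]

lemma integrable_shift (hf : AEStronglyMeasurable f volume) (hC : ∀ᵐ x, |f x| ≤ C) :
    ∀ᵐ x, Integrable (fun a => f (x + a)) μ := by
  filter_upwards [(aestronglyMeasurable_add_prod (μ := μ) hf).prodMk_left,
    ae_ae_add (μ := μ) hC] with x h1 h2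
  exact Integrable.of_bound h1 C (by simpa using h2)

/-- The average of the differences is dominated by the average of their absolute values, and duality
then moves the averaging onto the weight. Convergence for the integrable weight `adj μ |ψ|` is part
of the hypothesis. -/
lemma BddCont.avg {u : ℝ → ℝ → ℝ} (hu : BddCont u) : BddCont fun t => avg μ (u t) := by
  obtain ⟨C, h0, hC⟩ := hu.bdd
  refine ⟨fun t => aestronglyMeasurable_avg (hu.meas t), ⟨C, h0, fun t => abs_avg_le (hC t)⟩,
    fun ψ hψ t => ?_⟩
  refine squeeze_zero (fun s => integral_nonneg fun x => by positivity) (fun s => ?_)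
    (hu.tendsto (adj μ fun x => |ψ x|) (integrable_adj hψ.abs) t)
  have hm : AEStronglyMeasurable (fun x => |u s x - u t x|) volume :=
    ((hu.meas s).sub (hu.meas t)).norm
  have hb : ∀ᵐ x, |(|u s x - u t x|)| ≤ C + C := by
    filter_upwards [hC s, hC t] with x h1 h2
    rw [abs_abs]
    exact (abs_sub _ _).trans (add_le_add h1 h2)
  have hadj : ∀ y, |adj μ (fun x => |ψ x|) y| = adj μ (fun x => |ψ x|) y := fun y =>
    abs_of_nonneg (integral_nonneg fun _ => abs_nonneg _)
  simp only [hadj]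
  rw [← integral_avg_mul hm hb hψ.abs]
  refine integral_mono_of_nonneg (ae_of_all _ fun x => by positivity)
    (integrable_bdd_mul (aestronglyMeasurable_avg hm) (abs_avg_le hb) hψ.abs) ?_
  filter_upwards [integrable_shift (μ := μ) (hu.meas s) (hC s),
    integrable_shift (μ := μ) (hu.meas t) (hC t)] with x h1 h2
  gcongr
  simp only [NonlocalVelocity.avg]
  rw [← integral_sub h1 h2]
  exact norm_integral_le_integral_norm (μ := μ) (fun a => u s (x + a) - u t (x + a))

end Averaging

/-! ### The exponential kernel and its differential identity -/

section ExponentialLaw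

variable {η : ℝ}

/-- The exponential law with mean `η`. -/
def expLaw (η : ℝ) : Measure ℝ :=
  (volume.restrict (Ioi 0)).withDensity fun a => ENNReal.ofReal (η⁻¹ * Real.exp (-η⁻¹ * a))

lemma integral_expLaw (hη : 0 < η) (g : ℝ → ℝ) :
    ∫ a, g a ∂expLaw η = ∫ a in Ioi 0, η⁻¹ * Real.exp (-η⁻¹ * a) * g a := by
  rw [expLaw, integral_withDensity_eq_integral_toReal_smul (by fun_prop) (by simp)]
  refine integral_congr_ae (ae_of_all _ fun a => ?_)
  simp only [smul_eq_mul]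
  rw [ENNReal.toReal_ofReal (by positivity)]

lemma integrable_expLaw_iff (hη : 0 < η) (g : ℝ → ℝ) :
    Integrable g (expLaw η) ↔ IntegrableOn (fun a => η⁻¹ * Real.exp (-η⁻¹ * a) * g a) (Ioi 0) := by
  rw [expLaw, integrable_withDensity_iff_integrable_smul' (by fun_prop) (by simp), IntegrableOn]
  refine integrable_congr (ae_of_all _ fun a => ?_)
  simp only [smul_eq_mul]
  rw [ENNReal.toReal_ofReal (by positivity)]

lemma isProbabilityMeasure_expLaw (hη : 0 < η) : IsProbabilityMeasure (expLaw η) := by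
  constructor
  rw [expLaw, withDensity_apply _ MeasurableSet.univ, Measure.restrict_univ,
    ← ofReal_integral_eq_lintegral_ofReal]
  · rw [integral_const_mul, integral_exp_mul_Ioi (by simpa using hη)]
    field_simp
    simp
  · exact (exp_neg_integrableOn_Ioi 0 (by positivity)).const_mul _
  · exact ae_of_all _ fun a => by positivity

lemma expLaw_absolutelyContinuous : expLaw η ≪ volume :=
  (withDensity_absolutelyContinuous _ _).trans Measure.absolutelyContinuous_restrict

lemma setIntegral_Ioi_shift (g : ℝ → ℝ) (x : ℝ) :
    ∫ a in Ioi 0, g (x + a) = ∫ y in Ioi x, g y := by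
  rw [← (measurePreserving_add_left volume x).setIntegral_preimage_emb
    (measurableEmbedding_addLeft x) g (Ioi x)]
  simp

/-- Splitting the exponential separates `x` from the integration variable. What remains is a smooth
factor times a tail integral, a form that can be differentiated in `x`. -/
lemma avg_expLaw (hη : 0 < η) (f : ℝ → ℝ) (x : ℝ) :
    avg (expLaw η) f x
      = η⁻¹ * Real.exp (η⁻¹ * x) * ∫ y in Ioi x, Real.exp (-η⁻¹ * y) * f y := by
  rw [avg, integral_expLaw hη, ← integral_const_mul,
    ← setIntegral_Ioi_shift (fun y => η⁻¹ * Real.exp (η⁻¹ * x) * (Real.exp (-η⁻¹ * y) * f y))]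
  congr 1 with a
  rw [show -η⁻¹ * a = η⁻¹ * x + -η⁻¹ * (x + a) by ring, Real.exp_add]
  ring

lemma velocity_eq_avg (hη : 0 < η) (V : ℝ → ℝ) (q : ℝ → ℝ → ℝ) (t x : ℝ) :
    velocity expKernel η V q t x = avg (expLaw η) (fun y => V (q t y)) x := by
  rw [avg_expLaw hη, velocity, mul_assoc, one_div]
  congr 1
  rw [← integral_const_mul]
  refine (setIntegral_congr_fun (s := Ioi x) measurableSet_Ioi fun y _ => ?_)
  rw [expKernel, show -((y - x) / η) = η⁻¹ * x + -η⁻¹ * y by field_simp; ring, Real.exp_add]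
  ring

lemma integrableOn_exp_mul_Ioi (hη : 0 < η) {f : ℝ → ℝ} {C : ℝ}
    (hf : AEStronglyMeasurable f volume) (hC : ∀ᵐ x, |f x| ≤ C) (x : ℝ) :
    IntegrableOn (fun y => Real.exp (-η⁻¹ * y) * f y) (Ioi x) :=
  (exp_neg_integrableOn_Ioi x (inv_pos.mpr hη)).mul_bdd (c := C) hf.restrict
    (ae_restrict_of_ae (by simpa using hC))

lemma integral_Ioi_eq_sub {g : ℝ → ℝ} (hg : ∀ x, IntegrableOn g (Ioi x)) (x : ℝ) :
    ∫ y in Ioi x, g y = (∫ y in Ioi 0, g y) - ∫ y in (0 : ℝ)..x, g y := by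
  rcases le_total 0 x with h | h
  · rw [← intervalIntegral.integral_Ioi_sub_Ioi (hg 0) h]; ring
  · rw [intervalIntegral.integral_symm, ← intervalIntegral.integral_Ioi_sub_Ioi (hg x) h]; ring

/-- The exponential average `W` of `f` satisfies `η W' = W - f`. -/
lemma avg_expLaw_sub (hη : 0 < η) {f : ℝ → ℝ} {C : ℝ}
    (hf : AEStronglyMeasurable f volume) (hC : ∀ᵐ x, |f x| ≤ C) (x y : ℝ) :
    avg (expLaw η) f y - avg (expLaw η) f x
      = ∫ z in x..y, η⁻¹ * (avg (expLaw η) f z - f z) := by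
  have hg := integrableOn_exp_mul_Ioi hη hf hC
  set g : ℝ → ℝ := fun y => Real.exp (-η⁻¹ * y) * f y with hgdef
  have hgloc : LocallyIntegrable g volume :=
    (locallyIntegrable_of_bdd hf hC).continuous_mul (by fun_prop)
  have hW : avg (expLaw η) f = fun x =>
      (η⁻¹ * Real.exp (η⁻¹ * x)) * ((∫ y in Ioi 0, g y) - ∫ y in (0 : ℝ)..x, g y) := by
    ext x
    rw [avg_expLaw hη, integral_Ioi_eq_sub hg x]
  -- As `f` is only bounded and measurable, the product rule holds merely almost everywhere.
  -- Absolute continuity is what recovers increments from that derivative.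
  have hac : AbsolutelyContinuousOnInterval (avg (expLaw η) f) x y := by
    rw [hW]
    refine AbsolutelyContinuousOnInterval.fun_mul ?_ ?_
    · exact ContDiffOn.absolutelyContinuousOnInterval (by fun_prop)
    · refine AbsolutelyContinuousOnInterval.sub
        (ContDiffOn.absolutelyContinuousOnInterval contDiffOn_const) ?_
      -- The primitive is based at `0`, so the interval is first enlarged to contain `0` and then
      -- shrunk.
      refine AbsolutelyContinuousOnInterval.mono (a := min 0 (min x y)) (b := max 0 (max x y)) ?_ ?_
      · exact IntervalIntegrable.absolutelyContinuousOnInterval_intervalIntegral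
          (intervalIntegrable_of_locallyIntegrable hgloc _ _) (by
            rw [uIcc_of_le (by simp)]; simp)
      · rw [uIcc_of_le (by simp : min 0 (min x y) ≤ max 0 (max x y))]
        exact Icc_subset_Icc (min_le_right _ _) (le_max_right _ _)
  rw [← hac.integral_deriv_eq_sub]
  refine intervalIntegral.integral_congr_ae ?_
  filter_upwards [LocallyIntegrable.ae_hasDerivAt_integral hgloc] with z hz _
  have h1 : HasDerivAt (fun x => η⁻¹ * Real.exp (η⁻¹ * x)) (η⁻¹ * (Real.exp (η⁻¹ * z) * η⁻¹)) z := by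
    simpa using (((hasDerivAt_id z).const_mul η⁻¹).exp).const_mul η⁻¹
  have h2 := h1.mul ((hz 0).const_sub (∫ y in Ioi 0, g y))
  have h3 := h2.congr_of_eventuallyEq (.of_eq hW)
  rw [h3.deriv, congrFun hW z, hgdef]
  have h4 : Real.exp (η⁻¹ * z) * Real.exp (-η⁻¹ * z) = 1 := by
    rw [← Real.exp_add]; simp
  linear_combination (-η⁻¹ * f z) * h4

lemma continuous_of_sub_eq_integral {W p : ℝ → ℝ} (hp : LocallyIntegrable p volume)
    (h : ∀ x y, W y - W x = ∫ z in x..y, p z) : Continuous W := by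
  have : W = fun y => W 0 + ∫ z in (0 : ℝ)..y, p z := by
    ext y; rw [← h]; ring
  rw [this]
  exact continuous_const.add (intervalIntegral.continuous_primitive
    (intervalIntegrable_of_locallyIntegrable hp) 0)

/-- A bootstrap: the integral identity makes the average continuous, so for continuous `f` its
integrand is continuous and the fundamental theorem of calculus applies at every point. -/
lemma hasDerivAt_avg_expLaw (hη : 0 < η) {f : ℝ → ℝ} {C : ℝ}
    (hf : Continuous f) (hC : ∀ x, |f x| ≤ C) (x : ℝ) :
    HasDerivAt (avg (expLaw η) f) (η⁻¹ * (avg (expLaw η) f x - f x)) x := by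
  have := isProbabilityMeasure_expLaw hη
  have hm := hf.aestronglyMeasurable (μ := volume)
  have h := avg_expLaw_sub hη hm (ae_of_all _ hC)
  have hloc : LocallyIntegrable (fun z => η⁻¹ * (avg (expLaw η) f z - f z)) volume :=
    ((locallyIntegrable_of_bdd (aestronglyMeasurable_avg hm)
      (abs_avg_le (ae_of_all _ hC))).sub (locallyIntegrable_of_bdd hm (ae_of_all _ hC))).smul η⁻¹
  have hcont : Continuous (avg (expLaw η) f) := continuous_of_sub_eq_integral hloc h
  have hW : avg (expLaw η) f = fun y =>
      avg (expLaw η) f x + ∫ z in x..y, η⁻¹ * (avg (expLaw η) f z - f z) := by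
    ext y; rw [← h]; ring
  rw [hW]
  refine HasDerivAt.const_add _ ?_
  rw [← hW]
  have hc : Continuous fun z => η⁻¹ * (avg (expLaw η) f z - f z) :=
    continuous_const.mul (hcont.sub hf)
  exact intervalIntegral.integral_hasDerivAt_right (hc.intervalIntegrable _ _)
    (hc.stronglyMeasurableAtFilter _ _) hc.continuousAt

/-- Reflection exchanges `adj` and `avg`, which flips the sign in the differential identity. -/
lemma hasDerivAt_adj_expLaw (hη : 0 < η) {ψ : ℝ → ℝ} {C : ℝ}
    (hψ : Continuous ψ) (hC : ∀ x, |ψ x| ≤ C) (y : ℝ) :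
    HasDerivAt (adj (expLaw η) ψ) (η⁻¹ * (ψ y - adj (expLaw η) ψ y)) y := by
  have h : adj (expLaw η) ψ = fun y => avg (expLaw η) (fun x => ψ (-x)) (-y) := by
    ext y
    simp only [adj, avg, neg_add_rev, neg_neg, sub_eq_neg_add]
  have h1 := hasDerivAt_avg_expLaw hη (f := fun x => ψ (-x)) (by fun_prop) (fun x => hC _) (-y)
  have h2 := h1.comp y (hasDerivAt_neg y)
  rw [congrFun h y]
  conv in adj (expLaw η) ψ => rw [h]
  convert! h2 using 1
  simp only [neg_neg]
  ring

end ExponentialLaw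

/-! ### Cutoffs and balance laws integrated in time -/

/-- Smooth cutoff functions exhausting the line, with uniformly decaying derivatives. -/
lemma exists_cutoff : ∃ (D : ℝ) (χ : ℕ → ℝ → ℝ), 0 ≤ D ∧ ∀ n, ContDiff ℝ 1 (χ n) ∧
    HasCompactSupport (χ n) ∧ (∀ x, 0 ≤ χ n x ∧ χ n x ≤ 1) ∧
    (∀ x, |deriv (χ n) x| ≤ D / (n + 1)) ∧ ∀ x : ℝ, |x| ≤ n + 1 → χ n x = 1 := by
  let f : ContDiffBump (0 : ℝ) := ⟨1, 2, by norm_num, by norm_num⟩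
  have hf : ContDiff ℝ 1 (f : ℝ → ℝ) := f.contDiff (n := 1)
  obtain ⟨D, hD⟩ := (hf.continuous_deriv le_rfl).bounded_above_of_compact_support
    f.hasCompactSupport.deriv
  refine ⟨D, fun n x => f ((n + 1 : ℝ)⁻¹ * x), (norm_nonneg _).trans (hD 0), fun n =>
    ⟨hf.comp (contDiff_const.mul contDiff_id), ?_, fun x => ⟨f.nonneg, f.le_one⟩,
      fun x => ?_, fun x hx => ?_⟩⟩
  · exact f.hasCompactSupport.comp_homeomorph (Homeomorph.mulLeft₀ ((n + 1 : ℝ)⁻¹) (by positivity))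
  · rw [deriv_comp_mul_left, smul_eq_mul, abs_mul, abs_of_pos (by positivity),
      div_eq_inv_mul]
    gcongr
    exact hD _
  · refine f.one_of_mem_closedBall ?_
    rw [mem_closedBall_zero_iff, Real.norm_eq_abs, abs_mul, abs_of_pos (by positivity),
      ← div_eq_inv_mul]
    exact div_le_one_of_le₀ hx (by positivity)

lemma tendsto_of_eq_one {χ : ℕ → ℝ → ℝ} (h : ∀ (n : ℕ) (x : ℝ), |x| ≤ n + 1 → χ n x = 1) (x : ℝ) :
    Tendsto (fun n => χ n x) atTop (𝓝 1) := by
  refine tendsto_const_nhds.congr' ?_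
  filter_upwards [eventually_ge_atTop ⌈|x|⌉₊] with n hn
  exact (h n x ((Nat.ceil_le.mp hn).trans (by simp))).symm

lemma integrable_of_test {ψ : ℝ → ℝ} (h : ContDiff ℝ 1 ψ) (hc : HasCompactSupport ψ) :
    Integrable ψ := h.continuous.integrable_of_hasCompactSupport hc

lemma integrable_deriv_of_test {ψ : ℝ → ℝ} (h : ContDiff ℝ 1 ψ) (hc : HasCompactSupport ψ) :
    Integrable (deriv ψ) :=
  (h.continuous_deriv le_rfl).integrable_of_hasCompactSupport hc.deriv

/-- The balance law `∂ₜ u + ∂ₓ f = R` on `[0,T] × ℝ`, in the weak form integrated over time. -/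
def BalanceLaw (T : ℝ) (u f R : ℝ → ℝ → ℝ) : Prop :=
  ∀ ψ : ℝ → ℝ, ContDiff ℝ 1 ψ → HasCompactSupport ψ → ∀ s t, 0 ≤ s → s ≤ t → t ≤ T →
    (∫ x, u t x * ψ x) - ∫ x, u s x * ψ x
      = ∫ r in s..t, ((∫ x, f r x * deriv ψ x) + ∫ x, R r x * ψ x)

lemma BddCont.abs_integral_le {u : ℝ → ℝ → ℝ} {C : ℝ}
    (hC : ∀ t, ∀ᵐ x, |u t x| ≤ C) {ψ φ : ℝ → ℝ} (hφ : Integrable φ)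
    (h : ∀ x, |ψ x| ≤ φ x) (t : ℝ) : |∫ x, u t x * ψ x| ≤ C * ∫ x, φ x := by
  rw [← integral_const_mul]
  refine (norm_integral_le_integral_norm fun x => u t x * ψ x).trans (integral_mono_of_nonneg
    (ae_of_all _ fun x => norm_nonneg (u t x * ψ x)) (hφ.const_mul C) ?_)
  filter_upwards [hC t] with x hx
  rw [Real.norm_eq_abs, abs_mul]
  exact mul_le_mul hx (h x) (abs_nonneg _) ((abs_nonneg _).trans hx)

lemma BddCont.tendsto_integral_of_dominated {u : ℝ → ℝ → ℝ} (hu : BddCont u) {ψ : ℕ → ℝ → ℝ}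
    {ψ₀ φ : ℝ → ℝ} (hφ : Integrable φ) (hm : ∀ n, AEStronglyMeasurable (ψ n) volume)
    (hb : ∀ n x, |ψ n x| ≤ φ x)
    (hlim : ∀ x, Tendsto (fun n => ψ n x) atTop (𝓝 (ψ₀ x))) (t : ℝ) :
    Tendsto (fun n => ∫ x, u t x * ψ n x) atTop (𝓝 (∫ x, u t x * ψ₀ x)) := by
  obtain ⟨C, h0, hC⟩ := hu.bdd
  refine tendsto_integral_of_dominated_convergence (fun x => C * φ x)
    (fun n => (hu.meas t).mul (hm n)) (hφ.const_mul C) (fun n => ?_)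
    (ae_of_all _ fun x => (hlim x).const_mul _)
  filter_upwards [hC t] with x hx
  rw [Real.norm_eq_abs, abs_mul]
  exact mul_le_mul hx (hb n x) (abs_nonneg _) h0

/-- A balance law with bounded data may be tested with integrable `C¹` functions. -/
lemma BalanceLaw.extend {T : ℝ} {u f R : ℝ → ℝ → ℝ} (h : BalanceLaw T u f R) (hu : BddCont u)
    (hf : BddCont f) (hR : BddCont R) {ψ : ℝ → ℝ} (hψ : ContDiff ℝ 1 ψ) (hi : Integrable ψ)
    (hi' : Integrable (deriv ψ)) {s t : ℝ} (hs : 0 ≤ s) (hst : s ≤ t) (ht : t ≤ T) :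
    (∫ x, u t x * ψ x) - ∫ x, u s x * ψ x
      = ∫ r in s..t, ((∫ x, f r x * deriv ψ x) + ∫ x, R r x * ψ x) := by
  obtain ⟨D, χ, hD, hχ⟩ := exists_cutoff
  have hdχ : ∀ n x, |deriv (χ n) x| ≤ D := fun n x =>
    ((hχ n).2.2.2.1 x).trans (div_le_self hD (by linarith [n.cast_nonneg (α := ℝ)]))
  have habs : ∀ n x, |χ n x| ≤ 1 := fun n x => by
    rw [abs_of_nonneg ((hχ n).2.2.1 x).1]; exact ((hχ n).2.2.1 x).2
  have hderiv : ∀ n x, deriv (fun x => χ n x * ψ x) x = deriv (χ n) x * ψ x + χ n x * deriv ψ x :=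
    fun n x => deriv_fun_mul ((hχ n).1.differentiable one_ne_zero x)
      (hψ.differentiable one_ne_zero x)
  have hc1 : ∀ n, ContDiff ℝ 1 (fun x => χ n x * ψ x) := fun n => (hχ n).1.mul hψ
  have hdlim : ∀ x, Tendsto (fun n => deriv (χ n) x) atTop (𝓝 0) := fun x =>
    squeeze_zero_norm (fun n => (hχ n).2.2.2.1 x)
      (tendsto_const_nhds.div_atTop (tendsto_natCast_atTop_atTop.atTop_add tendsto_const_nhds))
  have hlim : ∀ x, Tendsto (fun n => χ n x) atTop (𝓝 1) :=
    tendsto_of_eq_one fun n => (hχ n).2.2.2.2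
  have hb1 : ∀ n x, |χ n x * ψ x| ≤ |ψ x| := fun n x => by
    rw [abs_mul]; exact mul_le_of_le_one_left (abs_nonneg _) (habs n x)
  have hb2 : ∀ n x, |deriv (fun x => χ n x * ψ x) x| ≤ D * |ψ x| + |deriv ψ x| := fun n x => by
    rw [hderiv]
    refine (abs_add_le _ _).trans (add_le_add ?_ ?_)
    · rw [abs_mul]; gcongr; exact hdχ n x
    · rw [abs_mul]; exact mul_le_of_le_one_left (abs_nonneg _) (habs n x)
  have hi2 : Integrable fun x => D * |ψ x| + |deriv ψ x| := (hi.abs.const_mul D).add hi'.abs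
  have hl1 : ∀ x, Tendsto (fun n => χ n x * ψ x) atTop (𝓝 (ψ x)) := fun x => by
    simpa using (hlim x).mul_const (ψ x)
  have hl2 : ∀ x, Tendsto (fun n => deriv (fun x => χ n x * ψ x) x) atTop (𝓝 (deriv ψ x)) :=
    fun x => by
      simp only [hderiv]
      simpa using ((hdlim x).mul_const (ψ x)).add ((hlim x).mul_const (deriv ψ x))
  have hm1 : ∀ n, AEStronglyMeasurable (fun x => χ n x * ψ x) volume := fun n =>
    (hc1 n).continuous.aestronglyMeasurable
  have hm2 : ∀ n, AEStronglyMeasurable (deriv fun x => χ n x * ψ x) volume := fun n =>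
    ((hc1 n).continuous_deriv le_rfl).aestronglyMeasurable
  have hLHS := (hu.tendsto_integral_of_dominated hi.abs hm1 hb1 hl1 t).sub
    (hu.tendsto_integral_of_dominated hi.abs hm1 hb1 hl1 s)
  obtain ⟨C₁, hC₁, hfC⟩ := hf.bdd
  obtain ⟨C₂, hC₂, hRC⟩ := hR.bdd
  have hRHS : Tendsto (fun n => ∫ r in s..t, ((∫ x, f r x * deriv (fun x => χ n x * ψ x) x)
      + ∫ x, R r x * (χ n x * ψ x))) atTop
      (𝓝 (∫ r in s..t, ((∫ x, f r x * deriv ψ x) + ∫ x, R r x * ψ x))) := by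
    refine intervalIntegral.tendsto_integral_filter_of_dominated_convergence
      (fun _ => C₁ * (∫ x, D * |ψ x| + |deriv ψ x|) + C₂ * ∫ x, |ψ x|) ?_ ?_ ?_ ?_
    · refine .of_forall fun n => Continuous.aestronglyMeasurable ?_
      exact (hf.continuous_integral (integrable_deriv_of_test (hc1 n)
        ((hχ n).2.1.mul_right))).add (hR.continuous_integral (integrable_of_test (hc1 n)
        ((hχ n).2.1.mul_right)))
    · refine .of_forall fun n => ae_of_all _ fun r _ => ?_
      exact (abs_add_le _ _).trans (add_le_add (BddCont.abs_integral_le hfC hi2 (hb2 n) r)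
        (BddCont.abs_integral_le hRC hi.abs (hb1 n) r))
    · exact intervalIntegrable_const
    · exact ae_of_all _ fun r _ => (hf.tendsto_integral_of_dominated hi2 hm2 hb2 hl2 r).add
        (hR.tendsto_integral_of_dominated hi.abs hm1 hb1 hl1 r)
  refine tendsto_nhds_unique hLHS (hRHS.congr fun n => ?_)
  exact (h _ (hc1 n) ((hχ n).2.1.mul_right) s t hs hst ht).symm

/-! ### From the weak formulation to an integrated balance law -/

/-- This is the weak form of `g' = G`, `g(0) = g₀`. Given a smooth `χ` supported in `(0,T)`, it is
tested with an antiderivative of `χ` that vanishes near `T`. Integrating the candidate `Γ` by parts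
against the same function cancels `G` and `g₀`, leaving `∫ χ (g - Γ) = 0`. -/
lemma eq_primitive_of_weak {g G : ℝ → ℝ} {g₀ T : ℝ} (hT : 0 < T) (hg : Continuous g)
    (hG : Continuous G)
    (h : ∀ θ : ℝ → ℝ, ContDiff ℝ 1 θ → HasCompactSupport θ → tsupport θ ⊆ Ioo (-42) T →
      (∫ t in Ioo 0 T, (deriv θ t * g t + θ t * G t)) + θ 0 * g₀ = 0) :
    ∀ t ∈ Icc 0 T, g t = g₀ + ∫ r in (0 : ℝ)..t, G r := by
  set Γ : ℝ → ℝ := fun t => g₀ + ∫ r in (0 : ℝ)..t, G r with hΓ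
  have hΓd : ∀ t, HasDerivAt Γ (G t) t := fun t =>
    (intervalIntegral.integral_hasDerivAt_right (hG.intervalIntegrable _ _)
      (hG.stronglyMeasurableAtFilter _ _) hG.continuousAt).const_add _
  have hΓc : Continuous Γ := continuous_iff_continuousAt.mpr fun t => (hΓd t).continuousAt
  have key : ∀ χ : ℝ → ℝ, ContDiff ℝ (↑(⊤ : ℕ∞)) χ → HasCompactSupport χ →
      tsupport χ ⊆ Ioo 0 T → ∫ x, χ x • (g x - Γ x) = 0 := by
    intro χ hχ hχc hχs
    obtain ⟨b, hbT, hb⟩ : ∃ b < T, ∀ x, b ≤ x → χ x = 0 := by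
      rcases (tsupport χ).eq_empty_or_nonempty with he | hne
      · exact ⟨T - 1, by linarith, fun x _ =>
          image_eq_zero_of_notMem_tsupport (by rw [he]; exact notMem_empty x)⟩
      · obtain ⟨m, hm, hmax⟩ := IsCompact.exists_isMaxOn hχc hne continuousOn_id
        refine ⟨(m + T) / 2, by linarith [(hχs hm).2], fun x hx => ?_⟩
        refine image_eq_zero_of_notMem_tsupport fun hx' => ?_
        have := hmax hx'
        simp only [id, mem_ofPred_eq] at this
        linarith [(hχs hm).2]
    have hχcont := hχ.continuous
    -- The base point `T` makes the antiderivative vanish near the final time. Its value at `0`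
    -- stays free, which is how the initial datum is detected.
    set I : ℝ → ℝ := fun t => ∫ r in T..t, χ r with hI
    have hId : ∀ t, HasDerivAt I (χ t) t := fun t =>
      intervalIntegral.integral_hasDerivAt_right (hχcont.intervalIntegrable _ _)
        (hχcont.stronglyMeasurableAtFilter _ _) hχcont.continuousAt
    have hI1 : ContDiff ℝ 1 I := by
      rw [contDiff_one_iff_deriv]
      refine ⟨fun t => (hId t).differentiableAt, ?_⟩
      rw [funext fun t => (hId t).deriv]
      exact hχcont
    have hI0 : ∀ t, b ≤ t → I t = 0 := by
      intro t ht
      refine intervalIntegral.integral_zero_ae (ae_of_all _ fun r hr => hb r ?_)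
      rcases (mem_uIoc.mp hr) with h | h <;> linarith [h.1, h.2]
    -- A cutoff in negative time: it is `0` up to `-2` and `1` from `-1` on. The product is thus
    -- supported in `[-2, b]`, inside `(-42, T)`, and is unchanged for positive times.
    set κ : ℝ → ℝ := fun t => Real.smoothTransition (t + 2) with hκ
    have hκ1 : ContDiff ℝ 1 κ :=
      (Real.smoothTransition.contDiff (n := 1)).comp (contDiff_id.add contDiff_const)
    set θ : ℝ → ℝ := fun t => κ t * I t with hθ
    have hsupp : Function.support θ ⊆ Icc (-2) b := by
      intro t ht
      rw [Function.mem_support] at ht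
      refine ⟨?_, ?_⟩
      · by_contra! hlt
        exact ht (by simp [hθ, hκ, Real.smoothTransition.zero_of_nonpos (by linarith : t + 2 ≤ 0)])
      · by_contra! hlt
        exact ht (by simp [hθ, hI0 t hlt.le])
    have htsupp : tsupport θ ⊆ Icc (-2) b := closure_minimal hsupp isClosed_Icc
    have hθ1 : ContDiff ℝ 1 θ := hκ1.mul hI1
    have hθc : HasCompactSupport θ := .of_support_subset_isCompact isCompact_Icc hsupp
    have hw := h θ hθ1 hθc
      (htsupp.trans fun x hx => ⟨by linarith [hx.1], lt_of_le_of_lt hx.2 hbT⟩)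
    have hθI : ∀ t, 0 < t → θ =ᶠ[𝓝 t] I := fun t ht => by
      filter_upwards [lt_mem_nhds ht] with r hr
      simp [hθ, hκ, Real.smoothTransition.one_of_one_le (by linarith : 1 ≤ r + 2)]
    have hθχ : ∀ t, 0 < t → deriv θ t = χ t := fun t ht => by
      rw [(hθI t ht).deriv_eq, (hId t).deriv]
    have hθd : ∀ t, HasDerivAt θ (deriv θ t) t := fun t =>
      (hθ1.differentiable one_ne_zero t).hasDerivAt
    have hθ'c : Continuous (deriv θ) := hθ1.continuous_deriv le_rfl
    have hθT : θ T = 0 := by simp [hθ, hI]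
    have hftc : ∫ t in (0 : ℝ)..T, (deriv θ t * Γ t + θ t * G t) = θ T * Γ T - θ 0 * Γ 0 :=
      intervalIntegral.integral_eq_sub_of_hasDerivAt (fun t _ => (hθd t).mul (hΓd t))
        (((hθ'c.mul hΓc).add (hθ1.continuous.mul hG)).intervalIntegrable _ _)
    have hΓ0 : Γ 0 = g₀ := by simp [hΓ]
    rw [hθT, zero_mul, zero_sub, hΓ0] at hftc
    rw [← integral_Ioc_eq_integral_Ioo, ← intervalIntegral.integral_of_le hT.le] at hw
    have hdiff : ∫ t in (0 : ℝ)..T, deriv θ t * (g t - Γ t) = 0 := by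
      have h1 : (fun t => deriv θ t * (g t - Γ t)) =
          fun t => (deriv θ t * g t + θ t * G t) - (deriv θ t * Γ t + θ t * G t) := by
        ext t; ring
      have h2 : Continuous fun t => deriv θ t * g t + θ t * G t := by fun_prop
      have h3 : Continuous fun t => deriv θ t * Γ t + θ t * G t := by fun_prop
      rw [h1, intervalIntegral.integral_sub (h2.intervalIntegrable _ _)
        (h3.intervalIntegrable _ _), hftc]
      linarith
    rw [← hdiff, intervalIntegral.integral_of_le hT.le, integral_Ioc_eq_integral_Ioo,
      ← setIntegral_eq_integral_of_forall_compl_eq_zero (s := Ioo 0 T)]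
    · refine setIntegral_congr_fun measurableSet_Ioo fun t ht => ?_
      simp only [smul_eq_mul, hθχ t ht.1]
    · intro x hx
      rw [image_eq_zero_of_notMem_tsupport fun hx' => hx (hχs hx'), zero_smul]
  have hae := isOpen_Ioo.ae_eq_zero_of_integral_contDiff_smul_eq_zero (μ := volume)
    ((hg.sub hΓc).locallyIntegrable.locallyIntegrableOn (Ioo 0 T)) key
  have hEq : EqOn g Γ (Ioo 0 T) := by
    refine Measure.eqOn_open_of_ae_eq (μ := volume) ?_ isOpen_Ioo hg.continuousOn hΓc.continuousOn
    refine (ae_restrict_iff' measurableSet_Ioo).mpr ?_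
    filter_upwards [hae] with x hx hx' using sub_eq_zero.mp (hx hx')
  have := hEq.closure hg hΓc
  rw [closure_Ioo hT.ne] at this
  exact this

/-- The projection of the real line onto `[0,T]`. -/
def clamp (T t : ℝ) : ℝ := max 0 (min t T)

lemma clamp_mem {T : ℝ} (hT : 0 < T) (t : ℝ) : clamp T t ∈ Icc 0 T :=
  ⟨le_max_left _ _, max_le hT.le (min_le_right _ _)⟩

lemma clamp_of_mem {T t : ℝ} (ht : t ∈ Icc 0 T) : clamp T t = t := by
  rw [clamp, min_eq_left ht.2, max_eq_right ht.1]

lemma continuous_clamp (T : ℝ) : Continuous (clamp T) := by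
  unfold clamp; fun_prop

/-- A subset of full measure in `(0,T)` is dense in `[0,T]`. Together with continuity in time, this
upgrades bounds valid for almost every time to every time, end points included. -/
lemma frequently_of_ae_Ioo {T : ℝ} (hT : 0 < T) {P : ℝ → Prop}
    (h : ∀ᵐ s ∂(volume.restrict (Ioo 0 T)), P s) {t : ℝ} (ht : t ∈ Icc 0 T) :
    ∃ᶠ s in 𝓝[Icc 0 T] t, P s := by
  rw [ae_restrict_iff' measurableSet_Ioo] at h
  have hd := (Measure.dense_of_ae h).open_subset_closure_inter (isOpen_Ioo (a := 0) (b := T))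
  have hcl : t ∈ closure (Ioo 0 T ∩ {s | s ∈ Ioo 0 T → P s}) := by
    have := closure_minimal hd isClosed_closure
    rw [closure_Ioo hT.ne] at this
    exact this ht
  rw [mem_closure_iff_frequently] at hcl
  rw [frequently_nhdsWithin_iff]
  exact hcl.mono fun s hs => ⟨hs.2 hs.1, Ioo_subset_Icc_self hs.1⟩

lemma ae_abs_le_of_eLpNorm_top_le {f : ℝ → ℝ} {C : ℝ} (hC : 0 ≤ C)
    (h : eLpNorm f ⊤ volume ≤ ENNReal.ofReal C) : ∀ᵐ x, |f x| ≤ C := by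
  rw [eLpNorm_exponent_top] at h
  filter_upwards [ae_le_eLpNormEssSup (f := f) (μ := volume)] with x hx
  have := hx.trans h
  rwa [Real.enorm_eq_ofReal_abs, ENNReal.ofReal_le_ofReal_iff hC] at this

/-- At a good time `s`, the excess `(|q t x| - C)⁺` is at most `|q s x - q t x|`. Integrating over a
compact set and letting `s → t` through good times makes the excess vanish. -/
lemma ae_abs_le_of_ae_time {T C : ℝ} (hT : 0 < T) {q : ℝ → ℝ → ℝ} (hq : ContinuousInL1loc T q)
    (h : ∀ᵐ t ∂(volume.restrict (Ioo 0 T)), ∀ᵐ x, |q t x| ≤ C) {t : ℝ} (ht : t ∈ Icc 0 T) :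
    ∀ᵐ x, |q t x| ≤ C := by
  have hloc : ∀ n : ℕ, ∀ᵐ x ∂(volume.restrict (Icc (-n : ℝ) n)), |q t x| ≤ C := by
    intro n
    have hlim := hq.2 _ (isCompact_Icc (a := (-n : ℝ)) (b := n)) t ht
    have hle : ∫⁻ x in Icc (-n : ℝ) n, ENNReal.ofReal (|q t x| - C) ≤ 0 := by
      refine ge_of_tendsto_of_frequently hlim ((frequently_of_ae_Ioo hT h ht).mono fun s hs => ?_)
      refine lintegral_mono_ae (ae_restrict_of_ae ?_)
      filter_upwards [hs] with x hx
      rw [Real.enorm_eq_ofReal_abs]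
      refine ENNReal.ofReal_le_ofReal ?_
      have := abs_sub_abs_le_abs_sub (q t x) (q s x)
      rw [abs_sub_comm] at this
      linarith
    have hm : AEMeasurable (fun x => ENNReal.ofReal (|q t x| - C))
        (volume.restrict (Icc (-n : ℝ) n)) := by
      have := ((hq.1 t ht).aestronglyMeasurable.aemeasurable).restrict (s := Icc (-n : ℝ) n)
      fun_prop
    have := (lintegral_eq_zero_iff' hm).mp (le_antisymm hle zero_le)
    filter_upwards [this] with x hx
    simpa using hx
  have hU : (⋃ n : ℕ, Icc (-n : ℝ) n) = univ := by
    refine eq_univ_of_forall fun x => mem_iUnion.mpr ⟨⌈|x|⌉₊, ?_⟩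
    exact abs_le.mp (Nat.le_ceil |x|)
  rw [← Measure.restrict_univ (μ := (volume : Measure ℝ)), ← hU, ae_restrict_iUnion_iff]
  exact hloc

/-- The weight is approximated in `L¹` by a continuous compactly supported one. The uniform bound
absorbs the error, and local `L¹` continuity treats the compact part. Clamping the time makes the
family defined and continuous on the whole line. -/
lemma bddCont_clamp {T C : ℝ} (hT : 0 < T) (hC0 : 0 ≤ C) {q : ℝ → ℝ → ℝ}
    (hq : ContinuousInL1loc T q) (hC : ∀ t ∈ Icc 0 T, ∀ᵐ x, |q t x| ≤ C) :
    BddCont fun t => q (clamp T t) := by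
  refine ⟨fun t => (hq.1 _ (clamp_mem hT t)).aestronglyMeasurable,
    ⟨C, hC0, fun t => hC _ (clamp_mem hT t)⟩, fun ψ hψ t => ?_⟩
  rw [Metric.tendsto_nhds]
  intro ε hε
  -- This tolerance will be multiplied by `2 * C`, and the one chosen below by `B`. Each product
  -- stays under `ε / 2`, and adding `1` keeps the denominators positive.
  obtain ⟨φ, hφc, hφ, hφcont, hφi⟩ :=
    hψ.exists_hasCompactSupport_integral_sub_le (ε := ε / (4 * (C + 1))) (by positivity)
  obtain ⟨B, hB⟩ := hφcont.bounded_above_of_compact_support hφc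
  have hB0 : 0 ≤ B := (norm_nonneg _).trans (hB 0)
  have hlim : Tendsto (fun s => ∫⁻ x in tsupport φ, ‖q (clamp T s) x - q (clamp T t) x‖ₑ) (𝓝 t)
      (𝓝 0) := by
    refine (hq.2 _ hφc (clamp T t) (clamp_mem hT t)).comp ?_
    exact tendsto_nhdsWithin_iff.mpr ⟨(continuous_clamp T).continuousAt,
      .of_forall fun s => clamp_mem hT s⟩
  filter_upwards [hlim.eventually_lt_const (u := ENNReal.ofReal (ε / (2 * (B + 1))))
    (by simp; positivity)] with s hs
  set w : ℝ → ℝ := fun x => |q (clamp T s) x - q (clamp T t) x| with hw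
  have hwm : AEStronglyMeasurable w volume :=
    ((hq.1 _ (clamp_mem hT s)).sub (hq.1 _ (clamp_mem hT t))).aestronglyMeasurable.norm
  have hwb : ∀ᵐ x, |w x| ≤ 2 * C := by
    filter_upwards [hC _ (clamp_mem hT s), hC _ (clamp_mem hT t)] with x h1 h2
    rw [hw, abs_abs]
    exact (abs_sub _ _).trans (by linarith)
  have hwK : IntegrableOn w (tsupport φ) := (locallyIntegrable_of_bdd hwm hwb).integrableOn_isCompact hφc
  have hs' : ∫ x in tsupport φ, w x < ε / (2 * (B + 1)) := by
    rw [integral_eq_lintegral_of_nonneg_ae (ae_of_all _ fun x => abs_nonneg _) hwm.restrict]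
    refine ENNReal.toReal_lt_of_lt_ofReal (lt_of_le_of_lt (le_of_eq ?_) hs)
    simp only [Real.enorm_eq_ofReal_abs]
  rw [Real.dist_eq, sub_zero, abs_of_nonneg (integral_nonneg fun x => by positivity)]
  have hi1 : Integrable fun x => w x * |φ x| := integrable_bdd_mul hwm hwb hφi.abs
  have hi2 : Integrable fun x => 2 * C * ‖ψ x - φ x‖ := ((hψ.sub hφi).norm).const_mul _
  calc ∫ x, w x * |ψ x| ≤ ∫ x, (w x * |φ x| + 2 * C * ‖ψ x - φ x‖) := by
        refine integral_mono_ae (integrable_bdd_mul hwm hwb hψ.abs) (hi1.add hi2) ?_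
        filter_upwards [hwb] with x hx
        have h0 : 0 ≤ w x := abs_nonneg _
        rw [abs_of_nonneg h0] at hx
        have h1 : |ψ x| ≤ |φ x| + |ψ x - φ x| := by
          have := abs_add_le (φ x) (ψ x - φ x); simpa using this
        calc w x * |ψ x| ≤ w x * (|φ x| + |ψ x - φ x|) := by gcongr
          _ ≤ w x * |φ x| + 2 * C * |ψ x - φ x| := by rw [mul_add]; gcongr
    _ = (∫ x, w x * |φ x|) + 2 * C * ∫ x, ‖ψ x - φ x‖ := by
        rw [integral_add hi1 hi2, integral_const_mul]
    _ ≤ B * (∫ x in tsupport φ, w x) + 2 * C * (ε / (4 * (C + 1))) := by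
        gcongr
        rw [← integral_const_mul, ← setIntegral_eq_integral_of_forall_compl_eq_zero
          (s := tsupport φ)]
        · refine setIntegral_mono hi1.integrableOn (hwK.const_mul B) fun x => ?_
          rw [mul_comm]
          have h0 : 0 ≤ w x := abs_nonneg _
          exact mul_le_mul_of_nonneg_right (hB x) h0
        · intro x hx
          rw [image_eq_zero_of_notMem_tsupport hx, abs_zero, mul_zero]
    _ ≤ B * (ε / (2 * (B + 1))) + 2 * C * (ε / (4 * (C + 1))) := by gcongr
    _ < ε := by
        have h1 : B * (ε / (2 * (B + 1))) < ε / 2 := by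
          rw [mul_div_assoc', div_lt_div_iff₀ (by positivity) (by positivity)]
          nlinarith
        have h2 : 2 * C * (ε / (4 * (C + 1))) < ε / 2 := by
          rw [mul_div_assoc', div_lt_div_iff₀ (by positivity) (by positivity)]
          nlinarith
        linarith

/-- Lower semicontinuity: each test integral is continuous in time, so it inherits the bound before
the supremum is taken. -/
lemma totalVariation_le_of_ae_time {T C : ℝ} (hT : 0 < T) {q : ℝ → ℝ → ℝ}
    (hu : BddCont fun t => q (clamp T t))
    (h : ∀ᵐ t ∂(volume.restrict (Ioo 0 T)), totalVariation (q t) ≤ ENNReal.ofReal C) {t : ℝ}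
    (ht : t ∈ Icc 0 T) : totalVariation (q t) ≤ ENNReal.ofReal C := by
  refine iSup₂_le fun φ hφ => ?_
  have hcont := hu.continuous_integral (integrable_deriv_of_test hφ.1 hφ.2.1)
  have hlim : Tendsto (fun s => ENNReal.ofReal (∫ x, q (clamp T s) x * deriv φ x)) (𝓝[Icc 0 T] t)
      (𝓝 (ENNReal.ofReal (∫ x, q (clamp T t) x * deriv φ x))) :=
    ((ENNReal.continuous_ofReal.comp hcont).tendsto t).mono_left nhdsWithin_le_nhds
  rw [clamp_of_mem ht] at hlim
  refine le_of_tendsto_of_frequently hlim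
    (((frequently_of_ae_Ioo hT h ht).and_eventually self_mem_nhdsWithin).mono fun s hs => ?_)
  rw [clamp_of_mem hs.2]
  exact (le_iSup₂_of_le φ hφ le_rfl).trans hs.1

/-- Testing with products `θ(t) ψ(x)` reduces the equation, for each fixed `ψ`, to a scalar weak
differential equation for `∫ u ψ`. -/
lemma balanceLaw_of_weak {T : ℝ} (hT : 0 < T) {q₀ : ℝ → ℝ} {u W : ℝ → ℝ → ℝ}
    (hu : BddCont u) (hW : BddCont W)
    (h : ∀ φ : ℝ × ℝ → ℝ, ContDiff ℝ 1 φ → HasCompactSupport φ →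
      tsupport φ ⊆ Ioo (-42) T ×ˢ univ →
      (∫ t in Ioo 0 T, ∫ x, u t x *
        (deriv (fun s => φ (s, x)) t + W t x * deriv (fun y => φ (t, y)) x))
      + ∫ x, q₀ x * φ (0, x) = 0) :
    BalanceLaw T u (fun t x => W t x * u t x) (fun _ _ => 0) ∧
    ∀ ψ : ℝ → ℝ, ContDiff ℝ 1 ψ → HasCompactSupport ψ → ∫ x, u 0 x * ψ x = ∫ x, q₀ x * ψ x := by
  have hf : BddCont fun t x => W t x * u t x := hW.mul hu
  have key : ∀ ψ : ℝ → ℝ, ContDiff ℝ 1 ψ → HasCompactSupport ψ → ∀ t ∈ Icc 0 T,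
      ∫ x, u t x * ψ x = (∫ x, q₀ x * ψ x)
        + ∫ r in (0 : ℝ)..t, ∫ x, W r x * u r x * deriv ψ x := by
    intro ψ hψ hψc
    have hψi := integrable_of_test hψ hψc
    have hψi' := integrable_deriv_of_test hψ hψc
    refine eq_primitive_of_weak hT (hu.continuous_integral hψi) (hf.continuous_integral hψi') ?_
    intro θ hθ hθc hθs
    have hsub : tsupport (fun z : ℝ × ℝ => θ z.1 * ψ z.2) ⊆ tsupport θ ×ˢ tsupport ψ := by
      refine closure_minimal (fun z hz => ?_) ((isClosed_tsupport θ).prod (isClosed_tsupport ψ))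
      rw [Function.mem_support] at hz
      exact ⟨subset_tsupport _ (left_ne_zero_of_mul hz),
        subset_tsupport _ (right_ne_zero_of_mul hz)⟩
    have hw := h (fun z => θ z.1 * ψ z.2)
      ((hθ.comp contDiff_fst).mul (hψ.comp contDiff_snd))
      (IsCompact.of_isClosed_subset (hθc.isCompact.prod hψc.isCompact) (isClosed_tsupport _) hsub)
      (hsub.trans fun z hz => ⟨hθs hz.1, mem_univ _⟩)
    refine Eq.trans ?_ hw
    congr 1
    · refine setIntegral_congr_fun measurableSet_Ioo fun t _ => ?_
      simp only
      rw [← integral_const_mul, ← integral_const_mul, ← integral_add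
        ((hu.integrable_mul hψi t).const_mul _) ((hf.integrable_mul hψi' t).const_mul _)]
      refine integral_congr_ae (ae_of_all _ fun x => ?_)
      simp only
      rw [deriv_mul_const (hθ.differentiable one_ne_zero t),
        deriv_const_mul _ (hψ.differentiable one_ne_zero x)]
      ring
    · rw [mul_comm, ← integral_mul_const]
      refine integral_congr_ae (ae_of_all _ fun x => ?_)
      simp only
      ring
  refine ⟨fun ψ hψ hψc s t hs hst ht => ?_, fun ψ hψ hψc => ?_⟩
  · have hc := hf.continuous_integral (integrable_deriv_of_test hψ hψc)
    rw [key ψ hψ hψc t ⟨hs.trans hst, ht⟩, key ψ hψ hψc s ⟨hs, hst.trans ht⟩]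
    simp only [zero_mul, integral_zero, add_zero]
    rw [← intervalIntegral.integral_add_adjacent_intervals (hc.intervalIntegrable 0 s)
      (hc.intervalIntegrable s t)]
    ring
  · rw [key ψ hψ hψc 0 ⟨le_rfl, hT.le⟩]
    simp

/-! ### Identification almost everywhere and calculus of primitives -/

lemma ae_eq_of_integral_test {f g : ℝ → ℝ} (hf : LocallyIntegrable f volume)
    (hg : LocallyIntegrable g volume)
    (h : ∀ ψ : ℝ → ℝ, ContDiff ℝ 1 ψ → HasCompactSupport ψ →
      ∫ x, f x * ψ x = ∫ x, g x * ψ x) : f =ᵐ[volume] g := by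
  refine ae_eq_of_integral_contDiff_smul_eq hf hg fun ψ hψ hψc => ?_
  simpa only [smul_eq_mul, mul_comm] using h ψ (hψ.of_le (by exact_mod_cast le_top)) hψc

lemma ae_add_of_absolutelyContinuous {μ : Measure ℝ} (hμ : μ ≪ volume) {P : ℝ → Prop}
    (h : ∀ᵐ x, P x) (x : ℝ) : ∀ᵐ a ∂μ, P (x + a) :=
  hμ.ae_le ((measurePreserving_add_left volume x).quasiMeasurePreserving.ae h)

lemma ae_hasDerivAt_of_sub_eq_integral {W p : ℝ → ℝ} (hp : LocallyIntegrable p volume)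
    (h : ∀ x y, W y - W x = ∫ z in x..y, p z) : ∀ᵐ x, HasDerivAt W (p x) x := by
  have : W = fun y => W 0 + ∫ z in (0 : ℝ)..y, p z := by
    ext y; rw [← h]; ring
  filter_upwards [LocallyIntegrable.ae_hasDerivAt_integral hp] with x hx
  rw [this]
  exact (hx 0).const_add _

lemma abs_sub_le_of_sub_eq_integral {W p : ℝ → ℝ} {C : ℝ} (hC : ∀ᵐ x, |p x| ≤ C)
    (h : ∀ x y, W y - W x = ∫ z in x..y, p z) (x y : ℝ) : |W y - W x| ≤ C * |y - x| := by
  rw [h]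
  refine intervalIntegral.norm_integral_le_of_norm_le_const_ae (f := p) ?_
  filter_upwards [hC] with z hz _ using hz

lemma lipschitzWith_of_abs_sub_le {W : ℝ → ℝ} {C : ℝ}
    (h : ∀ x y, |W y - W x| ≤ C * |y - x|) : LipschitzWith C.toNNReal W := by
  refine LipschitzWith.of_dist_le_mul fun x y => ?_
  rw [Real.dist_eq, Real.dist_eq]
  exact (h y x).trans (by gcongr; exact Real.le_coe_toNNReal C)

/-- The integral of the derivative of a compactly supported absolutely continuous function
vanishes. -/
lemma integral_deriv_eq_zero_of_ac {k k' : ℝ → ℝ} (hac : ∀ a b, AbsolutelyContinuousOnInterval k a b)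
    (hc : HasCompactSupport k) (hd : ∀ᵐ x, HasDerivAt k (k' x) x) : ∫ x, k' x = 0 := by
  have h1 : ∫ x, k' x = ∫ x, deriv k x := integral_congr_ae (by
    filter_upwards [hd] with x hx using hx.deriv.symm)
  obtain ⟨r, hr⟩ := hc.isBounded.subset_closedBall 0
  set R := max r 0 + 1 with hR
  have hsub : tsupport k ⊆ Ioo (-R) R := fun x hx => by
    have := hr hx
    rw [mem_closedBall_zero_iff, Real.norm_eq_abs, abs_le] at this
    constructor <;> linarith [le_max_left r 0, this.1, this.2]
  have hzero : ∀ x, x ∉ Ioo (-R) R → k x = 0 := fun x hx =>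
    image_eq_zero_of_notMem_tsupport fun hx' => hx (hsub hx')
  have hle : -R ≤ R := by linarith [le_max_right r 0]
  rw [h1, ← setIntegral_eq_integral_of_forall_compl_eq_zero (s := Ioc (-R) R),
    ← intervalIntegral.integral_of_le hle, (hac (-R) R).integral_deriv_eq_sub,
    hzero R (by simp), hzero (-R) (by simp), sub_zero]
  intro x hx
  by_contra hne
  exact hx (Ioo_subset_Ioc_self (hsub (support_deriv_subset hne)))

/-! ### Steklov averages -/

section Steklov

/-- The uniform law on `(0,h]`. -/
def unifLaw (h : ℝ) : Measure ℝ := ENNReal.ofReal h⁻¹ • volume.restrict (Ioc 0 h)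

variable {h : ℝ}

lemma isProbabilityMeasure_unifLaw (hh : 0 < h) : IsProbabilityMeasure (unifLaw h) := by
  constructor
  rw [unifLaw, Measure.smul_apply, Measure.restrict_apply_univ, Real.volume_Ioc, smul_eq_mul,
    ← ENNReal.ofReal_mul (by positivity), sub_zero, inv_mul_cancel₀ hh.ne', ENNReal.ofReal_one]

lemma unifLaw_absolutelyContinuous : unifLaw h ≪ volume :=
  (Measure.smul_absolutelyContinuous).trans Measure.absolutelyContinuous_restrict

lemma integral_unifLaw (hh : 0 < h) (g : ℝ → ℝ) :
    ∫ a, g a ∂unifLaw h = h⁻¹ * ∫ a in (0 : ℝ)..h, g a := by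
  rw [unifLaw, integral_smul_measure, ENNReal.toReal_ofReal (by positivity), smul_eq_mul,
    intervalIntegral.integral_of_le hh.le]

lemma avg_unifLaw (hh : 0 < h) (f : ℝ → ℝ) (x : ℝ) :
    avg (unifLaw h) f x = h⁻¹ * ∫ y in x..x + h, f y := by
  rw [avg, integral_unifLaw hh, intervalIntegral.integral_comp_add_left, add_zero]

lemma adj_unifLaw (hh : 0 < h) (f : ℝ → ℝ) (x : ℝ) :
    adj (unifLaw h) f x = h⁻¹ * ∫ y in x - h..x, f y := by
  rw [adj, integral_unifLaw hh, intervalIntegral.integral_comp_sub_left, sub_zero]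

lemma abs_avg_unifLaw_le (hh : 0 < h) {f : ℝ → ℝ} {C : ℝ} (hC : ∀ᵐ x, |f x| ≤ C) (x : ℝ) :
    |avg (unifLaw h) f x| ≤ C := by
  have := isProbabilityMeasure_unifLaw hh
  exact abs_integral_le_of_ae_le (ae_add_of_absolutelyContinuous unifLaw_absolutelyContinuous hC x)

lemma avg_unifLaw_sub (hh : 0 < h) {f : ℝ → ℝ} (hf : LocallyIntegrable f volume) (x y : ℝ) :
    avg (unifLaw h) f y - avg (unifLaw h) f x = ∫ z in x..y, h⁻¹ * (f (z + h) - f z) := by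
  have hi := intervalIntegrable_of_locallyIntegrable hf
  have hi' : IntervalIntegrable (fun z => f (z + h)) volume x y := by
    simpa using (hi (x + h) (y + h)).comp_add_right h
  rw [avg_unifLaw hh, avg_unifLaw hh, intervalIntegral.integral_const_mul,
    intervalIntegral.integral_sub hi' (hi _ _), intervalIntegral.integral_comp_add_right,
    ← mul_sub, ← intervalIntegral.integral_interval_sub_interval_comm' (hi _ _) (hi _ _) (hi _ _)]

lemma hasDerivAt_adj_unifLaw (hh : 0 < h) {ψ : ℝ → ℝ} (hψ : Continuous ψ) (y : ℝ) :
    HasDerivAt (adj (unifLaw h) ψ) (h⁻¹ * (ψ y - ψ (y - h))) y := by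
  have hF : ∀ y, HasDerivAt (fun y => ∫ z in (0 : ℝ)..y, ψ z) (ψ y) y := fun y =>
    intervalIntegral.integral_hasDerivAt_right (hψ.intervalIntegrable _ _)
      (hψ.stronglyMeasurableAtFilter _ _) hψ.continuousAt
  have h1 := ((hF y).sub ((hF (y - h)).comp_sub_const y h)).const_mul h⁻¹
  refine h1.congr_of_eventuallyEq (.of_forall fun z => ?_)
  rw [adj_unifLaw hh]
  simp only [Pi.sub_apply]
  rw [intervalIntegral.integral_interval_sub_left (hψ.intervalIntegrable _ _)
    (hψ.intervalIntegrable _ _)]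

lemma contDiff_adj_unifLaw (hh : 0 < h) {ψ : ℝ → ℝ} (hψ : Continuous ψ) :
    ContDiff ℝ 1 (adj (unifLaw h) ψ) := by
  rw [contDiff_one_iff_deriv]
  refine ⟨fun y => (hasDerivAt_adj_unifLaw hh hψ y).differentiableAt, ?_⟩
  rw [funext fun y => (hasDerivAt_adj_unifLaw hh hψ y).deriv]
  fun_prop

lemma hasCompactSupport_adj_unifLaw (hh : 0 < h) {ψ : ℝ → ℝ} (hc : HasCompactSupport ψ) :
    HasCompactSupport (adj (unifLaw h) ψ) := by
  obtain ⟨r, hr⟩ := hc.isBounded.subset_closedBall 0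
  refine .of_support_subset_isCompact (K := Metric.closedBall 0 (r + h))
    (isCompact_closedBall 0 (r + h)) fun y hy => ?_
  by_contra hy'
  rw [mem_closedBall_zero_iff, Real.norm_eq_abs, not_le] at hy'
  refine hy ?_
  rw [adj_unifLaw hh, intervalIntegral.integral_zero_ae, mul_zero]
  refine ae_of_all _ fun z hz => image_eq_zero_of_notMem_tsupport fun hz' => ?_
  rw [uIoc_of_le (by linarith)] at hz
  have h2 := hr hz'
  rw [mem_closedBall_zero_iff, Real.norm_eq_abs] at h2
  have h3 := abs_sub_abs_le_abs_sub y z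
  rw [abs_of_nonneg (by linarith [hz.2] : 0 ≤ y - z)] at h3
  linarith [hz.1]

lemma continuous_avg_unifLaw (hh : 0 < h) {f : ℝ → ℝ} (hf : LocallyIntegrable f volume) :
    Continuous (avg (unifLaw h) f) := by
  have h1 : LocallyIntegrable (fun z => f (z + h)) volume := by
    have hmp := measurePreserving_add_right (volume : Measure ℝ) h
    rw [locallyIntegrable_iff] at hf ⊢
    intro K hK
    have hK' : IsCompact ((fun x => x + h) '' K) := hK.image (by fun_prop)
    have := (hmp.integrableOn_comp_preimage (measurableEmbedding_addRight h)).mpr (hf _ hK')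
    rwa [preimage_image_eq _ (add_left_injective h)] at this
  exact continuous_of_sub_eq_integral ((h1.sub hf).smul h⁻¹)
    (fun x y => by simpa using avg_unifLaw_sub hh hf x y)

/-- Evaluating a Steklov average at `x` is integration against the indicator of an interval, hence
continuous in time at every point and not just almost everywhere. -/
lemma BddCont.continuous_avg_unifLaw {u : ℝ → ℝ → ℝ} (hu : BddCont u) (hh : 0 < h) (x : ℝ) :
    Continuous fun t => NonlocalVelocity.avg (unifLaw h) (u t) x := by
  have hψ : Integrable ((Ioc x (x + h)).indicator fun _ => (1 : ℝ)) volume :=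
    (integrable_indicator_iff measurableSet_Ioc).mpr (by simp)
  have := (hu.continuous_integral hψ).const_mul h⁻¹
  refine this.congr fun t => ?_
  rw [avg_unifLaw hh, intervalIntegral.integral_of_le (by linarith),
    ← integral_indicator measurableSet_Ioc]
  congr 2 with y
  by_cases hy : y ∈ Ioc x (x + h) <;> simp [hy]

/-- Lebesgue differentiation from the right and from the left. The second average covers the
interval from `x - δ n` to `x`; it arises from the change of variables in `integral_steklovSource`.
-/
lemma ae_tendsto_avg_unifLaw {f : ℝ → ℝ} (hf : LocallyIntegrable f volume) {δ : ℕ → ℝ}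
    (hδ : ∀ n, 0 < δ n) (hlim : Tendsto δ atTop (𝓝 0)) :
    ∀ᵐ x, Tendsto (fun n => avg (unifLaw (δ n)) f x) atTop (𝓝 (f x)) ∧
      Tendsto (fun n => avg (unifLaw (δ n)) f (x - δ n)) atTop (𝓝 (f x)) := by
  have hi := intervalIntegrable_of_locallyIntegrable hf
  filter_upwards [LocallyIntegrable.ae_hasDerivAt_integral hf] with x hx
  have h1 := (hx x).tendsto_slope_zero
  constructor
  · refine (h1.comp (tendsto_nhdsWithin_iff.mpr ⟨hlim, .of_forall fun n => (hδ n).ne'⟩)).congr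
      fun n => ?_
    simp [avg_unifLaw (hδ n)]
  · refine (h1.comp (tendsto_nhdsWithin_iff.mpr ⟨by simpa using hlim.neg,
      .of_forall fun n => (neg_lt_zero.mpr (hδ n)).ne⟩)).congr fun n => ?_
    simp only [Function.comp_apply, avg_unifLaw (hδ n), intervalIntegral.integral_same, sub_zero,
      sub_add_cancel, smul_eq_mul, inv_neg, ← sub_eq_add_neg]
    rw [intervalIntegral.integral_symm x (x - δ n)]
    ring

end Steklov

/-! ### The chain rule in time -/

/-- If increments of `g` are time integrals of a kernel depending continuously on the end points,
then the end points may be replaced by the running time. -/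
lemma sub_eq_integral_diagonal {T : ℝ} {g : ℝ → ℝ} {E : ℝ × ℝ × ℝ → ℝ} (hg : Continuous g)
    (hE : Continuous E)
    (h : ∀ s t, 0 ≤ s → s ≤ t → t ≤ T → g t - g s = ∫ r in s..t, E (s, t, r))
    {s t : ℝ} (hs : 0 ≤ s) (hst : s ≤ t) (ht : t ≤ T) :
    g t - g s = ∫ r in s..t, E (r, r, r) := by
  -- Over a short time interval around `a` all three arguments of `E` are close to `a`. Increments
  -- of `g` to either side of `a` are therefore `E (a, a, a)` times their length, up to a small
  -- relative error.
  have hd : ∀ a ∈ Ioo s t, HasDerivAt g (E (a, a, a)) a := by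
    intro a ha
    rw [hasDerivAt_iff_isLittleO, Asymptotics.isLittleO_iff]
    intro ε hε
    have hball : ∀ᶠ z in 𝓝 (a, a, a), dist (E z) (E (a, a, a)) < ε :=
      hE.continuousAt.eventually (Metric.ball_mem_nhds _ hε)
    obtain ⟨δ, hδ, hball⟩ := Metric.eventually_nhds_iff.mp hball
    have hclose : ∀ x y z : ℝ, |x - a| < δ → |y - a| < δ → |z - a| < δ →
        |E (x, y, z) - E (a, a, a)| ≤ ε := fun x y z hx hy hz =>
      (hball (y := (x, y, z)) (by simp [Prod.dist_eq, Real.dist_eq, hx, hy, hz])).le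
    have hcont : ∀ x y : ℝ, Continuous fun r => E (x, y, r) := fun x y => by fun_prop
    have hest : ∀ x y, 0 ≤ x → x ≤ y → y ≤ T → |x - a| < δ → |y - a| < δ →
        |g y - g x - (y - x) * E (a, a, a)| ≤ ε * |y - x| := by
      intro x y h0 hxy hyT hx hy
      have : g y - g x - (y - x) * E (a, a, a) = ∫ r in x..y, (E (x, y, r) - E (a, a, a)) := by
        rw [intervalIntegral.integral_sub ((hcont x y).intervalIntegrable _ _)
          intervalIntegrable_const, h x y h0 hxy hyT]
        simp
      rw [this]
      refine intervalIntegral.norm_integral_le_of_norm_le_const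
        (f := fun r => E (x, y, r) - E (a, a, a)) fun r hr => ?_
      rw [uIoc_of_le hxy] at hr
      refine hclose _ _ _ hx hy (abs_lt.mpr ⟨?_, ?_⟩)
      · linarith [(abs_lt.mp hx).1, hr.1]
      · linarith [(abs_lt.mp hy).2, hr.2]
    filter_upwards [Metric.ball_mem_nhds a hδ, Ioo_mem_nhds ha.1 ha.2] with y hy hy'
    rw [Metric.mem_ball, Real.dist_eq] at hy
    simp only [smul_eq_mul, Real.norm_eq_abs]
    rcases le_total a y with hay | hay
    · exact hest a y (by linarith [ha.1]) hay (by linarith [hy'.2]) (by simpa using hδ) hy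
    · have := hest y a (by linarith [hy'.1]) hay (by linarith [ha.2]) hy (by simpa using hδ)
      rw [← abs_neg, abs_sub_comm y a]
      convert! this using 2
      ring
  have hc : Continuous fun r => E (r, r, r) := by fun_prop
  exact (intervalIntegral.integral_eq_sub_of_hasDerivAt_of_le hst hg.continuousOn hd
    (hc.intervalIntegrable _ _)).symm

/-- The divided difference of a `C¹` function. -/
def dividedDiff (β : ℝ → ℝ) (z : ℝ × ℝ) : ℝ :=
  ∫ l in (0 : ℝ)..1, deriv β (z.1 + l * (z.2 - z.1))

lemma continuous_dividedDiff {β : ℝ → ℝ} (hβ : ContDiff ℝ 1 β) : Continuous (dividedDiff β) := by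
  have := hβ.continuous_deriv le_rfl
  exact intervalIntegral.continuous_parametric_intervalIntegral_of_continuous' (by fun_prop) 0 1

lemma dividedDiff_self (β : ℝ → ℝ) (a : ℝ) : dividedDiff β (a, a) = deriv β a := by
  simp [dividedDiff]

lemma sub_eq_mul_dividedDiff {β : ℝ → ℝ} (hβ : ContDiff ℝ 1 β) (a b : ℝ) :
    β b - β a = (b - a) * dividedDiff β (a, b) := by
  have hd : ∀ l ∈ uIcc (0 : ℝ) 1, HasDerivAt (fun l : ℝ => β (a + l * (b - a)))
      ((b - a) * deriv β (a + l * (b - a))) l := by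
    intro l _
    have h1 : HasDerivAt (fun l : ℝ => a + l * (b - a)) (b - a) l := by
      simpa using ((hasDerivAt_id l).mul_const (b - a)).const_add a
    rw [mul_comm]
    exact (hβ.differentiable one_ne_zero _).hasDerivAt.comp l h1
  have hcont := hβ.continuous_deriv le_rfl
  have := intervalIntegral.integral_eq_sub_of_hasDerivAt hd
    (Continuous.intervalIntegrable (by fun_prop) _ _)
  rw [intervalIntegral.integral_const_mul] at this
  simpa [dividedDiff] using this.symm

/-- Nonlinear chain rule in time for families that are continuous in space. -/
lemma integral_comp_sub_eq {T C : ℝ} {U F : ℝ → ℝ → ℝ} (hF : BddCont F)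
    (hUx : ∀ t, Continuous (U t)) (hUt : ∀ x, Continuous fun t => U t x)
    (hC : ∀ t x, |U t x| ≤ C)
    (h : ∀ χ : ℝ → ℝ, Continuous χ → HasCompactSupport χ → ∀ s t, 0 ≤ s → s ≤ t → t ≤ T →
      (∫ x, U t x * χ x) - ∫ x, U s x * χ x = ∫ r in s..t, ∫ x, F r x * χ x)
    {β : ℝ → ℝ} (hβ : ContDiff ℝ 1 β) {ψ : ℝ → ℝ} (hψ : Continuous ψ) (hψc : HasCompactSupport ψ)
    {s t : ℝ} (hs : 0 ≤ s) (hst : s ≤ t) (ht : t ≤ T) :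
    (∫ x, β (U t x) * ψ x) - ∫ x, β (U s x) * ψ x
      = ∫ r in s..t, ∫ x, F r x * (deriv β (U r x) * ψ x) := by
  have hψi : Integrable ψ := hψ.integrable_of_hasCompactSupport hψc
  have hddc := continuous_dividedDiff hβ
  obtain ⟨M, hM0, hM⟩ := exists_bound_of_continuous hβ.continuous C
  obtain ⟨M', hM'⟩ := ((isCompact_Icc (a := -C) (b := C)).prod
    (isCompact_Icc (a := -C) (b := C))).exists_bound_of_continuousOn hddc.continuousOn
  have hdd : ∀ a b x, |dividedDiff β (U a x, U b x)| ≤ M' := fun a b x =>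
    hM' _ ⟨abs_le.mp (hC a x), abs_le.mp (hC b x)⟩
  have hg : Continuous fun t => ∫ x, β (U t x) * ψ x := by
    refine continuous_of_dominated (bound := fun x => M * |ψ x|) (fun t => ?_) (fun t => ?_)
      (hψi.abs.const_mul M) ?_
    · exact ((hβ.continuous.comp (hUx t)).mul hψ).aestronglyMeasurable
    · refine ae_of_all _ fun x => ?_
      rw [Real.norm_eq_abs, abs_mul]
      gcongr
      exact hM _ (hC t x)
    · exact ae_of_all _ fun x => (hβ.continuous.comp (hUt x)).mul continuous_const
  -- The increment of `β(U)` is the increment of `U` times a divided difference. For fixed `s` and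
  -- `t` that divided difference times `ψ` is an admissible continuous test function, and on the
  -- diagonal it becomes `β'(U) ψ`.
  set E : ℝ × ℝ × ℝ → ℝ := fun z => ∫ x, F z.2.2 x * (dividedDiff β (U z.1 x, U z.2.1 x) * ψ x)
    with hEdef
  have hE : Continuous E := by
    refine continuous_iff_continuousAt.mpr fun z => ?_
    refine hF.tendsto_integral (r := fun z : ℝ × ℝ × ℝ => z.2.2)
      (B := fun z x => dividedDiff β (U z.1 x, U z.2.1 x))
      (B₀ := fun x => dividedDiff β (U z.1 x, U z.2.1 x)) (M := M')
      (Continuous.tendsto (by fun_prop) z) (.of_forall fun w => ?_)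
      (.of_forall fun w => ae_of_all _ fun x => hdd _ _ x) (ae_of_all _ fun x => ?_) hψi
    · exact (hddc.comp ((hUx _).prodMk (hUx _))).aestronglyMeasurable
    · exact Continuous.tendsto (hddc.comp (((hUt x).comp continuous_fst).prodMk
        ((hUt x).comp (continuous_fst.comp continuous_snd)))) z
  have key := sub_eq_integral_diagonal (T := T) hg hE (fun s t hs hst ht => ?_) hs hst ht
  · rw [key]
    simp only [hEdef, dividedDiff_self]
  · have hint : ∀ t, Integrable fun x => β (U t x) * ψ x := fun t =>
      integrable_bdd_mul (hβ.continuous.comp (hUx t)).aestronglyMeasurable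
        (ae_of_all _ fun x => hM _ (hC t x)) hψi
    have hχ : Continuous fun x => dividedDiff β (U s x, U t x) * ψ x :=
      (hddc.comp ((hUx s).prodMk (hUx t))).mul hψ
    have hχi := hχ.integrable_of_hasCompactSupport (μ := volume) hψc.mul_left
    have hint' : ∀ r, Integrable fun x => U r x * (dividedDiff β (U s x, U t x) * ψ x) := fun r =>
      integrable_bdd_mul (hUx r).aestronglyMeasurable (ae_of_all _ (hC r)) hχi
    rw [hEdef, ← h _ hχ hψc.mul_left s t hs hst ht, ← integral_sub (hint t) (hint s),
      ← integral_sub (hint' t) (hint' s)]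
    refine integral_congr_ae (ae_of_all _ fun x => ?_)
    simp only
    rw [← sub_mul, sub_eq_mul_dividedDiff hβ]
    ring

/-! ### Renormalization with a Lipschitz velocity -/

section Renormalization

variable {T : ℝ} {u b p R : ℝ → ℝ → ℝ} {h : ℝ}

/-- The right-hand side of the evolution equation of a Steklov average. -/
def steklovSource (h : ℝ) (f R : ℝ → ℝ → ℝ) (t x : ℝ) : ℝ :=
  -(h⁻¹ * (f t (x + h) - f t x)) + avg (unifLaw h) (R t) x

lemma bddCont_steklovSource {f : ℝ → ℝ → ℝ} (hh : 0 < h) (hf : BddCont f) (hR : BddCont R) :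
    BddCont (steklovSource h f R) := by
  have := isProbabilityMeasure_unifLaw hh
  exact (((hf.translate h).sub hf).const_mul h⁻¹).neg.add hR.avg

/-- The law is tested with the adjoint average of `χ`, which is `C¹` even when `χ` is merely
continuous. Its derivative is a difference quotient; translating that quotient back onto the flux
leaves a bounded source and no derivative of `χ`. -/
lemma BalanceLaw.steklov {f : ℝ → ℝ → ℝ} (hl : BalanceLaw T u f R) (hh : 0 < h) (hu : BddCont u)
    (hf : BddCont f) (hR : BddCont R) {χ : ℝ → ℝ} (hχ : Continuous χ) (hχc : HasCompactSupport χ)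
    {s t : ℝ} (hs : 0 ≤ s) (hst : s ≤ t) (ht : t ≤ T) :
    (∫ x, avg (unifLaw h) (u t) x * χ x) - ∫ x, avg (unifLaw h) (u s) x * χ x
      = ∫ r in s..t, ∫ x, steklovSource h f R r x * χ x := by
  have := isProbabilityMeasure_unifLaw hh
  have hχi : Integrable χ := hχ.integrable_of_hasCompactSupport hχc
  have hsw : ∀ {w : ℝ → ℝ → ℝ}, BddCont w → ∀ t, ∫ x, avg (unifLaw h) (w t) x * χ x
      = ∫ x, w t x * adj (unifLaw h) χ x := fun {w} hw t => by
    obtain ⟨C, h0, hC⟩ := hw.bdd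
    exact integral_avg_mul (hw.meas t) (hC t) hχi
  rw [hsw hu, hsw hu, hl _ (contDiff_adj_unifLaw hh hχ) (hasCompactSupport_adj_unifLaw hh hχc) s t
    hs hst ht]
  refine intervalIntegral.integral_congr fun r _ => ?_
  have hmp := hχi.comp_sub_right h
  have e1 : ∫ x, f r x * (h⁻¹ * (χ x - χ (x - h)))
      = ∫ x, -(h⁻¹ * (f r (x + h) - f r x)) * χ x := by
    have i1 := (hf.integrable_mul hχi r).const_mul h⁻¹
    have i2 := (hf.integrable_mul hmp r).const_mul h⁻¹
    have i3 := ((hf.translate h).integrable_mul hχi r).const_mul h⁻¹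
    have e2 : ∫ x, h⁻¹ * (f r x * χ (x - h)) = ∫ x, h⁻¹ * (f r (x + h) * χ x) := by
      rw [← integral_add_right_eq_self (fun x => h⁻¹ * (f r x * χ (x - h))) h]
      simp
    calc _ = ∫ x, (h⁻¹ * (f r x * χ x) - h⁻¹ * (f r x * χ (x - h))) := by
          congr 1 with x; ring
      _ = (∫ x, h⁻¹ * (f r x * χ x)) - ∫ x, h⁻¹ * (f r (x + h) * χ x) := by
          rw [integral_sub i1 i2, e2]
      _ = ∫ x, (h⁻¹ * (f r x * χ x) - h⁻¹ * (f r (x + h) * χ x)) := (integral_sub i1 i3).symm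
      _ = _ := by congr 1 with x; ring
  simp only [steklovSource, add_mul]
  rw [integral_add, ← e1, hsw hR]
  · simp only [(hasDerivAt_adj_unifLaw hh hχ _).deriv]
  · exact ((((hf.translate h).sub hf).const_mul h⁻¹).neg).integrable_mul hχi r
  · exact (hR.avg (μ := unifLaw h)).integrable_mul hχi r

end Renormalization

section Renormalization

variable {T : ℝ} {u b p R : ℝ → ℝ → ℝ} {h : ℝ}

/-- By the discrete product rule, the difference quotient of `b u` is `b ∂ₓ U` plus the shifted `u`
times the difference quotient of `b`, where `U` is the Steklov average. Multiplied by `β'(U)`, the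
first part is `b ∂ₓ β(U)` and is integrated by parts. The second is translated by `h` to put `u`
back at `x`. Every term then has a limit as `h → 0`. -/
lemma integral_steklovSource (hh : 0 < h) (hu : BddCont u) (hb : BddCont b) (hp : BddCont p)
    (hR : BddCont R) (hbp : ∀ t x y, b t y - b t x = ∫ z in x..y, p t z)
    {β : ℝ → ℝ} (hβ : ContDiff ℝ 1 β) {ψ : ℝ → ℝ} (hψ : ContDiff ℝ 1 ψ)
    (hψc : HasCompactSupport ψ) (r : ℝ) :
    ∫ x, steklovSource h (fun t x => b t x * u t x) R r x
        * (deriv β (avg (unifLaw h) (u r) x) * ψ x)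
      = (∫ x, b r x * (β (avg (unifLaw h) (u r) x) * deriv ψ x))
        + (∫ x, p r x * (β (avg (unifLaw h) (u r) x) * ψ x))
        - (∫ x, u r x * (deriv β (avg (unifLaw h) (u r) (x - h))
            * (h⁻¹ * (b r x - b r (x - h))) * ψ (x - h)))
        + ∫ x, avg (unifLaw h) (R r) x * (deriv β (avg (unifLaw h) (u r) x) * ψ x) := by
  have := isProbabilityMeasure_unifLaw hh
  obtain ⟨C, hC0, hC⟩ := hu.bdd
  obtain ⟨Cp, hCp0, hCp⟩ := hp.bdd
  set U : ℝ → ℝ := avg (unifLaw h) (u r) with hU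
  set w : ℝ → ℝ := fun x => h⁻¹ * (u r (x + h) - u r x) with hw
  have hwB : BddCont fun t x => h⁻¹ * (u t (x + h) - u t x) :=
    ((hu.translate h).sub hu).const_mul h⁻¹
  have hwloc : LocallyIntegrable w volume := hwB.locallyIntegrable r
  have hUc : Continuous U := continuous_avg_unifLaw hh (hu.locallyIntegrable r)
  have hUb : ∀ x, |U x| ≤ C := abs_avg_unifLaw_le hh (hC r)
  have hUw : ∀ x y, U y - U x = ∫ z in x..y, w z := avg_unifLaw_sub hh (hu.locallyIntegrable r)
  have hbc : Continuous (b r) := continuous_of_sub_eq_integral (hp.locallyIntegrable r) (hbp r)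
  have hβ' := hβ.continuous_deriv le_rfl
  obtain ⟨M, hM0, hM⟩ := exists_bound_of_continuous hβ.continuous C
  obtain ⟨M', hM'0, hM'⟩ := exists_bound_of_continuous hβ' C
  have hψi := integrable_of_test hψ hψc
  have hψi' := integrable_deriv_of_test hψ hψc
  obtain ⟨Cw, hCw0, hCw⟩ := hwB.bdd
  obtain ⟨L, hL0, hL⟩ := exists_lipschitz_bound hβ.locallyLipschitz C
  have hβL : ∀ x y, |β (U y) - β (U x)| ≤ (L * Cw) * |y - x| := fun x y => by
    refine (hL _ _ (hUb y) (hUb x)).trans ?_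
    rw [mul_assoc]
    gcongr
    exact abs_sub_le_of_sub_eq_integral (hCw r) hUw x y
  have hac : ∀ a c, AbsolutelyContinuousOnInterval (fun x => β (U x) * (b r x * ψ x)) a c := by
    intro a c
    refine AbsolutelyContinuousOnInterval.fun_mul
      ((lipschitzWith_of_abs_sub_le hβL).lipschitzOnWith.absolutelyContinuousOnInterval) ?_
    refine AbsolutelyContinuousOnInterval.fun_mul ((lipschitzWith_of_abs_sub_le
      (abs_sub_le_of_sub_eq_integral (hCp r) (hbp r))).lipschitzOnWith.absolutelyContinuousOnInterval)
      hψ.contDiffOn.absolutelyContinuousOnInterval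
  have hzero : ∫ x, (deriv β (U x) * w x * (b r x * ψ x)
      + β (U x) * (p r x * ψ x + b r x * deriv ψ x)) = 0 := by
    refine integral_deriv_eq_zero_of_ac hac (hψc.mul_left.mul_left) ?_
    filter_upwards [ae_hasDerivAt_of_sub_eq_integral hwloc hUw,
      ae_hasDerivAt_of_sub_eq_integral (hp.locallyIntegrable r) (hbp r)] with x h1 h2
    exact ((hβ.differentiable one_ne_zero _).hasDerivAt.comp x h1).mul
      (h2.mul (hψ.differentiable one_ne_zero x).hasDerivAt)
  have iβ : ∀ {φ : ℝ → ℝ}, Integrable φ → Integrable fun x => β (U x) * φ x := fun hφ =>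
    integrable_bdd_mul (hβ.continuous.comp hUc).aestronglyMeasurable
      (ae_of_all _ fun x => hM _ (hUb x)) hφ
  have iβ' : ∀ {φ : ℝ → ℝ}, Integrable φ → Integrable fun x => deriv β (U x) * φ x := fun hφ =>
    integrable_bdd_mul (hβ'.comp hUc).aestronglyMeasurable
      (ae_of_all _ fun x => hM' _ (hUb x)) hφ
  have i1 : Integrable fun x => w x * (b r x * (deriv β (U x) * ψ x)) :=
    hwB.integrable_mul (hb.integrable_mul (iβ' hψi) r) r
  have i2 : Integrable fun x => b r x * (β (U x) * deriv ψ x) := hb.integrable_mul (iβ hψi') r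
  have i3 : Integrable fun x => p r x * (β (U x) * ψ x) := hp.integrable_mul (iβ hψi) r
  have i4 : Integrable fun x => u r (x + h) * ((h⁻¹ * (b r (x + h) - b r x))
      * (deriv β (U x) * ψ x)) :=
    (hu.translate h).integrable_mul ((((hb.translate h).sub hb).const_mul h⁻¹).integrable_mul
      (iβ' hψi) r) r
  have i5 : Integrable fun x => avg (unifLaw h) (R r) x * (deriv β (U x) * ψ x) :=
    (hR.avg (μ := unifLaw h)).integrable_mul (iβ' hψi) r
  have hparts : ∫ x, w x * (b r x * (deriv β (U x) * ψ x))
      = -((∫ x, b r x * (β (U x) * deriv ψ x)) + ∫ x, p r x * (β (U x) * ψ x)) := by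
    have i23 : Integrable fun x => b r x * (β (U x) * deriv ψ x) + p r x * (β (U x) * ψ x) :=
      i2.add i3
    rw [eq_neg_iff_add_eq_zero, ← integral_add i2 i3, ← integral_add i1 i23, ← hzero]
    congr 1 with x
    ring
  have hshift : ∫ x, u r (x + h) * ((h⁻¹ * (b r (x + h) - b r x)) * (deriv β (U x) * ψ x))
      = ∫ x, u r x * (deriv β (U (x - h)) * (h⁻¹ * (b r x - b r (x - h))) * ψ (x - h)) := by
    rw [← integral_add_right_eq_self (fun x => u r x * (deriv β (U (x - h))
      * (h⁻¹ * (b r x - b r (x - h))) * ψ (x - h))) h]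
    congr 1 with x
    rw [add_sub_cancel_right]
    ring
  calc ∫ x, steklovSource h (fun t x => b t x * u t x) R r x * (deriv β (U x) * ψ x)
      = ∫ x, (-(w x * (b r x * (deriv β (U x) * ψ x)))
          - u r (x + h) * ((h⁻¹ * (b r (x + h) - b r x)) * (deriv β (U x) * ψ x))
          + avg (unifLaw h) (R r) x * (deriv β (U x) * ψ x)) := by
        congr 1 with x
        simp only [steklovSource, hw]
        ring
    _ = _ := by
        have e1 : Integrable fun x => -(w x * (b r x * (deriv β (U x) * ψ x))) := i1.neg
        have e2 : Integrable fun x => -(w x * (b r x * (deriv β (U x) * ψ x)))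
          - u r (x + h) * ((h⁻¹ * (b r (x + h) - b r x)) * (deriv β (U x) * ψ x)) := e1.sub i4
        rw [integral_add e2 i5, integral_sub e1 i4, integral_neg, hparts, hshift]
        ring

/-- Renormalization: a bounded solution of `∂ₜ u + ∂ₓ (b u) = R` with `b` Lipschitz in space,
`∂ₓ b = p`, satisfies `∂ₜ β(u) + ∂ₓ (b β(u)) = (β(u) - u β'(u)) p + β'(u) R`. -/
theorem BalanceLaw.renormalize (hl : BalanceLaw T u (fun t x => b t x * u t x) R)
    (hu : BddCont u) (hb : BddCont b) (hp : BddCont p) (hR : BddCont R)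
    (hbp : ∀ t x y, b t y - b t x = ∫ z in x..y, p t z) {β : ℝ → ℝ} (hβ : ContDiff ℝ 1 β) :
    BalanceLaw T (fun t x => β (u t x)) (fun t x => b t x * β (u t x))
      (fun t x => (β (u t x) - u t x * deriv β (u t x)) * p t x + deriv β (u t x) * R t x) := by
  intro ψ hψ hψc s t hs hst ht
  have hψi := integrable_of_test hψ hψc
  have hψi' := integrable_deriv_of_test hψ hψc
  obtain ⟨C, hC0, hC⟩ := hu.bdd
  obtain ⟨Cb, hCb0, hCb⟩ := hb.bdd
  obtain ⟨Cp, hCp0, hCp⟩ := hp.bdd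
  obtain ⟨CR, hCR0, hCR⟩ := hR.bdd
  have hβ' := hβ.continuous_deriv le_rfl
  obtain ⟨M, hM0, hM⟩ := exists_bound_of_continuous hβ.continuous C
  obtain ⟨M', hM'0, hM'⟩ := exists_bound_of_continuous hβ' C
  set δ : ℕ → ℝ := fun n => 1 / ((n : ℝ) + 1) with hδdef
  have hδ : ∀ n, 0 < δ n := fun n => by positivity
  have hδ1 : ∀ n, δ n ≤ 1 := fun n => by
    rw [hδdef]; exact div_le_one_of_le₀ (by linarith [n.cast_nonneg (α := ℝ)]) (by positivity)
  have hδlim : Tendsto δ atTop (𝓝 0) := tendsto_one_div_add_atTop_nhds_zero_nat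
  have hprob : ∀ n, IsProbabilityMeasure (unifLaw (δ n)) := fun n =>
    isProbabilityMeasure_unifLaw (hδ n)
  set U : ℕ → ℝ → ℝ → ℝ := fun n t => avg (unifLaw (δ n)) (u t) with hU
  have hUx : ∀ n t, Continuous (U n t) := fun n t =>
    continuous_avg_unifLaw (hδ n) (hu.locallyIntegrable t)
  have hUb : ∀ n t x, |U n t x| ≤ C := fun n t => abs_avg_unifLaw_le (hδ n) (hC t)
  have hlim : ∀ t, ∀ᵐ x, Tendsto (fun n => U n t x) atTop (𝓝 (u t x)) ∧
      Tendsto (fun n => U n t (x - δ n)) atTop (𝓝 (u t x)) := fun t =>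
    ae_tendsto_avg_unifLaw (hu.locallyIntegrable t) hδ hδlim
  have hbb : ∀ r x y, |b r y - b r x| ≤ Cp * |y - x| := fun r =>
    abs_sub_le_of_sub_eq_integral (hCp r) (hbp r)
  have hbc : ∀ r, Continuous (b r) := fun r =>
    continuous_of_sub_eq_integral (hp.locallyIntegrable r) (hbp r)
  have hone : BddCont fun _ _ => (1 : ℝ) :=
    BddCont.const (C := 1) aestronglyMeasurable_const (by simp)
  obtain ⟨ρ, hρ⟩ := hψc.isBounded.subset_closedBall 0
  obtain ⟨Mψ, hMψ⟩ := hψ.continuous.bounded_above_of_compact_support hψc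
  have hMψ0 : 0 ≤ Mψ := (norm_nonneg _).trans (hMψ 0)
  -- Since `δ n ≤ 1`, this single ball contains the supports of all the translates `ψ (· - δ n)`.
  -- Its indicator serves as an integrable weight independent of `n`.
  set J : ℝ → ℝ := (Metric.closedBall (0 : ℝ) (ρ + 1)).indicator fun _ => 1 with hJ
  have hJi : Integrable J :=
    (integrable_indicator_iff measurableSet_closedBall).mpr
      (integrableOn_const (isCompact_closedBall (0 : ℝ) (ρ + 1)).measure_lt_top.ne)
  have hJ1 : ∀ n x, ψ (x - δ n) * J x = ψ (x - δ n) := fun n x => by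
    by_cases hx : x ∈ Metric.closedBall (0 : ℝ) (ρ + 1)
    · rw [hJ, indicator_of_mem hx, mul_one]
    · have hx0 : x - δ n ∉ tsupport ψ := fun hx' => hx ?_
      · rw [image_eq_zero_of_notMem_tsupport hx0, zero_mul]
      have := hρ hx'
      rw [mem_closedBall_zero_iff, Real.norm_eq_abs] at this ⊢
      have h2 := abs_sub_abs_le_abs_sub x (δ n)
      rw [abs_of_pos (hδ n)] at h2
      linarith [hδ1 n]
  have hJ2 : ∀ x, ψ x * J x = ψ x := fun x => by
    by_cases hx : x ∈ Metric.closedBall (0 : ℝ) (ρ + 1)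
    · rw [hJ, indicator_of_mem hx, mul_one]
    · have hx0 : x ∉ tsupport ψ := fun hx' =>
        hx (Metric.closedBall_subset_closedBall (by linarith) (hρ hx'))
      rw [image_eq_zero_of_notMem_tsupport hx0, zero_mul]
  have hJ0 : ∀ x, 0 ≤ J x := fun x => indicator_nonneg (fun _ _ => zero_le_one) x
  -- The commutator factor. The Lipschitz bound on `b` controls it uniformly in `n`, and
  -- differentiability of `b` almost everywhere gives the limit `β'(u) p ψ`.
  set Q : ℕ → ℝ → ℝ → ℝ := fun n r x => deriv β (U n r (x - δ n))
            * ((δ n)⁻¹ * (b r x - b r (x - δ n))) * ψ (x - δ n) with hQ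
  have hQb : ∀ n r x, |Q n r x| ≤ M' * Cp * Mψ := fun n r x => by
    have h1 : |(δ n)⁻¹ * (b r x - b r (x - δ n))| ≤ Cp := by
      rw [abs_mul, abs_of_pos (inv_pos.mpr (hδ n)), inv_mul_le_iff₀ (hδ n)]
      refine (hbb r (x - δ n) x).trans (le_of_eq ?_)
      rw [sub_sub_cancel, abs_of_pos (hδ n), mul_comm]
    rw [hQ, abs_mul, abs_mul]
    gcongr
    · exact hM' _ (hUb n r _)
    · exact hMψ _
  have hQJ : ∀ n r x, Q n r x * J x = Q n r x := fun n r x => by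
    rw [hQ]; simp only; rw [mul_assoc _ (ψ _), hJ1]
  have hQc : ∀ n r, Continuous (Q n r) := fun n r => by
    have h1 := hUx n r
    have h2 := hbc r
    have h3 := hψ.continuous
    rw [hQ]
    fun_prop
  -- the time-integrated identity for the Steklov averages
  have hn : ∀ n, (∫ x, β (U n t x) * ψ x) - ∫ x, β (U n s x) * ψ x = ∫ r in s..t,
      ∫ x, steklovSource (δ n) (fun t x => b t x * u t x) R r x
        * (deriv β (U n r x) * ψ x) := fun n =>
    integral_comp_sub_eq (bddCont_steklovSource (hδ n) (hb.mul hu) hR) (hUx n)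
      (hu.continuous_avg_unifLaw (hδ n)) (hUb n)
      (fun χ hχ hχc s t hs hst ht => hl.steklov (hδ n) hu (hb.mul hu) hR hχ hχc hs hst ht)
      hβ hψ.continuous hψc hs hst ht
  have hLHS : ∀ t, Tendsto (fun n => ∫ x, β (U n t x) * ψ x) atTop (𝓝 (∫ x, β (u t x) * ψ x)) := by
    intro t
    have := hone.tendsto_integral (r := fun _ : ℕ => (0 : ℝ)) (t := 0) (l := atTop)
      tendsto_const_nhds (B := fun n x => β (U n t x)) (B₀ := fun x => β (u t x)) (M := M)
      (.of_forall fun n => (hβ.continuous.comp (hUx n t)).aestronglyMeasurable)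
      (.of_forall fun n => ae_of_all _ fun x => hM _ (hUb n t x)) (by
        filter_upwards [hlim t] with x hx using (hβ.continuous.tendsto _).comp hx.1) hψi
    simpa only [one_mul] using this
  have hRHS : Tendsto (fun n => ∫ r in s..t,
      ∫ x, steklovSource (δ n) (fun t x => b t x * u t x) R r x
        * (deriv β (U n r x) * ψ x)) atTop
      (𝓝 (∫ r in s..t, ((∫ x, b r x * β (u r x) * deriv ψ x) + ∫ x,
        ((β (u r x) - u r x * deriv β (u r x)) * p r x + deriv β (u r x) * R r x) * ψ x))) := by
    refine intervalIntegral.tendsto_integral_filter_of_dominated_convergence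
      (fun _ => Cb * (∫ x, M * |deriv ψ x|) + Cp * (∫ x, M * |ψ x|)
        + C * (∫ x, M' * Cp * Mψ * J x) + CR * ∫ x, M' * |ψ x|) ?_ ?_ intervalIntegrable_const ?_
    · refine .of_forall fun n => Continuous.aestronglyMeasurable ?_
      refine continuous_iff_continuousAt.mpr fun r => ?_
      refine (bddCont_steklovSource (hδ n) (hb.mul hu) hR).tendsto_integral (r := fun r => r)
        tendsto_id (B := fun r x => deriv β (U n r x)) (M := M')
        (.of_forall fun r => (hβ'.comp (hUx n r)).aestronglyMeasurable)
        (.of_forall fun r => ae_of_all _ fun x => hM' _ (hUb n r x)) (ae_of_all _ fun x => ?_) hψi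
      exact (hβ'.comp (hu.continuous_avg_unifLaw (hδ n) x)).tendsto r
    · refine .of_forall fun n => ae_of_all _ fun r _ => ?_
      rw [hU, integral_steklovSource (hδ n) hu hb hp hR hbp hβ hψ hψc r, Real.norm_eq_abs]
      have b1 := BddCont.abs_integral_le hCb (hψi'.abs.const_mul M)
        (ψ := fun x => β (U n r x) * deriv ψ x) (fun x => by
          rw [abs_mul]; gcongr; exact hM _ (hUb n r x)) r
      have b2 := BddCont.abs_integral_le hCp (hψi.abs.const_mul M)
        (ψ := fun x => β (U n r x) * ψ x) (fun x => by
          rw [abs_mul]; gcongr; exact hM _ (hUb n r x)) r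
      have b3 := BddCont.abs_integral_le hC (hJi.const_mul (M' * Cp * Mψ))
        (ψ := Q n r) (fun x => by
          rw [← hQJ, abs_mul, abs_of_nonneg (hJ0 x)]
          exact mul_le_mul_of_nonneg_right (hQb n r x) (hJ0 x)) r
      have b4 := BddCont.abs_integral_le (u := fun r => avg (unifLaw (δ n)) (R r))
        (fun r => ae_of_all _ fun x => abs_avg_unifLaw_le (hδ n) (hCR r) x) (hψi.abs.const_mul M')
        (ψ := fun x => deriv β (U n r x) * ψ x) (fun x => by
          rw [abs_mul]; gcongr; exact hM' _ (hUb n r x)) r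
      refine (abs_add_le _ _).trans (add_le_add ?_ b4)
      refine (abs_sub _ _).trans (add_le_add ?_ b3)
      exact (abs_add_le _ _).trans (add_le_add b1 b2)
    · refine ae_of_all _ fun r _ => ?_
      have hRm := hR.locallyIntegrable r
      have t1 := hb.tendsto_integral (r := fun _ : ℕ => r) (l := atTop) tendsto_const_nhds
        (B := fun n x => β (U n r x)) (B₀ := fun x => β (u r x)) (M := M)
        (.of_forall fun n => (hβ.continuous.comp (hUx n r)).aestronglyMeasurable)
        (.of_forall fun n => ae_of_all _ fun x => hM _ (hUb n r x)) (by
          filter_upwards [hlim r] with x hx using (hβ.continuous.tendsto _).comp hx.1) hψi'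
      have t2 := hp.tendsto_integral (r := fun _ : ℕ => r) (l := atTop) tendsto_const_nhds
        (B := fun n x => β (U n r x)) (B₀ := fun x => β (u r x)) (M := M)
        (.of_forall fun n => (hβ.continuous.comp (hUx n r)).aestronglyMeasurable)
        (.of_forall fun n => ae_of_all _ fun x => hM _ (hUb n r x)) (by
          filter_upwards [hlim r] with x hx using (hβ.continuous.tendsto _).comp hx.1) hψi
      have t3 := hu.tendsto_integral (r := fun _ : ℕ => r) (l := atTop) tendsto_const_nhds
        (B := fun n x => Q n r x) (B₀ := fun x => deriv β (u r x) * p r x * ψ x)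
        (M := M' * Cp * Mψ) (.of_forall fun n => (hQc n r).aestronglyMeasurable)
        (.of_forall fun n => ae_of_all _ fun x => hQb n r x) (by
          filter_upwards [hlim r, ae_hasDerivAt_of_sub_eq_integral (hp.locallyIntegrable r)
            (hbp r)] with x hx hx'
          have hsl := hx'.tendsto_slope_zero.comp (tendsto_nhdsWithin_iff.mpr
            ⟨by simpa using hδlim.neg, .of_forall fun n => (neg_lt_zero.mpr (hδ n)).ne⟩)
          have hψl : Tendsto (fun n => ψ (x - δ n)) atTop (𝓝 (ψ x)) := by
            have : Tendsto (fun n => x - δ n) atTop (𝓝 x) := by simpa using hδlim.const_sub x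
            exact (hψ.continuous.tendsto x).comp this
          refine (((hβ'.tendsto _).comp hx.2).mul (hsl.congr fun n => ?_)).mul hψl
          simp only [Function.comp_apply, smul_eq_mul, inv_neg, ← sub_eq_add_neg]
          ring) hJi
      have t4 := hone.tendsto_integral (r := fun _ : ℕ => r) (l := atTop) tendsto_const_nhds
        (B := fun n x => avg (unifLaw (δ n)) (R r) x * deriv β (U n r x))
        (B₀ := fun x => R r x * deriv β (u r x)) (M := CR * M')
        (.of_forall fun n => ((continuous_avg_unifLaw (hδ n) hRm).mul
          (hβ'.comp (hUx n r))).aestronglyMeasurable)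
        (.of_forall fun n => ae_of_all _ fun x => by
          rw [abs_mul]
          exact mul_le_mul (abs_avg_unifLaw_le (hδ n) (hCR r) x) (hM' _ (hUb n r x))
            (abs_nonneg _) hCR0) (by
          filter_upwards [hlim r, ae_tendsto_avg_unifLaw hRm hδ hδlim] with x hx hx'
          exact hx'.1.mul ((hβ'.tendsto _).comp hx.1)) hψi
      simp only [hQJ] at t3
      have hJ3 : ∀ x, deriv β (u r x) * p r x * ψ x * J x = deriv β (u r x) * p r x * ψ x :=
        fun x => by rw [mul_assoc _ (ψ x), hJ2]
      simp only [hJ3] at t3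
      simp only [one_mul, mul_assoc] at t4
      have tsum := ((t1.add t2).sub t3).add t4
      have iβ : ∀ {φ : ℝ → ℝ}, Integrable φ → Integrable fun x => β (u r x) * φ x := fun hφ =>
        (hu.comp hβ.locallyLipschitz).integrable_mul hφ r
      have iβ' : ∀ {φ : ℝ → ℝ}, Integrable φ → Integrable fun x => deriv β (u r x) * φ x :=
        fun hφ => integrable_bdd_mul (hβ'.comp_aestronglyMeasurable (hu.meas r))
          (by filter_upwards [hC r] with x hx using hM' _ hx) hφ
      have i2 := hp.integrable_mul (iβ hψi) r
      have i3 : Integrable fun x => u r x * (deriv β (u r x) * p r x * ψ x) := by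
        simpa only [mul_assoc] using hu.integrable_mul (iβ' (hp.integrable_mul hψi r)) r
      have i4 := hR.integrable_mul (iβ' hψi) r
      have hval : (∫ x, b r x * (β (u r x) * deriv ψ x)) + (∫ x, p r x * (β (u r x) * ψ x))
          - (∫ x, u r x * (deriv β (u r x) * p r x * ψ x))
          + (∫ x, R r x * (deriv β (u r x) * ψ x))
          = (∫ x, b r x * β (u r x) * deriv ψ x) + ∫ x,
        ((β (u r x) - u r x * deriv β (u r x)) * p r x + deriv β (u r x) * R r x) * ψ x := by
        have i23 : Integrable fun x => p r x * (β (u r x) * ψ x)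
            - u r x * (deriv β (u r x) * p r x * ψ x) := i2.sub i3
        rw [add_sub_assoc, add_assoc, ← integral_sub i2 i3, ← integral_add i23 i4]
        congr 1
        · simp only [mul_assoc]
        · congr 1 with x
          ring
      rw [hval] at tsum
      refine tsum.congr fun n => ?_
      rw [hU, integral_steklovSource (hδ n) hu hb hp hR hbp hβ hψ hψc r]
  exact tendsto_nhds_unique ((hLHS t).sub (hLHS s)) (hRHS.congr fun n => (hn n).symm)

end Renormalization

/-! ### The maximum principle -/

/-- Squaring removes the kink of the positive part, so the result is `C¹` and may be used for
renormalization. -/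
lemma hasDerivAt_sq_max_zero (y : ℝ) :
    HasDerivAt (fun y : ℝ => max y 0 ^ 2) (2 * max y 0) y := by
  rcases lt_trichotomy y 0 with hy | rfl | hy
  · rw [max_eq_right hy.le, mul_zero]
    refine (hasDerivAt_const y (0 : ℝ)).congr_of_eventuallyEq ?_
    filter_upwards [gt_mem_nhds hy] with z hz
    simp [max_eq_right (le_of_lt hz)]
  · rw [hasDerivAt_iff_isLittleO]
    have h1 : (fun y : ℝ => y ^ 2) =o[𝓝 0] fun y => y := by
      simpa using Asymptotics.isLittleO_pow_pow (𝕜 := ℝ) (show 1 < 2 by norm_num)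
    have h2 : (fun y : ℝ => max y 0 ^ 2) =O[𝓝 0] fun y => y ^ 2 := by
      refine Asymptotics.isBigO_of_le _ fun y => ?_
      rw [Real.norm_eq_abs, Real.norm_eq_abs, abs_pow, abs_pow]
      refine pow_le_pow_left₀ (abs_nonneg _) ?_ 2
      rcases le_total y 0 with h | h
      · rw [max_eq_right h, abs_zero]; exact abs_nonneg y
      · rw [max_eq_left h]
    simpa using h2.trans_isLittleO h1
  · rw [max_eq_left hy.le]
    have h1 : HasDerivAt (fun y : ℝ => y ^ 2) (2 * y) y := by simpa using hasDerivAt_pow 2 y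
    refine h1.congr_of_eventuallyEq ?_
    filter_upwards [lt_mem_nhds hy] with z hz
    simp [max_eq_left (le_of_lt hz)]

/-- Grönwall for the primitive `Y` of `y`, which satisfies `Y(0) = 0` and `Y' = y ≤ A Y`. -/
lemma eq_zero_of_le_integral {T A : ℝ} {y : ℝ → ℝ} (hy : Continuous y)
    (hy0 : ∀ t, 0 ≤ y t) (h : ∀ t ∈ Icc 0 T, y t ≤ A * ∫ r in (0 : ℝ)..t, y r) :
    ∀ t ∈ Icc 0 T, y t = 0 := by
  have hd : ∀ t, HasDerivAt (fun t => ∫ r in (0 : ℝ)..t, y r) (y t) t := fun t =>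
    intervalIntegral.integral_hasDerivAt_right (hy.intervalIntegrable _ _)
      (hy.stronglyMeasurableAtFilter _ _) hy.continuousAt
  have hY : ∀ t ∈ Icc 0 T, ∫ r in (0 : ℝ)..t, y r = 0 := by
    refine eq_zero_of_abs_deriv_le_mul_abs_self_of_eq_zero_right (f' := y) (K := A)
      (fun t _ => (hd t).continuousAt.continuousWithinAt)
      (fun t _ => (hd t).hasDerivWithinAt) (by simp) fun t ht => ?_
    have h1 : 0 ≤ ∫ r in (0 : ℝ)..t, y r :=
      intervalIntegral.integral_nonneg ht.1 fun r _ => hy0 r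
    rw [Real.norm_eq_abs, Real.norm_eq_abs, abs_of_nonneg (hy0 t), abs_of_nonneg h1]
    exact h t (Ico_subset_Icc_self ht)
  intro t ht
  refine le_antisymm ?_ (hy0 t)
  simpa [hY t ht] using h t ht

/-- An integrable weight that varies slowly on the scale of the exponential law. -/
lemma exists_weight {η : ℝ} (hη : 0 < η) : ∃ (κ : ℝ) (ψ : ℝ → ℝ), 0 ≤ κ ∧ ContDiff ℝ 1 ψ ∧
    Integrable ψ ∧ Integrable (deriv ψ) ∧ (∀ x, 0 < ψ x) ∧ (∀ x, |deriv ψ x| ≤ κ * ψ x) ∧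
    ∀ x, adj (expLaw η) ψ x ≤ 2 * ψ x := by
  -- Half the decay rate of the kernel: if the weight varies at rate at most `κ`, its average still
  -- decays at rate `κ`, and `∫ η⁻¹ e^{-κ a} da = 2` produces the factor `2`.
  set κ : ℝ := (2 * η)⁻¹ with hκ
  have hκ0 : 0 < κ := by positivity
  set ψ : ℝ → ℝ := fun x => (1 + (κ * x) ^ 2)⁻¹ with hψ
  have hpos : ∀ x, 0 < ψ x := fun x => by positivity
  have hψ1 : ContDiff ℝ 1 ψ := by
    refine ContDiff.inv (by fun_prop) fun x => by positivity
  have hψi : Integrable ψ := integrable_inv_one_add_sq.comp_mul_left' hκ0.ne'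
  have hd : ∀ x, HasDerivAt ψ (-(2 * κ ^ 2 * x) / (1 + (κ * x) ^ 2) ^ 2) x := by
    intro x
    have h1 : HasDerivAt (fun x : ℝ => 1 + (κ * x) ^ 2) (2 * κ ^ 2 * x) x := by
      have := (((hasDerivAt_id x).const_mul κ).pow 2).const_add 1
      convert! this using 1
      simp
      ring
    exact h1.inv (by positivity)
  have hb : ∀ x, |deriv ψ x| ≤ κ * ψ x := by
    intro x
    rw [(hd x).deriv, abs_div, abs_neg, abs_of_pos (by positivity : 0 < (1 + (κ * x) ^ 2) ^ 2),
      div_le_iff₀ (by positivity)]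
    have h1 : κ * ψ x * (1 + (κ * x) ^ 2) ^ 2 = κ * (1 + (κ * x) ^ 2) := by
      rw [hψ]; field_simp
    rw [h1, abs_mul, abs_of_pos (by positivity : 0 < 2 * κ ^ 2)]
    have h2 : 2 * (κ * |x|) ≤ 1 + (κ * x) ^ 2 := by
      rw [← sq_abs (κ * x), abs_mul, abs_of_pos hκ0]
      nlinarith [sq_nonneg (κ * |x| - 1)]
    nlinarith
  -- The bound `|ψ'| ≤ κ ψ` in integrated form: it yields `ψ (x - a) ≤ e^{κ a} ψ x` for `a > 0`.
  have hmono : Monotone fun x => Real.exp (κ * x) * ψ x := by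
    have he : ∀ x, HasDerivAt (fun x => Real.exp (κ * x) * ψ x)
        (Real.exp (κ * x) * κ * ψ x + Real.exp (κ * x) * deriv ψ x) x := fun x => by
      have h1 : HasDerivAt (fun x => Real.exp (κ * x)) (Real.exp (κ * x) * κ) x := by
        simpa using ((hasDerivAt_id x).const_mul κ).exp
      exact h1.mul (hψ1.differentiable one_ne_zero x).hasDerivAt
    refine monotone_of_deriv_nonneg (fun x => (he x).differentiableAt) fun x => ?_
    rw [(he x).deriv]
    have := (abs_le.mp (hb x)).1
    nlinarith [Real.exp_pos (κ * x)]
  refine ⟨κ, ψ, hκ0.le, hψ1, hψi, ?_, hpos, hb, fun x => ?_⟩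
  · refine (hψi.const_mul κ).mono' (hψ1.continuous_deriv le_rfl).aestronglyMeasurable ?_
    exact ae_of_all _ hb
  · rw [adj, integral_expLaw hη]
    have hI : ∫ a in Ioi (0 : ℝ), η⁻¹ * Real.exp (-κ * a) * ψ x = 2 * ψ x := by
      rw [integral_mul_const, integral_const_mul, integral_exp_mul_Ioi (by simpa using hκ0)]
      rw [hκ]
      field_simp
      simp
    rw [← hI]
    refine integral_mono_of_nonneg ?_
      (((exp_neg_integrableOn_Ioi 0 hκ0).const_mul η⁻¹).mul_const (ψ x)) ?_
    · exact ae_of_all _ fun a => by have := (hpos (x - a)).le; positivity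
    · refine (ae_restrict_iff' measurableSet_Ioi).mpr (ae_of_all _ fun a ha => ?_)
      have h1 := hmono (show x - a ≤ x by linarith [show (0 : ℝ) < a from ha])
      simp only at h1
      have h2 : ψ (x - a) ≤ Real.exp (κ * a) * ψ x := by
        have h3 : Real.exp (κ * x) = Real.exp (κ * (x - a)) * Real.exp (κ * a) := by
          rw [← Real.exp_add]; ring_nf
        rw [h3, mul_assoc] at h1
        exact le_of_mul_le_mul_left h1 (Real.exp_pos _)
      have h4 : Real.exp (-η⁻¹ * a) * Real.exp (κ * a) = Real.exp (-κ * a) := by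
        rw [← Real.exp_add, hκ]; congr 1; field_simp; ring
      calc η⁻¹ * Real.exp (-η⁻¹ * a) * ψ (x - a)
          ≤ η⁻¹ * Real.exp (-η⁻¹ * a) * (Real.exp (κ * a) * ψ x) := by gcongr
        _ = η⁻¹ * (Real.exp (-η⁻¹ * a) * Real.exp (κ * a)) * ψ x := by ring
        _ = _ := by rw [h4]

/-- The exponentially averaged velocity of the density `u`. -/
def vel (η : ℝ) (V : ℝ → ℝ) (u : ℝ → ℝ → ℝ) (t : ℝ) : ℝ → ℝ :=
  avg (expLaw η) fun y => V (u t y)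

/-- The spatial derivative of `vel`. -/
def velSlope (η : ℝ) (V : ℝ → ℝ) (u : ℝ → ℝ → ℝ) (t x : ℝ) : ℝ :=
  η⁻¹ * (vel η V u t x - V (u t x))

section Velocity

variable {T η : ℝ} {V : ℝ → ℝ} {u : ℝ → ℝ → ℝ}

lemma bddCont_vel (hη : 0 < η) (hV : ContDiff ℝ 2 V) (hu : BddCont u) : BddCont (vel η V u) := by
  have := isProbabilityMeasure_expLaw hη
  exact (hu.comp (hV.of_le one_le_two).locallyLipschitz).avg

lemma bddCont_velSlope (hη : 0 < η) (hV : ContDiff ℝ 2 V) (hu : BddCont u) :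
    BddCont (velSlope η V u) :=
  ((bddCont_vel hη hV hu).sub (hu.comp (hV.of_le one_le_two).locallyLipschitz)).const_mul η⁻¹

lemma vel_sub (hη : 0 < η) (hV : ContDiff ℝ 2 V) (hu : BddCont u) (t x y : ℝ) :
    vel η V u t y - vel η V u t x = ∫ z in x..y, velSlope η V u t z := by
  have hz := hu.comp (hV.of_le one_le_two).locallyLipschitz
  obtain ⟨C, -, hC⟩ := hz.bdd
  exact avg_expLaw_sub hη (hz.meas t) (hC t) x y

/-- A one-sided bound by a nonnegative constant (from above for `σ = 1`, from below for `σ = -1`)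
is propagated by the nonlocal conservation law. -/
theorem BalanceLaw.one_sided_bound (hη : 0 < η) (hV : ContDiff ℝ 2 V)
    (hV' : ∀ x, deriv V x ≤ 0) (hu : BddCont u)
    (hl : BalanceLaw T u (fun t x => vel η V u t x * u t x) fun _ _ => 0)
    {σ c : ℝ} (hσ : σ = 1 ∨ σ = -1) (hc : 0 ≤ c) (h0 : ∀ᵐ x, σ * (u 0 x - c) ≤ 0)
    {t : ℝ} (ht : t ∈ Icc 0 T) : ∀ᵐ x, σ * (u t x - c) ≤ 0 := by
  have hprob := isProbabilityMeasure_expLaw hη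
  have hW := bddCont_vel hη hV hu
  have hp := bddCont_velSlope hη hV hu
  have hVa : Antitone V := antitone_of_deriv_nonpos (hV.differentiable two_ne_zero) hV'
  obtain ⟨C, hC0, hC⟩ := hu.bdd
  obtain ⟨CW, hCW0, hCW⟩ := hW.bdd
  obtain ⟨Cp, hCp0, hCp⟩ := hp.bdd
  obtain ⟨L, hL0, hL⟩ := exists_lipschitz_bound (hV.of_le one_le_two).locallyLipschitz (max C c)
  obtain ⟨κ, ψ, hκ, hψ, hψi, hψi', hψpos, hψd, hψadj⟩ := exists_weight hη
  set m : ℝ → ℝ := fun a => max (σ * (a - c)) 0 with hm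
  have hm0 : ∀ a, 0 ≤ m a := fun a => le_max_right _ _
  have hmσ : ∀ a, σ * (a - c) * m a = m a ^ 2 := fun a => by
    rcases le_total (σ * (a - c)) 0 with h | h
    · simp [hm, max_eq_right h]
    · rw [hm]; simp only; rw [max_eq_left h]; ring
  set β : ℝ → ℝ := fun a => m a ^ 2 with hβdef
  have hσ2 : σ * σ = 1 := by rcases hσ with rfl | rfl <;> norm_num
  have hβd : ∀ a, HasDerivAt β (2 * σ * m a) a := fun a => by
    have h1 : HasDerivAt (fun a => σ * (a - c)) σ a := by
      simpa using ((hasDerivAt_id a).sub_const c).const_mul σ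
    have := (hasDerivAt_sq_max_zero (σ * (a - c))).comp a h1
    convert! this using 1
    simp only [hm]; ring
  have hβ1 : ContDiff ℝ 1 β := by
    rw [contDiff_one_iff_deriv]
    refine ⟨fun a => (hβd a).differentiableAt, ?_⟩
    rw [funext fun a => (hβd a).deriv]
    fun_prop
  -- Writing `a = c + (a - c)` isolates the only term that is linear, not quadratic, in the
  -- violation `m`. A bound on the velocity gradient by a constant would not suffice for it; the
  -- sign of the gradient has to be used.
  have hsrc : ∀ a, β a - a * deriv β a = -(m a ^ 2) - 2 * c * σ * m a := fun a => by
    rw [(hβd a).deriv]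
    linear_combination (-2) * hmσ a
  have hB : BddCont fun t x => β (u t x) := hu.comp hβ1.locallyLipschitz
  obtain ⟨CB, hCB0, hCB⟩ := hB.bdd
  have hKB : BddCont fun t => avg (expLaw η) fun x => β (u t x) := hB.avg
  have hlβ := hl.renormalize hu hW hp (BddCont.const (C := 0) aestronglyMeasurable_const (by simp))
    (vel_sub hη hV hu) hβ1
  set y : ℝ → ℝ := fun t => ∫ x, β (u t x) * ψ x with hy
  have hyc : Continuous y := hB.continuous_integral hψi
  have hy0 : ∀ t, 0 ≤ y t := fun t => integral_nonneg fun x =>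
    mul_nonneg (sq_nonneg _) (hψpos x).le
  set K : ℝ := c * (η⁻¹ * L) with hK
  have hK0 : 0 ≤ K := by positivity
  -- pointwise bound of the source term
  have hptw : ∀ t, ∀ᵐ x, (β (u t x) - u t x * deriv β (u t x)) * velSlope η V u t x
      ≤ Cp * β (u t x) + K * (β (u t x) + avg (expLaw η) (fun x => β (u t x)) x) := by
    intro t
    have hz := hu.comp (hV.of_le one_le_two).locallyLipschitz
    obtain ⟨Cz, -, hCz⟩ := hz.bdd
    have hmB : BddCont fun t x => m (u t x) := by
      refine hu.comp (LipschitzWith.locallyLipschitz (K := 1) ?_)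
      refine LipschitzWith.of_dist_le_mul fun a b => ?_
      rw [Real.dist_eq, Real.dist_eq, NNReal.coe_one, one_mul]
      refine (abs_max_sub_max_le_abs _ _ _).trans (le_of_eq ?_)
      rw [← mul_sub, abs_mul, sub_sub_sub_cancel_right]
      rcases hσ with rfl | rfl <;> simp
    obtain ⟨Cm, -, hCm⟩ := hmB.bdd
    filter_upwards [hC t, hCp t, integrable_shift (μ := expLaw η) (hB.meas t) (hCB t),
      integrable_shift (μ := expLaw η) (hz.meas t) (hCz t),
      integrable_shift (μ := expLaw η) (hmB.meas t) (hCm t),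
      ae_ae_add (μ := expLaw η) (hC t)] with x hx hpx hiB hiz him hCa
    have hv := hm0 (u t x)
    -- the velocity gradient is bounded below where the bound is violated
    have hgrad : -(σ * velSlope η V u t x) * m (u t x)
        ≤ η⁻¹ * L * (avg (expLaw η) (fun x => m (u t x)) x * m (u t x)) := by
      rcases eq_or_lt_of_le hv with hv0 | hv0
      · rw [← hv0]; simp
      rw [← mul_assoc]
      refine mul_le_mul_of_nonneg_right ?_ hv
      have hpos : 0 < σ * (u t x - c) := by
        by_contra! hneg
        rw [hm] at hv0
        simp [max_eq_right hneg] at hv0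
      have h1 : σ * V (u t x) ≤ σ * V c := by
        rcases hσ with rfl | rfl
        · simpa using hVa (show c ≤ u t x by linarith)
        · simpa using hVa (show u t x ≤ c by linarith)
      -- Monotonicity of `V` gives the favourable sign at every shifted point where the bound holds.
      -- Only shifted points that violate it contribute, at most `L` times their own violation.
      have h2 : σ * V c - σ * vel η V u t x ≤ L * avg (expLaw η) (fun x => m (u t x)) x := by
        have : σ * V c - σ * vel η V u t x
            = ∫ a, (σ * V c - σ * V (u t (x + a))) ∂expLaw η := by
          rw [integral_sub (integrable_const _) (hiz.const_mul σ),
            integral_const_mul σ (fun a => V (u t (x + a)))]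
          simp [vel, avg]
        rw [this, avg, ← integral_const_mul]
        refine integral_mono_ae ((integrable_const _).sub (hiz.const_mul σ)) (him.const_mul L) ?_
        filter_upwards [hCa] with a ha
        rcases le_total (σ * (u t (x + a) - c)) 0 with hs | hs
        · have h3 : σ * V c ≤ σ * V (u t (x + a)) := by
            rcases hσ with rfl | rfl
            · simpa using hVa (show u t (x + a) ≤ c by linarith)
            · simpa using hVa (show c ≤ u t (x + a) by linarith)
          have := mul_nonneg hL0 (hm0 (u t (x + a)))
          linarith
        · have h3 : m (u t (x + a)) = |u t (x + a) - c| := by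
            rw [hm]; simp only; rw [max_eq_left hs, ← abs_of_nonneg hs, abs_mul]
            rcases hσ with rfl | rfl <;> simp
          have h4 := hL (u t (x + a)) c (ha.trans (le_max_left _ _))
            ((abs_of_nonneg hc).le.trans (le_max_right _ _))
          rw [← h3] at h4
          refine le_trans ?_ h4
          rw [abs_sub_comm, ← mul_sub]
          refine (le_abs_self _).trans (le_of_eq ?_)
          rw [abs_mul]
          rcases hσ with rfl | rfl <;> simp
      calc -(σ * velSlope η V u t x) = η⁻¹ * (σ * V (u t x) - σ * vel η V u t x) := by
            rw [velSlope]; ring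
        _ ≤ η⁻¹ * (L * avg (expLaw η) (fun x => m (u t x)) x) := by
            gcongr
            linarith
        _ = _ := by ring
    have hprod : 2 * (avg (expLaw η) (fun x => m (u t x)) x * m (u t x))
        ≤ β (u t x) + avg (expLaw η) (fun x => β (u t x)) x := by
      have h1 : β (u t x) + avg (expLaw η) (fun x => β (u t x)) x
          = ∫ a, (β (u t x) + β (u t (x + a))) ∂expLaw η := by
        rw [integral_add (integrable_const _) hiB]; simp [avg]
      rw [h1, avg, ← integral_mul_const, ← integral_const_mul]
      refine integral_mono ((him.mul_const _).const_mul 2) ((integrable_const _).add hiB) fun a => ?_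
      simp only [hβdef]
      nlinarith [sq_nonneg (m (u t x) - m (u t (x + a)))]
    have h5 : -(m (u t x) ^ 2) * velSlope η V u t x ≤ Cp * β (u t x) := by
      have := (abs_le.mp hpx).1
      nlinarith [sq_nonneg (m (u t x))]
    have hηL : 0 ≤ η⁻¹ * L := by positivity
    have h6 : 2 * c * (-(σ * velSlope η V u t x) * m (u t x))
        ≤ K * (β (u t x) + avg (expLaw η) (fun x => β (u t x)) x) := by
      calc 2 * c * (-(σ * velSlope η V u t x) * m (u t x))
          ≤ 2 * c * (η⁻¹ * L * (avg (expLaw η) (fun x => m (u t x)) x * m (u t x))) := by gcongr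
        _ = K * (2 * (avg (expLaw η) (fun x => m (u t x)) x * m (u t x))) := by rw [hK]; ring
        _ ≤ _ := by gcongr
    rw [hsrc]
    linarith
  -- The constant collects `CW * κ` from transport through `|ψ'| ≤ κ ψ`, `Cp` from the quadratic
  -- source, and `3 * K` from the linear one. In the last, the local part counts once and the
  -- averaged part at most twice, by the choice of the weight.
  have hgron : ∀ t ∈ Icc 0 T, y t ≤ (CW * κ + Cp + 3 * K) * ∫ r in (0 : ℝ)..t, y r := by
    intro t ht
    have hSB : BddCont fun t x => (β (u t x) - u t x * deriv β (u t x)) * velSlope η V u t x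
        + deriv β (u t x) * 0 := by
      have h1 : BddCont fun t x => deriv β (u t x) := by
        have : (fun t x => deriv β (u t x)) = fun t x => 2 * σ * m (u t x) := by
          ext t x; exact (hβd _).deriv
        rw [this]
        refine BddCont.const_mul (hu.comp (LipschitzWith.locallyLipschitz (K := 1) ?_)) _
        refine LipschitzWith.of_dist_le_mul fun a b => ?_
        rw [Real.dist_eq, Real.dist_eq, NNReal.coe_one, one_mul]
        refine (abs_max_sub_max_le_abs _ _ _).trans (le_of_eq ?_)
        rw [← mul_sub, abs_mul, sub_sub_sub_cancel_right]
        rcases hσ with rfl | rfl <;> simp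
      simpa using (hB.sub (hu.mul h1)).mul hp
    have hext := hlβ.extend hB (hW.mul hB) hSB hψ hψi hψi' le_rfl ht.1 ht.2
    have hy00 : y 0 = 0 := by
      rw [hy]
      refine integral_eq_zero_of_ae ?_
      filter_upwards [h0] with x hx
      simp [hβdef, hm, max_eq_right hx]
    have hle : y t - y 0 ≤ ∫ r in (0 : ℝ)..t, (CW * κ + Cp + 3 * K) * y r := by
      rw [hy]
      simp only
      rw [hext]
      refine intervalIntegral.integral_mono_on ht.1
        (((hW.mul hB).continuous_integral hψi').add
          (hSB.continuous_integral hψi) |>.intervalIntegrable _ _)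
        ((hyc.const_mul _).intervalIntegrable _ _) fun r _ => ?_
      have i1 : Integrable fun x => β (u r x) * ψ x := hB.integrable_mul hψi r
      have i2 : Integrable fun x => avg (expLaw η) (fun x => β (u r x)) x * ψ x :=
        hKB.integrable_mul hψi r
      have e1 : ∫ x, vel η V u r x * β (u r x) * deriv ψ x ≤ CW * κ * y r := by
        rw [hy, ← integral_const_mul]
        refine integral_mono_ae ((hW.mul hB).integrable_mul hψi' r) (i1.const_mul _) ?_
        filter_upwards [hCW r] with x hx
        refine (le_abs_self _).trans ?_
        rw [abs_mul, abs_mul, abs_of_nonneg (sq_nonneg (m (u r x)) : 0 ≤ β (u r x))]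
        have hβ0 : 0 ≤ β (u r x) := sq_nonneg _
        calc |vel η V u r x| * β (u r x) * |deriv ψ x| ≤ CW * β (u r x) * (κ * ψ x) := by
              gcongr; exact hψd x
          _ = _ := by ring
      have e2 : ∫ x, avg (expLaw η) (fun x => β (u r x)) x * ψ x ≤ 2 * y r := by
        rw [integral_avg_mul (hB.meas r) (hCB r) hψi, hy, ← integral_const_mul]
        refine integral_mono (hB.integrable_mul (integrable_adj hψi) r) (i1.const_mul _) fun x => ?_
        have hβ0 : 0 ≤ β (u r x) := sq_nonneg _
        simp only
        nlinarith [mul_le_mul_of_nonneg_left (hψadj x) hβ0]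
      have e3 : ∫ x, ((β (u r x) - u r x * deriv β (u r x)) * velSlope η V u r x
          + deriv β (u r x) * 0) * ψ x
          ≤ Cp * y r + K * (y r + ∫ x, avg (expLaw η) (fun x => β (u r x)) x * ψ x) := by
        have i3 : Integrable fun x => Cp * (β (u r x) * ψ x) := i1.const_mul Cp
        have i4 : Integrable fun x => β (u r x) * ψ x
          + avg (expLaw η) (fun x => β (u r x)) x * ψ x := i1.add i2
        rw [hy, ← integral_add i1 i2, ← integral_const_mul, ← integral_const_mul,
          ← integral_add i3 (i4.const_mul K)]
        refine integral_mono_ae (hSB.integrable_mul hψi r) (i3.add (i4.const_mul K)) ?_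
        filter_upwards [hptw r] with x hx
        rw [mul_zero, add_zero]
        calc _ ≤ (Cp * β (u r x) + K * (β (u r x) + avg (expLaw η) (fun x => β (u r x)) x))
              * ψ x := mul_le_mul_of_nonneg_right hx (hψpos x).le
          _ = _ := by ring
      have e4 := mul_le_mul_of_nonneg_left e2 hK0
      linarith
    rw [intervalIntegral.integral_const_mul, hy00, sub_zero] at hle
    exact hle
  have hyt := eq_zero_of_le_integral hyc hy0 hgron t ht
  rw [hy] at hyt
  have := (integral_eq_zero_iff_of_nonneg (fun x => mul_nonneg (sq_nonneg _) (hψpos x).le)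
    (hB.integrable_mul hψi t)).mp hyt
  filter_upwards [this] with x hx
  have h1 : m (u t x) ^ 2 = 0 := (mul_eq_zero.mp hx).resolve_right (hψpos x).ne'
  have h2 : m (u t x) = 0 := by simpa using h1
  exact max_eq_right_iff.mp h2

end Velocity

/-! ### The equation for the slope of the velocity -/

/-- The integral of the derivative of an integrable, locally absolutely continuous function
vanishes. -/
lemma integral_deriv_eq_zero_of_integrable {k k' : ℝ → ℝ}
    (hac : ∀ a b, AbsolutelyContinuousOnInterval k a b) (hd : ∀ᵐ x, HasDerivAt k (k' x) x)
    (hk : Integrable k) (hk' : Integrable k') : ∫ x, k' x = 0 := by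
  obtain ⟨D, χ, hD, hχ⟩ := exists_cutoff
  have habs : ∀ n x, |χ n x| ≤ 1 := fun n x => by
    rw [abs_of_nonneg ((hχ n).2.2.1 x).1]; exact ((hχ n).2.2.1 x).2
  have hdχ : ∀ n x, |deriv (χ n) x| ≤ D := fun n x =>
    ((hχ n).2.2.2.1 x).trans (div_le_self hD (by linarith [n.cast_nonneg (α := ℝ)]))
  have hzero : ∀ n, ∫ x, (deriv (χ n) x * k x + χ n x * k' x) = 0 := fun n => by
    refine integral_deriv_eq_zero_of_ac (k := fun x => χ n x * k x) (fun a b =>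
      ((hχ n).1.contDiffOn.absolutelyContinuousOnInterval).fun_mul (hac a b))
      (hχ n).2.1.mul_right ?_
    filter_upwards [hd] with x hx
    exact ((hχ n).1.differentiable one_ne_zero x).hasDerivAt.mul hx
  have hlim : Tendsto (fun n => ∫ x, (deriv (χ n) x * k x + χ n x * k' x)) atTop
      (𝓝 (∫ x, k' x)) := by
    refine tendsto_integral_of_dominated_convergence (fun x => D * |k x| + |k' x|) (fun n => ?_)
      ((hk.abs.const_mul D).add hk'.abs) (fun n => ae_of_all _ fun x => ?_)
      (ae_of_all _ fun x => ?_)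
    · exact (((hχ n).1.continuous_deriv le_rfl).aestronglyMeasurable.mul hk.1).add
        ((hχ n).1.continuous.aestronglyMeasurable.mul hk'.1)
    · refine (abs_add_le _ _).trans (add_le_add ?_ ?_)
      · rw [abs_mul]; gcongr; exact hdχ n x
      · rw [abs_mul]; exact mul_le_of_le_one_left (abs_nonneg _) (habs n x)
    · have h1 : Tendsto (fun n => deriv (χ n) x) atTop (𝓝 0) :=
        squeeze_zero_norm (fun n => (hχ n).2.2.2.1 x)
          (tendsto_const_nhds.div_atTop (tendsto_natCast_atTop_atTop.atTop_add tendsto_const_nhds))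
      have h2 := tendsto_of_eq_one (fun n => (hχ n).2.2.2.2) x
      simpa using (h1.mul_const (k x)).add (h2.mul_const (k' x))
  simp only [hzero] at hlim
  exact tendsto_nhds_unique hlim tendsto_const_nhds |>.symm ▸ rfl

section SlopeLaw

variable {T η : ℝ}

set_option maxHeartbeats 1000000 in
/-- If `∂ₜ z + ∂ₓ (W z) = W p - N` where `W` is the exponential average of `z` and
`p = ∂ₓ W = (W - z) / η`, then `∂ₜ p + ∂ₓ (W p) = (N - 𝒲 N) / η`, where `𝒲` denotes the
exponential average. -/
theorem BalanceLaw.slope (hη : 0 < η) {z N : ℝ → ℝ → ℝ} (hz : BddCont z) (hN : BddCont N)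
    {W p : ℝ → ℝ → ℝ} (hWdef : ∀ t, W t = avg (expLaw η) (z t))
    (hpdef : ∀ t x, p t x = η⁻¹ * (W t x - z t x))
    (hl : BalanceLaw T z (fun t x => W t x * z t x) fun t x => W t x * p t x - N t x) :
    BalanceLaw T p (fun t x => W t x * p t x)
      fun t x => η⁻¹ * (N t x - avg (expLaw η) (N t) x) := by
  have hprob := isProbabilityMeasure_expLaw hη
  have hW : BddCont W := by
    rw [funext hWdef]; exact hz.avg
  have hp : BddCont p := by
    have : p = fun t x => η⁻¹ * (W t x - z t x) := by ext t x; exact hpdef t x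
    rw [this]; exact (hW.sub hz).const_mul η⁻¹
  have hKN : BddCont fun t => avg (expLaw η) (N t) := hN.avg
  obtain ⟨Cz, -, hCz⟩ := hz.bdd
  obtain ⟨CN, -, hCN⟩ := hN.bdd
  obtain ⟨Cp, hCp0, hCp⟩ := hp.bdd
  have hWp : ∀ t x y, W t y - W t x = ∫ ξ in x..y, p t ξ := fun t x y => by
    simp only [hpdef]
    rw [hWdef]
    exact avg_expLaw_sub hη (hz.meas t) (hCz t) x y
  intro ψ hψ hψc s t hs hst ht
  have hψi := integrable_of_test hψ hψc
  have hψi' := integrable_deriv_of_test hψ hψc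
  obtain ⟨M, hM⟩ := hψ.continuous.bounded_above_of_compact_support hψc
  -- By duality `∫ W ψ = ∫ z Ψ`, so testing `p` with `ψ` amounts to testing `z` with `(Ψ - ψ) / η`.
  -- As `Ψ` need not have compact support, the law for `z` must first be extended to integrable test
  -- functions.
  obtain ⟨Ψ, hΨ⟩ : ∃ Ψ, Ψ = adj (expLaw η) ψ := ⟨_, rfl⟩
  have hΨd : ∀ y, HasDerivAt Ψ (η⁻¹ * (ψ y - Ψ y)) y := by
    rw [hΨ]; exact hasDerivAt_adj_expLaw hη hψ.continuous hM
  have hΨ' : deriv Ψ = fun y => η⁻¹ * (ψ y - Ψ y) := funext fun y => (hΨd y).deriv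
  have hΨc : Continuous Ψ := continuous_iff_continuousAt.mpr fun y => (hΨd y).continuousAt
  have hΨ1 : ContDiff ℝ 1 Ψ := by
    rw [contDiff_one_iff_deriv]
    refine ⟨fun y => (hΨd y).differentiableAt, ?_⟩
    rw [hΨ']
    exact continuous_const.mul (hψ.continuous.sub hΨc)
  have hΨi : Integrable Ψ := hΨ ▸ integrable_adj hψi
  have hΨi' : Integrable (deriv Ψ) := by
    rw [hΨ']; exact (hψi.sub hΨi).const_mul η⁻¹
  have hS : BddCont fun t x => W t x * p t x - N t x := (hW.mul hp).sub hN
  have hF : BddCont fun t x => W t x * z t x := hW.mul hz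
  have l1 := hl.extend hz hF hS hΨ1 hΨi hΨi' hs hst ht
  have l2 := hl ψ hψ hψc s t hs hst ht
  have hpz : ∀ t, ∫ x, p t x * ψ x = η⁻¹ * ((∫ x, z t x * Ψ x) - ∫ x, z t x * ψ x) := fun t => by
    have h1 : ∫ x, W t x * ψ x = ∫ x, z t x * Ψ x := by
      rw [hWdef, hΨ]; exact integral_avg_mul (hz.meas t) (hCz t) hψi
    rw [← h1, ← integral_sub (hW.integrable_mul hψi t) (hz.integrable_mul hψi t),
      ← integral_const_mul]
    congr 1 with x
    rw [hpdef]; ring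
  -- The integrand is the derivative of `W² (Ψ - ψ)`. Modulo this exact derivative, the equation for
  -- `z` becomes the one for `p`.
  have hzero : ∀ r, ∫ x, (2 * (W r x * p r x) * (Ψ x - ψ x)
      + W r x * W r x * (deriv Ψ x - deriv ψ x)) = 0 := by
    intro r
    have hWac : ∀ a b, AbsolutelyContinuousOnInterval (W r) a b := fun a b =>
      (lipschitzWith_of_abs_sub_le (abs_sub_le_of_sub_eq_integral (hCp r)
        (hWp r))).lipschitzOnWith.absolutelyContinuousOnInterval
    have hD1 : ContDiff ℝ 1 fun x => Ψ x - ψ x := hΨ1.sub hψ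
    have hDi : Integrable fun x => Ψ x - ψ x := hΨi.sub hψi
    have hDi' : Integrable fun x => deriv Ψ x - deriv ψ x := hΨi'.sub hψi'
    have hkac : ∀ a b, AbsolutelyContinuousOnInterval
        (fun x => W r x * W r x * (Ψ x - ψ x)) a b := fun a b =>
      ((hWac a b).fun_mul (hWac a b)).fun_mul hD1.contDiffOn.absolutelyContinuousOnInterval
    have hki : Integrable fun x => W r x * W r x * (Ψ x - ψ x) := (hW.mul hW).integrable_mul hDi r
    have hki' : Integrable fun x => 2 * (W r x * p r x) * (Ψ x - ψ x)
        + W r x * W r x * (deriv Ψ x - deriv ψ x) :=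
      (((hW.mul hp).const_mul 2).integrable_mul hDi r).add ((hW.mul hW).integrable_mul hDi' r)
    refine integral_deriv_eq_zero_of_integrable hkac ?_ hki hki'
    filter_upwards [ae_hasDerivAt_of_sub_eq_integral (hp.locallyIntegrable r) (hWp r)] with x hx
    have h1 := (hx.mul hx).mul ((hΨ1.differentiable one_ne_zero x).hasDerivAt.sub
      (hψ.differentiable one_ne_zero x).hasDerivAt)
    convert! h1 using 1
    simp only [Pi.sub_apply, Pi.mul_apply]
    ring
  have c1 : Continuous fun r => (∫ x, W r x * z r x * deriv Ψ x)
      + ∫ x, (W r x * p r x - N r x) * Ψ x :=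
    (hF.continuous_integral hΨi').add (hS.continuous_integral hΨi)
  have c2 : Continuous fun r => (∫ x, W r x * z r x * deriv ψ x)
      + ∫ x, (W r x * p r x - N r x) * ψ x :=
    (hF.continuous_integral hψi').add (hS.continuous_integral hψi)
  simp only at l2 ⊢
  rw [hpz, hpz, ← mul_sub, sub_sub_sub_comm, l1, l2,
    ← intervalIntegral.integral_sub (c1.intervalIntegrable _ _) (c2.intervalIntegrable _ _),
    ← intervalIntegral.integral_const_mul]
  refine intervalIntegral.integral_congr fun r _ => ?_
  have hNs : ∫ x, avg (expLaw η) (N r) x * ψ x = ∫ x, N r x * Ψ x := by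
    rw [hΨ]; exact integral_avg_mul (hN.meas r) (hCN r) hψi
  have iF := fun {φ : ℝ → ℝ} (hφ : Integrable φ) => hF.integrable_mul hφ r
  have iS := fun {φ : ℝ → ℝ} (hφ : Integrable φ) => hS.integrable_mul hφ r
  have iWp := fun {φ : ℝ → ℝ} (hφ : Integrable φ) => (hW.mul hp).integrable_mul hφ r
  have iN := fun {φ : ℝ → ℝ} (hφ : Integrable φ) => hN.integrable_mul hφ r
  have hRψ : ∫ x, η⁻¹ * (N r x - avg (expLaw η) (N r) x) * ψ x
      = ∫ x, (η⁻¹ * (N r x * ψ x) - η⁻¹ * (N r x * Ψ x)) := by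
    rw [integral_sub ((iN hψi).const_mul _) ((iN hΨi).const_mul _), integral_const_mul,
      integral_const_mul, ← hNs, ← mul_sub,
      ← integral_sub (iN hψi) (hKN.integrable_mul hψi r), ← integral_const_mul]
    congr 1 with x
    ring
  have iL1 : Integrable fun x => W r x * z r x * deriv Ψ x
      + (W r x * p r x - N r x) * Ψ x := (iF hΨi').add (iS hΨi)
  have iL2 : Integrable fun x => W r x * z r x * deriv ψ x
      + (W r x * p r x - N r x) * ψ x := (iF hψi').add (iS hψi)
  have iR : Integrable fun x => η⁻¹ * (N r x * ψ x) - η⁻¹ * (N r x * Ψ x) :=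
    ((iN hψi).const_mul _).sub ((iN hΨi).const_mul _)
  have iZ : Integrable fun x => η⁻¹ * (2 * (W r x * p r x) * (Ψ x - ψ x)
      + W r x * W r x * (deriv Ψ x - deriv ψ x)) :=
    (((hW.mul hp).const_mul 2 |>.integrable_mul (hΨi.sub hψi) r).add
        ((hW.mul hW).integrable_mul (hΨi'.sub hψi') r)).const_mul _
  have iR2 : Integrable fun x => W r x * p r x * deriv ψ x
      + (η⁻¹ * (N r x * ψ x) - η⁻¹ * (N r x * Ψ x)) := (iWp hψi').add iR
  have hη0 := hη.ne'
  -- Pointwise algebra after substituting the two kernel relations `z = W - η p` and `ψ = Ψ + η Ψ'`.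
  have hpt : ∀ x, η⁻¹ * (W r x * z r x * deriv Ψ x + (W r x * p r x - N r x) * Ψ x
        - (W r x * z r x * deriv ψ x + (W r x * p r x - N r x) * ψ x))
      = W r x * p r x * deriv ψ x + (η⁻¹ * (N r x * ψ x) - η⁻¹ * (N r x * Ψ x))
        + η⁻¹ * (2 * (W r x * p r x) * (Ψ x - ψ x)
          + W r x * W r x * (deriv Ψ x - deriv ψ x)) := fun x => by
    have hzx : z r x = W r x - η * p r x := by rw [hpdef]; field_simp; ring
    have hψx : ψ x = Ψ x + η * deriv Ψ x := by rw [hΨ']; field_simp; ring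
    rw [hzx, hψx]
    field_simp
    ring
  calc η⁻¹ * ((∫ x, W r x * z r x * deriv Ψ x) + (∫ x, (W r x * p r x - N r x) * Ψ x)
        - ((∫ x, W r x * z r x * deriv ψ x) + ∫ x, (W r x * p r x - N r x) * ψ x))
      = ∫ x, η⁻¹ * (W r x * z r x * deriv Ψ x + (W r x * p r x - N r x) * Ψ x
        - (W r x * z r x * deriv ψ x + (W r x * p r x - N r x) * ψ x)) := by
        rw [integral_const_mul, integral_sub iL1 iL2, integral_add (iF hΨi') (iS hΨi),
          integral_add (iF hψi') (iS hψi)]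
    _ = (∫ x, (W r x * p r x * deriv ψ x + (η⁻¹ * (N r x * ψ x) - η⁻¹ * (N r x * Ψ x))))
        + ∫ x, η⁻¹ * (2 * (W r x * p r x) * (Ψ x - ψ x)
          + W r x * W r x * (deriv Ψ x - deriv ψ x)) := by
        rw [← integral_add iR2 iZ]
        exact integral_congr_ae (ae_of_all _ hpt)
    _ = (∫ x, W r x * p r x * deriv ψ x)
        + ∫ x, η⁻¹ * (N r x - avg (expLaw η) (N r) x) * ψ x := by
        rw [integral_const_mul η⁻¹ fun x => 2 * (W r x * p r x) * (Ψ x - ψ x)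
          + W r x * W r x * (deriv Ψ x - deriv ψ x), hzero, mul_zero, add_zero,
          integral_add (iWp hψi') iR, hRψ]

end SlopeLaw

/-! ### A smooth absolute value -/

/-- A smooth approximation of the absolute value. -/
def smoothAbs (δ x : ℝ) : ℝ := √(x ^ 2 + δ ^ 2)

section SmoothAbs

variable {δ : ℝ}

lemma smoothAbs_pos (hδ : 0 < δ) (x : ℝ) : 0 < smoothAbs δ x := Real.sqrt_pos.mpr (by positivity)

lemma sq_smoothAbs (δ x : ℝ) : smoothAbs δ x ^ 2 = x ^ 2 + δ ^ 2 := Real.sq_sqrt (by positivity)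

lemma contDiff_smoothAbs (hδ : 0 < δ) {n : WithTop ℕ∞} : ContDiff ℝ n (smoothAbs δ) :=
  ContDiff.sqrt (by fun_prop) fun x => by positivity

lemma deriv_smoothAbs (hδ : 0 < δ) : deriv (smoothAbs δ) = fun x => x / smoothAbs δ x := by
  ext x
  have h : HasDerivAt (fun x : ℝ => x ^ 2 + δ ^ 2) (2 * x) x := by
    simpa using (hasDerivAt_pow 2 x).add_const (δ ^ 2)
  have h2 := (h.sqrt (by positivity)).deriv
  change deriv (fun y => √(y ^ 2 + δ ^ 2)) x = _
  rw [h2, smoothAbs]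
  field_simp

lemma contDiff_deriv_smoothAbs (hδ : 0 < δ) {n : WithTop ℕ∞} :
    ContDiff ℝ n (deriv (smoothAbs δ)) := by
  rw [deriv_smoothAbs hδ]
  exact contDiff_id.div (contDiff_smoothAbs hδ) fun x => (smoothAbs_pos hδ x).ne'

lemma abs_le_smoothAbs (δ x : ℝ) : |x| ≤ smoothAbs δ x :=
  Real.abs_le_sqrt (by nlinarith)

lemma smoothAbs_le (hδ : 0 < δ) (x : ℝ) : smoothAbs δ x ≤ |x| + δ := by
  refine Real.sqrt_le_iff.mpr ⟨by positivity, ?_⟩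
  nlinarith [abs_nonneg x, sq_abs x]

lemma abs_deriv_smoothAbs_le (hδ : 0 < δ) (x : ℝ) : |deriv (smoothAbs δ) x| ≤ 1 := by
  rw [deriv_smoothAbs hδ, abs_div, abs_of_pos (smoothAbs_pos hδ x)]
  exact div_le_one_of_le₀ (abs_le_smoothAbs δ x) (smoothAbs_pos hδ x).le

/-- `x β'(x)` is within `δ` of `|x|`, and of `β(x)`. -/
lemma abs_sub_le_mul_deriv_smoothAbs (hδ : 0 < δ) (x : ℝ) :
    |x| - δ ≤ x * deriv (smoothAbs δ) x ∧ smoothAbs δ x - δ ≤ x * deriv (smoothAbs δ) x ∧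
      x * deriv (smoothAbs δ) x ≤ smoothAbs δ x := by
  have h0 := smoothAbs_pos hδ x
  have h1 := sq_smoothAbs δ x
  have h2 := abs_le_smoothAbs δ x
  have h3 : δ ≤ smoothAbs δ x := Real.le_sqrt_of_sq_le (by nlinarith)
  have h4 : x * deriv (smoothAbs δ) x = smoothAbs δ x - δ ^ 2 / smoothAbs δ x := by
    rw [deriv_smoothAbs hδ]
    field_simp
    linarith
  have h5 : δ ^ 2 / smoothAbs δ x ≤ δ := by
    rw [div_le_iff₀ h0, sq]
    gcongr
  have h6 : 0 ≤ δ ^ 2 / smoothAbs δ x := by positivity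
  exact ⟨by linarith, by linarith, by linarith⟩

end SmoothAbs

/-! ### Decay of the `L¹` norm of the slope -/

section Contraction

lemma integrable_abs_expLaw {η : ℝ} (hη : 0 < η) : Integrable (fun a => |a|) (expLaw η) := by
  rw [integrable_expLaw_iff hη]
  have h := (integrableOn_rpow_mul_exp_neg_mul_rpow (p := 1) (s := 1) (b := η⁻¹) (by norm_num)
    one_pos (by positivity)).const_mul η⁻¹
  refine IntegrableOn.congr_fun h (fun a ha => ?_) measurableSet_Ioi
  simp only [Real.rpow_one, abs_of_pos (mem_Ioi.mp ha)]
  ring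

/-- The mean value inequality gives `|ψ (y - a) - ψ y| ≤ d |a|`, so for a slowly varying test
function averaging costs `d` times the first moment of the law. -/
lemma abs_adj_sub_le {μ : Measure ℝ} [IsProbabilityMeasure μ] (hμ : Integrable (fun a => |a|) μ)
    {ψ : ℝ → ℝ} (hψ : ContDiff ℝ 1 ψ) {d : ℝ} (hd : ∀ x, |deriv ψ x| ≤ d) (y : ℝ) :
    |adj μ ψ y - ψ y| ≤ d * ∫ a, |a| ∂μ := by
  have hle (a : ℝ) : |ψ (y - a) - ψ y| ≤ d * |a| := by
    have h := convex_univ.norm_image_sub_le_of_norm_deriv_le (f := ψ) (C := d) (x := y)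
      (y := y - a) (fun x _ => hψ.differentiable one_ne_zero x) (fun x _ => hd x) trivial trivial
    simpa [Real.norm_eq_abs] using h
  have hm : AEStronglyMeasurable (fun a => ψ (y - a) - ψ y) μ :=
    ((hψ.continuous.comp (by fun_prop)).sub continuous_const).aestronglyMeasurable
  have hi : Integrable (fun a => ψ (y - a) - ψ y) μ :=
    (hμ.const_mul d).mono' hm (ae_of_all _ hle)
  have hi2 : Integrable (fun a => ψ (y - a)) μ := by
    refine (hi.add (integrable_const (ψ y))).congr (ae_of_all _ fun a => ?_)
    simp
  have heq : adj μ ψ y - ψ y = ∫ a, (ψ (y - a) - ψ y) ∂μ := by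
    rw [integral_sub hi2 (integrable_const _)]
    simp [adj]
  rw [heq, ← integral_const_mul]
  exact norm_integral_le_of_norm_le (f := fun a => ψ (y - a) - ψ y) (hμ.const_mul d)
    (ae_of_all _ hle)

variable {T η : ℝ} {W p N : ℝ → ℝ → ℝ}

/-- The source `(N - 𝒲 N) / η`, with `N = a p`, `a ≤ 0`, decreases `∫ |p| ψ` up to an error which
is small for slowly varying `ψ`. -/
lemma integral_source_le (hη : 0 < η) {f n : ℝ → ℝ} {C C₁ Cn d δ : ℝ} (hδ : 0 < δ) (hC : 0 ≤ C)
    (hfi : Integrable f) (hf1 : ∫ x, |f x| ≤ C₁)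
    (hn : AEStronglyMeasurable n volume) (hnb : ∀ᵐ x, |n x| ≤ Cn)
    (hnf : ∀ᵐ x, ∃ a, -C ≤ a ∧ a ≤ 0 ∧ n x = a * f x)
    {ψ : ℝ → ℝ} (hψ : ContDiff ℝ 1 ψ) (hψi : Integrable ψ) (hψ0 : ∀ x, 0 ≤ ψ x)
    (hd0 : 0 ≤ d) (hd : ∀ x, |deriv ψ x| ≤ d) :
    ∫ x, deriv (smoothAbs δ) (f x) * (η⁻¹ * (n x - avg (expLaw η) n x)) * ψ x
      ≤ η⁻¹ * (C * δ * (∫ x, ψ x) + C * (d * ∫ a, |a| ∂expLaw η) * C₁) := by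
  have hprob := isProbabilityMeasure_expLaw hη
  set m := ∫ a, |a| ∂expLaw η
  have hm0 : 0 ≤ m := integral_nonneg fun a => abs_nonneg a
  have hna : AEStronglyMeasurable (fun x => |n x|) volume := hn.norm
  have hnab : ∀ᵐ x, |(|n x|)| ≤ Cn := by simpa using hnb
  have hnf' : ∀ᵐ x, |n x| ≤ C * |f x| := by
    filter_upwards [hnf] with x ⟨a, h1, h2, h3⟩
    rw [h3, abs_mul]
    gcongr
    exact abs_le.mpr ⟨h1, h2.trans hC⟩
  have hni : Integrable fun x => |n x| :=
    (hfi.abs.const_mul C).mono' hna (by simpa using hnf')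
  have i1 : Integrable fun x => |n x| * ψ x := integrable_bdd_mul hna hnab hψi
  have i2 : Integrable fun x => avg (expLaw η) (fun x => |n x|) x * ψ x :=
    integrable_bdd_mul (aestronglyMeasurable_avg hna) (abs_avg_le hnab) hψi
  have i3 : Integrable fun x => |n x| * adj (expLaw η) ψ x :=
    integrable_bdd_mul hna hnab (integrable_adj hψi)
  have hpt : ∀ᵐ x, deriv (smoothAbs δ) (f x) * (η⁻¹ * (n x - avg (expLaw η) n x)) * ψ x
      ≤ η⁻¹ * (C * δ * ψ x + (avg (expLaw η) (fun x => |n x|) x * ψ x - |n x| * ψ x)) := by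
    filter_upwards [hnf] with x ⟨a, h1, h2, h3⟩
    have hb := abs_deriv_smoothAbs_le hδ (f x)
    obtain ⟨hc, -, -⟩ := abs_sub_le_mul_deriv_smoothAbs hδ (f x)
    -- The place where `a ≤ 0` enters: formally `sgn(f) n = a |f| = -|n|`, and smoothing the sign
    -- costs at most `C * δ`.
    have h4 : deriv (smoothAbs δ) (f x) * n x ≤ C * δ - |n x| := by
      rw [h3, abs_mul, abs_of_nonpos h2]
      nlinarith [mul_nonneg (neg_nonneg.mpr h2) (sub_nonneg.mpr hc),
        mul_nonneg hδ.le (neg_le_iff_add_nonneg'.mp h1)]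
    have h5 : |avg (expLaw η) n x| ≤ avg (expLaw η) (fun x => |n x|) x :=
      abs_integral_le_integral_abs
    have h6 : -(deriv (smoothAbs δ) (f x) * avg (expLaw η) n x)
        ≤ avg (expLaw η) (fun x => |n x|) x := by
      refine (neg_le_abs _).trans ?_
      rw [abs_mul]
      exact (mul_le_of_le_one_left (abs_nonneg _) hb).trans h5
    calc _ = η⁻¹ * ((deriv (smoothAbs δ) (f x) * n x
          + -(deriv (smoothAbs δ) (f x) * avg (expLaw η) n x)) * ψ x) := by ring
      _ ≤ η⁻¹ * (((C * δ - |n x|) + avg (expLaw η) (fun x => |n x|) x) * ψ x) := by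
        have := hψ0 x
        gcongr
      _ = _ := by ring
  have i4 : Integrable fun x =>
      avg (expLaw η) (fun x => |n x|) x * ψ x - |n x| * ψ x := i2.sub i1
  have hr : Integrable fun x => η⁻¹ * (C * δ * ψ x
      + (avg (expLaw η) (fun x => |n x|) x * ψ x - |n x| * ψ x)) :=
    ((hψi.const_mul (C * δ)).add i4).const_mul η⁻¹
  have hl : Integrable fun x =>
      deriv (smoothAbs δ) (f x) * (η⁻¹ * (n x - avg (expLaw η) n x)) * ψ x := by
    refine integrable_bdd_mul (C := η⁻¹ * (Cn + Cn)) ?_ ?_ hψi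
    · exact ((contDiff_deriv_smoothAbs hδ (n := 0)).continuous.comp_aestronglyMeasurable
        hfi.1).mul ((hn.sub (aestronglyMeasurable_avg hn)).const_mul _)
    · filter_upwards [hnb, abs_avg_le (μ := expLaw η) hnb] with x h1 h2
      rw [abs_mul, abs_mul, abs_of_pos (inv_pos.mpr hη)]
      refine (mul_le_of_le_one_left (by positivity) (abs_deriv_smoothAbs_le hδ _)).trans ?_
      gcongr
      exact (abs_sub _ _).trans (add_le_add h1 h2)
  refine (integral_mono_ae hl hr hpt).trans ?_
  rw [integral_const_mul, integral_add (hψi.const_mul _) i4, integral_const_mul,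
    integral_sub i2 i1, integral_avg_mul hna hnab hψi, ← integral_sub i3 i1]
  -- The gain `∫ 𝒲|n| ψ` and the loss `∫ |n| ψ` would cancel exactly for constant `ψ`. What survives
  -- is the failure of `ψ` to equal its adjoint average.
  have hlast : ∫ x, (|n x| * adj (expLaw η) ψ x - |n x| * ψ x) ≤ C * (d * m) * C₁ := by
    calc ∫ x, (|n x| * adj (expLaw η) ψ x - |n x| * ψ x)
        ≤ ∫ x, C * (d * m) * |f x| := by
          refine integral_mono_ae (i3.sub i1) (hfi.abs.const_mul _) ?_
          filter_upwards [hnf'] with x hx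
          have h1 := abs_adj_sub_le (integrable_abs_expLaw hη) hψ hd x
          calc |n x| * adj (expLaw η) ψ x - |n x| * ψ x
              = |n x| * (adj (expLaw η) ψ x - ψ x) := by ring
            _ ≤ (C * |f x|) * (d * m) :=
              (mul_le_mul_of_nonneg_left ((le_abs_self _).trans h1) (abs_nonneg _)).trans
                (mul_le_mul_of_nonneg_right hx (mul_nonneg hd0 hm0))
            _ = C * (d * m) * |f x| := by ring
      _ ≤ _ := by
        rw [integral_const_mul]
        gcongr
  gcongr

/-- The localized `L¹` estimate for the slope. -/
lemma BalanceLaw.integral_abs_mul_le (hη : 0 < η) (hW : BddCont W) (hp : BddCont p)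
    (hN : BddCont N) (hWp : ∀ t x y, W t y - W t x = ∫ z in x..y, p t z)
    (hl : BalanceLaw T p (fun t x => W t x * p t x)
      fun t x => η⁻¹ * (N t x - avg (expLaw η) (N t) x))
    {CW C C₁ : ℝ} (hCW0 : 0 ≤ CW) (hCW : ∀ t, ∀ᵐ x, |W t x| ≤ CW) (hC : 0 ≤ C)
    (hNp : ∀ t ∈ Icc 0 T, ∀ᵐ x, ∃ a, -C ≤ a ∧ a ≤ 0 ∧ N t x = a * p t x)
    (hpi : ∀ t ∈ Icc 0 T, Integrable (p t)) (hp1 : ∀ t ∈ Icc 0 T, ∫ x, |p t x| ≤ C₁)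
    {ψ : ℝ → ℝ} (hψ : ContDiff ℝ 1 ψ) (hψc : HasCompactSupport ψ) (hψ0 : ∀ x, 0 ≤ ψ x)
    {d : ℝ} (hd0 : 0 ≤ d) (hd : ∀ x, |deriv ψ x| ≤ d)
    {s t : ℝ} (hs : 0 ≤ s) (hst : s ≤ t) (ht : t ≤ T) :
    ∫ x, |p t x| * ψ x ≤ (∫ x, |p s x| * ψ x)
      + d * ((t - s) * ((CW + η⁻¹ * C * ∫ a, |a| ∂expLaw η) * C₁)) := by
  have hprob := isProbabilityMeasure_expLaw hη
  obtain ⟨Cp, hCp0, hCp⟩ := hp.bdd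
  obtain ⟨CN, hCN0, hCN⟩ := hN.bdd
  set m := ∫ a, |a| ∂expLaw η
  have hψi := integrable_of_test hψ hψc
  have hψi' := integrable_deriv_of_test hψ hψc
  have hR : BddCont fun t x => η⁻¹ * (N t x - avg (expLaw η) (N t) x) :=
    (hN.sub hN.avg).const_mul η⁻¹
  -- Two kinds of error: those proportional to `δ` vanish for fixed `ψ` when the smoothing is
  -- removed. Those proportional to `d` remain, and vanish only when the cutoff is spread out.
  have key : ∀ δ > 0, ∫ x, |p t x| * ψ x ≤ (∫ x, |p s x| * ψ x)
      + d * ((t - s) * ((CW + η⁻¹ * C * m) * C₁))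
      + δ * ((∫ x, ψ x) + (t - s) * (CW * (∫ x, |deriv ψ x|) + (Cp + η⁻¹ * C) * ∫ x, ψ x)) := by
    intro δ hδ
    have hβ : ContDiff ℝ 1 (smoothAbs δ) := contDiff_smoothAbs hδ
    have hβ' : ContDiff ℝ 1 (deriv (smoothAbs δ)) := contDiff_deriv_smoothAbs hδ
    have hb : BddCont fun t x => smoothAbs δ (p t x) := hp.comp hβ.locallyLipschitz
    have hb' : BddCont fun t x => deriv (smoothAbs δ) (p t x) := hp.comp hβ'.locallyLipschitz
    have hWb : BddCont fun t x => W t x * smoothAbs δ (p t x) := hW.mul hb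
    have hS1 : BddCont fun t x =>
        (smoothAbs δ (p t x) - p t x * deriv (smoothAbs δ) (p t x)) * p t x :=
      (hb.sub (hp.mul hb')).mul hp
    have hS2 : BddCont fun t x => deriv (smoothAbs δ) (p t x)
        * (η⁻¹ * (N t x - avg (expLaw η) (N t) x)) := hb'.mul hR
    have hS : BddCont fun t x =>
        (smoothAbs δ (p t x) - p t x * deriv (smoothAbs δ) (p t x)) * p t x
          + deriv (smoothAbs δ) (p t x) * (η⁻¹ * (N t x - avg (expLaw η) (N t) x)) := hS1.add hS2
    have hlaw := hl.renormalize hp hW hp hR hWp hβ ψ hψ hψc s t hs hst ht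
    simp only at hlaw
    have hbound : ∀ r ∈ Icc s t, (∫ x, W r x * smoothAbs δ (p r x) * deriv ψ x)
        + (∫ x, ((smoothAbs δ (p r x) - p r x * deriv (smoothAbs δ) (p r x)) * p r x
          + deriv (smoothAbs δ) (p r x) * (η⁻¹ * (N r x - avg (expLaw η) (N r) x))) * ψ x)
        ≤ d * ((CW + η⁻¹ * C * m) * C₁)
          + δ * (CW * (∫ x, |deriv ψ x|) + (Cp + η⁻¹ * C) * ∫ x, ψ x) := by
      intro r hr
      have hr' : r ∈ Icc 0 T := ⟨hs.trans hr.1, hr.2.trans ht⟩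
      have e1 : ∫ x, W r x * smoothAbs δ (p r x) * deriv ψ x
          ≤ CW * d * C₁ + CW * δ * ∫ x, |deriv ψ x| := by
        have i : Integrable fun x => CW * d * |p r x| + CW * δ * |deriv ψ x| :=
          ((hpi r hr').abs.const_mul _).add (hψi'.abs.const_mul _)
        calc ∫ x, W r x * smoothAbs δ (p r x) * deriv ψ x
            ≤ ∫ x, (CW * d * |p r x| + CW * δ * |deriv ψ x|) := by
              refine integral_mono_ae (hWb.integrable_mul hψi' r) i ?_
              filter_upwards [hCW r] with x hx
              refine (le_abs_self _).trans ?_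
              rw [abs_mul, abs_mul, abs_of_pos (smoothAbs_pos hδ _)]
              calc |W r x| * smoothAbs δ (p r x) * |deriv ψ x|
                  ≤ CW * (|p r x| + δ) * |deriv ψ x| := by
                    gcongr
                    · exact (smoothAbs_pos hδ _).le
                    · exact smoothAbs_le hδ _
                _ = CW * |deriv ψ x| * |p r x| + CW * δ * |deriv ψ x| := by ring
                _ ≤ _ := by gcongr; exact hd x
          _ ≤ _ := by
            rw [integral_add ((hpi r hr').abs.const_mul _) (hψi'.abs.const_mul _),
              integral_const_mul, integral_const_mul]
            gcongr
            exact hp1 r hr'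
      have e2 : ∫ x, (smoothAbs δ (p r x) - p r x * deriv (smoothAbs δ) (p r x)) * p r x * ψ x
          ≤ δ * Cp * ∫ x, ψ x := by
        rw [← integral_const_mul]
        refine integral_mono_ae (hS1.integrable_mul hψi r) (hψi.const_mul _) ?_
        filter_upwards [hCp r] with x hx
        obtain ⟨-, h1, h2⟩ := abs_sub_le_mul_deriv_smoothAbs hδ (p r x)
        refine mul_le_mul_of_nonneg_right ?_ (hψ0 x)
        exact (mul_le_mul_of_nonneg_left ((le_abs_self _).trans hx) (by linarith)).trans
          (mul_le_mul_of_nonneg_right (by linarith) hCp0)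
      have e3 := integral_source_le hη hδ hC (hpi r hr') (hp1 r hr') (hN.meas r) (hCN r)
        (hNp r hr') hψ hψi hψ0 hd0 hd
      have e4 : ∫ x, ((smoothAbs δ (p r x) - p r x * deriv (smoothAbs δ) (p r x)) * p r x
          + deriv (smoothAbs δ) (p r x) * (η⁻¹ * (N r x - avg (expLaw η) (N r) x))) * ψ x
          = (∫ x, (smoothAbs δ (p r x) - p r x * deriv (smoothAbs δ) (p r x)) * p r x * ψ x)
            + ∫ x, deriv (smoothAbs δ) (p r x)
              * (η⁻¹ * (N r x - avg (expLaw η) (N r) x)) * ψ x := by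
        rw [← integral_add (hS1.integrable_mul hψi r) (hS2.integrable_mul hψi r)]
        congr 1 with x
        ring
      rw [e4]
      linarith
    have hcont : Continuous fun r => (∫ x, W r x * smoothAbs δ (p r x) * deriv ψ x)
        + (∫ x, ((smoothAbs δ (p r x) - p r x * deriv (smoothAbs δ) (p r x)) * p r x
          + deriv (smoothAbs δ) (p r x) * (η⁻¹ * (N r x - avg (expLaw η) (N r) x))) * ψ x) :=
      (hWb.continuous_integral hψi').add (hS.continuous_integral hψi)
    have hint := intervalIntegral.integral_mono_on (μ := volume) hst (hcont.intervalIntegrable s t)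
      (continuous_const.intervalIntegrable s t) hbound
    rw [← hlaw, intervalIntegral.integral_const, smul_eq_mul] at hint
    have f1 : ∫ x, |p t x| * ψ x ≤ ∫ x, smoothAbs δ (p t x) * ψ x :=
      integral_mono (integrable_bdd_mul (hp.meas t).norm (by simpa using hCp t) hψi)
        (hb.integrable_mul hψi t)
        fun x => mul_le_mul_of_nonneg_right (abs_le_smoothAbs _ _) (hψ0 x)
    have f2 : ∫ x, smoothAbs δ (p s x) * ψ x ≤ (∫ x, |p s x| * ψ x) + δ * ∫ x, ψ x := by
      have i : Integrable fun x => |p s x| * ψ x :=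
        integrable_bdd_mul (hp.meas s).norm (by simpa using hCp s) hψi
      rw [← integral_const_mul, ← integral_add i (hψi.const_mul δ)]
      refine integral_mono (hb.integrable_mul hψi s) (i.add (hψi.const_mul δ)) fun x => ?_
      calc smoothAbs δ (p s x) * ψ x ≤ (|p s x| + δ) * ψ x :=
            mul_le_mul_of_nonneg_right (smoothAbs_le hδ _) (hψ0 x)
        _ = |p s x| * ψ x + δ * ψ x := by ring
    linarith
  set E := (∫ x, ψ x) + (t - s) * (CW * (∫ x, |deriv ψ x|) + (Cp + η⁻¹ * C) * ∫ x, ψ x)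
  refine ge_of_tendsto (f := fun δ => (∫ x, |p s x| * ψ x)
    + d * ((t - s) * ((CW + η⁻¹ * C * m) * C₁)) + δ * E) (x := 𝓝[>] 0) ?_
    (eventually_mem_nhdsWithin.mono fun δ hδ => key δ hδ)
  have : Tendsto (fun δ : ℝ => (∫ x, |p s x| * ψ x)
      + d * ((t - s) * ((CW + η⁻¹ * C * m) * C₁)) + δ * E) (𝓝 0)
      (𝓝 ((∫ x, |p s x| * ψ x) + d * ((t - s) * ((CW + η⁻¹ * C * m) * C₁)) + 0 * E)) :=
    Continuous.tendsto (by fun_prop) 0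
  rw [zero_mul, add_zero] at this
  exact this.mono_left nhdsWithin_le_nhds

/-- The `L¹` norm of the slope is nonincreasing in time. -/
theorem BalanceLaw.integral_abs_le (hη : 0 < η) (hW : BddCont W) (hp : BddCont p)
    (hN : BddCont N) (hWp : ∀ t x y, W t y - W t x = ∫ z in x..y, p t z)
    (hl : BalanceLaw T p (fun t x => W t x * p t x)
      fun t x => η⁻¹ * (N t x - avg (expLaw η) (N t) x))
    {C C₁ : ℝ} (hC : 0 ≤ C)
    (hNp : ∀ t ∈ Icc 0 T, ∀ᵐ x, ∃ a, -C ≤ a ∧ a ≤ 0 ∧ N t x = a * p t x)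
    (hpi : ∀ t ∈ Icc 0 T, Integrable (p t)) (hp1 : ∀ t ∈ Icc 0 T, ∫ x, |p t x| ≤ C₁)
    {s t : ℝ} (hs : 0 ≤ s) (hst : s ≤ t) (ht : t ≤ T) :
    ∫ x, |p t x| ≤ ∫ x, |p s x| := by
  obtain ⟨CW, hCW0, hCW⟩ := hW.bdd
  obtain ⟨D, χ, hD, hχ⟩ := exists_cutoff
  have hlim : ∀ r ∈ Icc 0 T, Tendsto (fun n => ∫ x, |p r x| * χ n x) atTop
      (𝓝 (∫ x, |p r x|)) := fun r hr => by
    refine tendsto_integral_of_dominated_convergence (fun x => |p r x|)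
      (fun n => (hp.meas r).norm.mul (hχ n).1.continuous.aestronglyMeasurable) (hpi r hr).abs
      (fun n => ae_of_all _ fun x => ?_) (ae_of_all _ fun x => ?_)
    · rw [Real.norm_eq_abs, abs_mul, abs_abs, abs_of_nonneg ((hχ n).2.2.1 x).1]
      exact mul_le_of_le_one_right (abs_nonneg _) ((hχ n).2.2.1 x).2
    · simpa using (tendsto_of_eq_one (fun n => (hχ n).2.2.2.2) x).const_mul |p r x|
  have hd : Tendsto (fun n : ℕ => D / (n + 1 : ℝ)) atTop (𝓝 0) :=
    tendsto_const_nhds.div_atTop (tendsto_natCast_atTop_atTop.atTop_add tendsto_const_nhds)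
  -- The cutoffs have slopes at most `D / (n + 1)`, while the factor multiplying the slope bound
  -- does not depend on `n`.
  have h := le_of_tendsto_of_tendsto' (hlim t ⟨hs.trans hst, ht⟩)
    ((hlim s ⟨hs, hst.trans ht⟩).add (hd.mul_const _)) fun n =>
      hl.integral_abs_mul_le hη hW hp hN hWp hCW0 hCW hC hNp hpi hp1 (hχ n).1 (hχ n).2.1
        (fun x => ((hχ n).2.2.1 x).1) (by positivity) (hχ n).2.2.2.1 hs hst ht
  simpa using h

end Contraction

/-! ### Total variation and `L¹` norms of derivatives -/

section TotalVariation

lemma totalVariation_congr_ae {f g : ℝ → ℝ} (h : f =ᵐ[volume] g) :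
    totalVariation f = totalVariation g := by
  have h1 (φ : ℝ → ℝ) : ∫ x, f x * deriv φ x = ∫ x, g x * deriv φ x :=
    integral_congr_ae (h.mul (ae_eq_refl _))
  simp only [totalVariation, h1]

lemma ofReal_integral_mul_deriv_le (f : ℝ → ℝ) {φ : ℝ → ℝ} (hφ : ContDiff ℝ 1 φ)
    (hc : HasCompactSupport φ) (h1 : ∀ x, |φ x| ≤ 1) :
    ENNReal.ofReal (∫ x, f x * deriv φ x) ≤ totalVariation f :=
  le_iSup₂_of_le φ ⟨hφ, hc, h1⟩ le_rfl

/-- Duality for the `L¹` norm of a bounded function. -/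
lemma lintegral_enorm_le_of_test {g : ℝ → ℝ} {C : ℝ} {K : ℝ≥0∞}
    (hg : AEStronglyMeasurable g volume) (hC : ∀ᵐ x, |g x| ≤ C)
    (h : ∀ φ : ℝ → ℝ, Continuous φ → HasCompactSupport φ → (∀ x, |φ x| ≤ 1) →
      ENNReal.ofReal (∫ x, g x * φ x) ≤ K) :
    ∫⁻ x, ‖g x‖ₑ ≤ K := by
  have hC0 : 0 ≤ C := by
    obtain ⟨x, hx⟩ := hC.exists
    exact (abs_nonneg _).trans hx
  have hcov : AECover volume atTop fun n : ℕ => Icc (-n : ℝ) n :=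
    aecover_Icc (tendsto_neg_atTop_atBot.comp tendsto_natCast_atTop_atTop)
      tendsto_natCast_atTop_atTop
  refine le_of_tendsto' (hcov.lintegral_tendsto_of_nat hg.enorm) fun n => ?_
  -- The truncated sign of `g`; division by zero gives `0` where `g` vanishes.
  set s : ℝ → ℝ := (Icc (-n : ℝ) n).indicator fun x => g x / |g x| with hs
  have hs1 (x : ℝ) : |s x| ≤ 1 := by
    rw [hs]
    by_cases hx : x ∈ Icc (-n : ℝ) n
    · rw [indicator_of_mem hx, abs_div, abs_abs]
      exact div_self_le_one _
    · rw [indicator_of_notMem hx, abs_zero]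
      exact zero_le_one
  have hsi : Integrable s := by
    rw [hs, integrable_indicator_iff measurableSet_Icc]
    refine Measure.integrableOn_of_bounded (M := 1) (by simp)
      (hg.aemeasurable.div hg.norm.aemeasurable).aestronglyMeasurable (ae_of_all _ fun x => ?_)
    rw [Real.norm_eq_abs, abs_div, abs_abs]
    exact div_self_le_one _
  have hgi : IntegrableOn g (Icc (-n : ℝ) n) :=
    Measure.integrableOn_of_bounded (M := C) (by simp) hg (ae_restrict_of_ae (by simpa using hC))
  have hgs : ∫ x, g x * s x = ∫ x in Icc (-n : ℝ) n, |g x| := by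
    rw [← integral_indicator measurableSet_Icc]
    congr 1 with x
    by_cases hx : x ∈ Icc (-n : ℝ) n
    · simp only [hs, indicator_of_mem hx]
      rw [mul_div_assoc', ← abs_mul_abs_self, mul_self_div_self]
    · simp only [hs, indicator_of_notMem hx, mul_zero]
  rw [← ofReal_integral_norm_eq_lintegral_enorm hgi]
  simp only [Real.norm_eq_abs]
  rw [← hgs]
  have key : ∀ ε > 0, ENNReal.ofReal ((∫ x, g x * s x) - C * ε) ≤ K := by
    intro ε hε
    obtain ⟨φ, hφc, hφε, hφ, hφi⟩ := hsi.exists_hasCompactSupport_integral_sub_le hε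
    -- Truncation to `[-1, 1]` makes the approximant admissible. It does not move it away from `s`,
    -- whose values already lie in that interval.
    set θ : ℝ → ℝ := fun x => max (-1) (min 1 (φ x)) with hθ
    have hθc : Continuous θ := by fun_prop
    have hθs : HasCompactSupport θ := by
      have : θ = (fun y => max (-1) (min 1 y)) ∘ φ := rfl
      rw [this]
      exact hφc.comp_left (by norm_num)
    have hθ1 (x : ℝ) : |θ x| ≤ 1 := abs_le.mpr ⟨le_max_left _ _, max_le (by norm_num)
      (min_le_left _ _)⟩
    have hθi : Integrable θ := hθc.integrable_of_hasCompactSupport hθs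
    have hclose (x : ℝ) : |s x - θ x| ≤ |s x - φ x| := by
      obtain ⟨h1, h2⟩ := abs_le.mp (hs1 x)
      have : s x = max (-1) (min 1 (s x)) := by rw [min_eq_right h2, max_eq_right h1]
      calc |s x - θ x| = |max (-1) (min 1 (s x)) - max (-1) (min 1 (φ x))| := by rw [← this]
        _ ≤ |min 1 (s x) - min 1 (φ x)| := by
          simpa using abs_max_sub_max_le_max (-1) (min 1 (s x)) (-1) (min 1 (φ x))
        _ ≤ |s x - φ x| := by
          simpa using abs_min_sub_min_le_max 1 (s x) 1 (φ x)
    have igs := integrable_bdd_mul hg hC hsi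
    have igθ := integrable_bdd_mul hg hC hθi
    refine le_trans (ENNReal.ofReal_le_ofReal ?_) (h θ hθc hθs hθ1)
    rw [sub_le_iff_le_add, ← sub_le_iff_le_add', ← integral_sub igs igθ]
    calc ∫ x, (g x * s x - g x * θ x) ≤ ∫ x, C * ‖s x - φ x‖ := by
          refine integral_mono_ae (igs.sub igθ) ((hsi.sub hφi).norm.const_mul C) ?_
          filter_upwards [hC] with x hx
          refine (le_abs_self _).trans ?_
          rw [← mul_sub, abs_mul]
          exact mul_le_mul hx (hclose x) (abs_nonneg _) hC0
      _ ≤ C * ε := by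
          rw [integral_const_mul]
          gcongr
  have hlim : Tendsto (fun ε : ℝ => ENNReal.ofReal ((∫ x, g x * s x) - C * ε)) (𝓝 0)
      (𝓝 (ENNReal.ofReal ((∫ x, g x * s x) - C * 0))) :=
    (ENNReal.continuous_ofReal.comp (by fun_prop)).tendsto 0
  rw [mul_zero, sub_zero] at hlim
  exact le_of_tendsto (hlim.mono_left (nhdsWithin_le_nhds (s := Ioi 0)))
    (eventually_mem_nhdsWithin.mono fun ε hε => key ε hε)

/-- The `L¹` modulus of continuity of a function of bounded variation. -/
lemma lintegral_enorm_shift_sub_le {f : ℝ → ℝ} {C : ℝ} (hf : AEStronglyMeasurable f volume)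
    (hC : ∀ᵐ x, |f x| ≤ C) {h : ℝ} (hh : 0 < h) :
    ∫⁻ x, ‖f (x + h) - f x‖ₑ ≤ ENNReal.ofReal h * totalVariation f := by
  have hprob := isProbabilityMeasure_unifLaw hh
  have hmp := measurePreserving_add_right (volume : Measure ℝ) h
  have hfh : AEStronglyMeasurable (fun x => f (x + h)) volume := hf.comp_measurePreserving hmp
  have hCh : ∀ᵐ x, |f (x + h)| ≤ C := hmp.quasiMeasurePreserving.ae hC
  refine lintegral_enorm_le_of_test (C := C + C) (hfh.sub hf) ?_ fun φ hφ hφc hφ1 => ?_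
  · filter_upwards [hC, hCh] with x h1 h2 using (abs_sub _ _).trans (add_le_add h2 h1)
  have hφi : Integrable φ := hφ.integrable_of_hasCompactSupport hφc
  have hφih : Integrable fun x => φ (x - h) := hφi.comp_sub_right h
  have hd := hasDerivAt_adj_unifLaw hh hφ
  -- This function is bounded by `1`, and `h` times its derivative is `φ (x - h) - φ x`. It is
  -- therefore the total variation test function that detects the translation of `f` by `h`.
  have hΦ : ContDiff ℝ 1 fun x => -adj (unifLaw h) φ x := (contDiff_adj_unifLaw hh hφ).neg
  have hΦ1 (x : ℝ) : |-adj (unifLaw h) φ x| ≤ 1 := by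
    rw [abs_neg]
    exact abs_integral_le_of_ae_le (ae_of_all _ fun a => hφ1 _)
  have key : ∫ x, (f (x + h) - f x) * φ x
      = h * ∫ x, f x * deriv (fun x => -adj (unifLaw h) φ x) x := by
    have h1 : ∫ x, f (x + h) * φ x = ∫ x, f x * φ (x - h) := by
      rw [← integral_add_right_eq_self (fun x => f x * φ (x - h)) h]
      simp
    have i1 : Integrable fun x => f (x + h) * φ x := integrable_bdd_mul hfh hCh hφi
    have i2 : Integrable fun x => f x * φ x := integrable_bdd_mul hf hC hφi
    have i3 : Integrable fun x => f x * φ (x - h) := integrable_bdd_mul hf hC hφih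
    simp only [sub_mul]
    rw [integral_sub i1 i2, h1, ← integral_sub i3 i2, ← integral_const_mul]
    congr 1 with x
    rw [(hd x).fun_neg.deriv]
    field_simp
    ring
  rw [key, ENNReal.ofReal_mul hh.le]
  gcongr
  exact ofReal_integral_mul_deriv_le f hΦ (hasCompactSupport_adj_unifLaw hh hφc).neg hΦ1

/-- A bound on the difference quotients in `L¹` is inherited by the derivative. -/
lemma lintegral_enorm_le_of_shift {W p : ℝ → ℝ} {K : ℝ≥0∞} (hp : LocallyIntegrable p volume)
    (hW : Continuous W) (hWp : ∀ x y, W y - W x = ∫ z in x..y, p z)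
    (h : ∀ h > 0, ∫⁻ x, ‖W (x + h) - W x‖ₑ ≤ ENNReal.ofReal h * K) :
    ∫⁻ x, ‖p x‖ₑ ≤ K := by
  have hb (k : ℝ) (hk : 0 < k) : ∫⁻ x, ‖k⁻¹ * (W (x + k) - W x)‖ₑ ≤ K := by
    have h0 : ENNReal.ofReal k ≠ 0 := by simpa using hk
    simp only [enorm_mul]
    rw [lintegral_const_mul' _ _ enorm_ne_top, enorm_inv hk.ne', Real.enorm_of_nonneg hk.le]
    calc _ ≤ (ENNReal.ofReal k)⁻¹ * (ENNReal.ofReal k * K) := by gcongr; exact h k hk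
      _ = K := by
        rw [← mul_assoc, ENNReal.inv_mul_cancel h0 ENNReal.ofReal_ne_top, one_mul]
  -- Fatou's lemma along right difference quotients, which converge to `p` almost everywhere.
  calc ∫⁻ x, ‖p x‖ₑ = ∫⁻ x, liminf (fun k => ‖k⁻¹ * (W (x + k) - W x)‖ₑ) (𝓝[>] 0) := by
        refine lintegral_congr_ae ?_
        filter_upwards [ae_hasDerivAt_of_sub_eq_integral hp hWp] with x hx
        have := hx.tendsto_slope_zero_right
        simp only [smul_eq_mul] at this
        exact (this.enorm).liminf_eq.symm
    _ ≤ liminf (fun k => ∫⁻ x, ‖k⁻¹ * (W (x + k) - W x)‖ₑ) (𝓝[>] 0) :=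
        lintegral_liminf_le' fun k => by fun_prop
    _ ≤ K := by
        refine liminf_le_of_le (by isBoundedDefault) fun b hb' => ?_
        obtain ⟨k, h1, h2⟩ := (hb'.and eventually_mem_nhdsWithin).exists
        exact h1.trans (hb k h2)

/-- The total variation of an absolutely continuous function is at most the `L¹` norm of its
derivative. -/
lemma totalVariation_le_lintegral {W p : ℝ → ℝ} {C : ℝ} (hp : AEStronglyMeasurable p volume)
    (hC : ∀ᵐ x, |p x| ≤ C) (hWp : ∀ x y, W y - W x = ∫ z in x..y, p z) :
    totalVariation W ≤ ∫⁻ x, ‖p x‖ₑ := by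
  have hpl : LocallyIntegrable p volume := locallyIntegrable_of_bdd hp hC
  have hWl := lipschitzWith_of_abs_sub_le (abs_sub_le_of_sub_eq_integral hC hWp)
  refine iSup₂_le fun φ ⟨hφ, hφc, hφ1⟩ => ?_
  have hφi := integrable_of_test hφ hφc
  have hφi' : Integrable (deriv φ) := integrable_deriv_of_test hφ hφc
  have i1 : Integrable fun x => p x * φ x := integrable_bdd_mul hp hC hφi
  have i2 : Integrable fun x => W x * deriv φ x :=
    (hWl.continuous.mul (hφ.continuous_deriv le_rfl)).integrable_of_hasCompactSupport
      hφc.deriv.mul_left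
  have h0 : ∫ x, (p x * φ x + W x * deriv φ x) = 0 := by
    refine integral_deriv_eq_zero_of_ac (k := fun x => W x * φ x) (fun a b =>
      (hWl.lipschitzOnWith.absolutelyContinuousOnInterval).fun_mul
        hφ.contDiffOn.absolutelyContinuousOnInterval) hφc.mul_left ?_
    filter_upwards [ae_hasDerivAt_of_sub_eq_integral hpl hWp] with x hx
    exact hx.mul (hφ.differentiable one_ne_zero x).hasDerivAt
  rw [integral_add i1 i2] at h0
  rw [eq_neg_of_add_eq_zero_right h0, ← integral_neg]
  refine (Real.ofReal_le_enorm _).trans ((enorm_integral_le_lintegral_enorm _).trans ?_)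
  refine lintegral_mono fun x => ?_
  rw [enorm_neg, enorm_mul]
  refine mul_le_of_le_one_right' ?_
  rw [Real.enorm_eq_ofReal_abs]
  simpa using hφ1 x

/-- The slope of an absolutely continuous function is bounded in `L¹` by the total variation. -/
lemma lintegral_le_totalVariation {W p : ℝ → ℝ} {C CW : ℝ} (hp : AEStronglyMeasurable p volume)
    (hC : ∀ᵐ x, |p x| ≤ C) (hCW : ∀ᵐ x, |W x| ≤ CW)
    (hWp : ∀ x y, W y - W x = ∫ z in x..y, p z) :
    ∫⁻ x, ‖p x‖ₑ ≤ totalVariation W := by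
  have hW := (lipschitzWith_of_abs_sub_le (abs_sub_le_of_sub_eq_integral hC hWp)).continuous
  exact lintegral_enorm_le_of_shift (locallyIntegrable_of_bdd hp hC) hW hWp fun h hh =>
    lintegral_enorm_shift_sub_le hW.aestronglyMeasurable hCW hh

/-- The slope of the average of `V ∘ f` is bounded in `L¹` by the total variation of `f`. -/
lemma lintegral_le_mul_totalVariation {η : ℝ} (hη : 0 < η) {V : ℝ → ℝ} (hV : Continuous V)
    {f W p : ℝ → ℝ} {C Cp CV L : ℝ} {S : Set ℝ} (hp : AEStronglyMeasurable p volume)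
    (hCp : ∀ᵐ x, |p x| ≤ Cp) (hWp : ∀ x y, W y - W x = ∫ z in x..y, p z)
    (hW : ∀ x, W x = avg (expLaw η) (fun y => V (f y)) x)
    (hf : AEStronglyMeasurable f volume) (hC : ∀ᵐ x, |f x| ≤ C) (hCV : ∀ᵐ x, |V (f x)| ≤ CV)
    (hS : ∀ᵐ x, f x ∈ S) (hL : ∀ a ∈ S, ∀ b ∈ S, |V a - V b| ≤ L * |a - b|) :
    ∫⁻ x, ‖p x‖ₑ ≤ ENNReal.ofReal L * totalVariation f := by
  have hprob := isProbabilityMeasure_expLaw hη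
  have hWc := (lipschitzWith_of_abs_sub_le (abs_sub_le_of_sub_eq_integral hCp hWp)).continuous
  refine lintegral_enorm_le_of_shift (locallyIntegrable_of_bdd hp hCp) hWc hWp fun h hh => ?_
  have hz : AEStronglyMeasurable (fun x => V (f x)) volume := hV.comp_aestronglyMeasurable hf
  have hmp := measurePreserving_add_right (volume : Measure ℝ) h
  have hzh : AEStronglyMeasurable (fun x => V (f (x + h))) volume :=
    hz.comp_measurePreserving hmp
  have hSh : ∀ᵐ x, f (x + h) ∈ S := hmp.quasiMeasurePreserving.ae hS
  have hCVh : ∀ᵐ x, |V (f (x + h))| ≤ CV := hmp.quasiMeasurePreserving.ae hCV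
  calc ∫⁻ x, ‖W (x + h) - W x‖ₑ
      = ∫⁻ x, ‖avg (expLaw η) (fun y => V (f (y + h)) - V (f y)) x‖ₑ := by
        refine lintegral_congr_ae ?_
        filter_upwards [integrable_shift (μ := expLaw η) hz hCV,
          integrable_shift (μ := expLaw η) hzh hCVh] with x h1 h2
        rw [hW, hW, avg, avg, avg, integral_sub h2 h1]
        simp only [add_right_comm]
    _ ≤ ∫⁻ x, ‖V (f (x + h)) - V (f x)‖ₑ := lintegral_avg_le (hzh.sub hz)
    _ ≤ ∫⁻ x, ENNReal.ofReal L * ‖f (x + h) - f x‖ₑ := by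
        refine lintegral_mono_ae ?_
        filter_upwards [hS, hSh] with x h1 h2
        rw [Real.enorm_eq_ofReal_abs, Real.enorm_eq_ofReal_abs,
          ← ENNReal.ofReal_mul' (abs_nonneg _)]
        exact ENNReal.ofReal_le_ofReal (hL _ h2 _ h1)
    _ ≤ ENNReal.ofReal L * (ENNReal.ofReal h * totalVariation f) := by
        rw [lintegral_const_mul' _ _ ENNReal.ofReal_ne_top]
        gcongr
        exact lintegral_enorm_shift_sub_le hf hC hh
    _ = _ := mul_left_comm _ _ _

end TotalVariation

/-! ### Monotonicity of the total variation and the initial bound -/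

section MainEstimate

variable {T η : ℝ} {V : ℝ → ℝ} {u : ℝ → ℝ → ℝ}

/-- The total variation of the nonlocal velocity is nonincreasing in time. -/
theorem BalanceLaw.totalVariation_vel_le (hη : 0 < η) (hV : ContDiff ℝ 2 V)
    (hV' : ∀ x, deriv V x ≤ 0) (hu : BddCont u)
    (hl : BalanceLaw T u (fun t x => vel η V u t x * u t x) fun _ _ => 0) {m M C : ℝ}
    (hmM : ∀ t ∈ Icc 0 T, ∀ᵐ x, u t x ∈ Icc m M)
    (hA : ∀ x ∈ Icc m M, deriv V x * x - V x + V m ≤ 0)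
    (hTV : ∀ t ∈ Icc 0 T, totalVariation (u t) ≤ ENNReal.ofReal C)
    {s t : ℝ} (hs : 0 ≤ s) (hst : s ≤ t) (ht : t ≤ T) :
    totalVariation (vel η V u t) ≤ totalVariation (vel η V u s) := by
  have hprob := isProbabilityMeasure_expLaw hη
  have hV1 : ContDiff ℝ 1 V := hV.of_le one_le_two
  have hVa : Antitone V := antitone_of_deriv_nonpos (hV.differentiable two_ne_zero) hV'
  have hdV : ContDiff ℝ 1 (deriv V) := by
    rw [← one_add_one_eq_two] at hV
    exact hV.deriv'
  have hW := bddCont_vel hη hV hu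
  have hp := bddCont_velSlope hη hV hu
  have hWp := vel_sub hη hV hu
  have hz : BddCont fun t x => V (u t x) := hu.comp hV1.locallyLipschitz
  have ha : BddCont fun t x => deriv V (u t x) * u t x - V (u t x) + vel η V u t x :=
    (((hu.comp hdV.locallyLipschitz).mul hu).sub hz).add hW
  have hN : BddCont fun t x =>
      (deriv V (u t x) * u t x - V (u t x) + vel η V u t x) * velSlope η V u t x := ha.mul hp
  obtain ⟨Cu, hCu0, hCu⟩ := hu.bdd
  obtain ⟨Cz, hCz0, hCz⟩ := hz.bdd
  obtain ⟨Ca, hCa0, hCa⟩ := ha.bdd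
  obtain ⟨Cp, hCp0, hCp⟩ := hp.bdd
  obtain ⟨CW, hCW0, hCW⟩ := hW.bdd
  obtain ⟨L, hL0, hL⟩ := exists_lipschitz_bound hV1.locallyLipschitz Cu
  -- Renormalization with `V` has the source `(V(u) - u V'(u)) p`. Adding and subtracting `W p`
  -- brings it to the form from which the slope equation is derived.
  have hzl : BalanceLaw T (fun t x => V (u t x)) (fun t x => vel η V u t x * V (u t x))
      fun t x => vel η V u t x * velSlope η V u t x
        - (deriv V (u t x) * u t x - V (u t x) + vel η V u t x) * velSlope η V u t x := by
    have h := hl.renormalize hu hW hp (BddCont.const (C := 0) aestronglyMeasurable_const (by simp))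
      hWp hV1
    refine Eq.mp (congrArg _ (funext₂ fun t x => ?_)) h
    ring
  have hpl := hzl.slope hη hz hN (fun _ => rfl) fun _ _ => rfl
  -- As `V` is nonincreasing and `u ≥ m`, the average satisfies `W ≤ V(m)`. The factor in front of
  -- `p` is then at most `V'(u) u - V(u) + V(m)`, which the structural assumption makes nonpositive.
  have hsign : ∀ r ∈ Icc 0 T, ∀ᵐ x, ∃ a, -Ca ≤ a ∧ a ≤ 0 ∧
      (deriv V (u r x) * u r x - V (u r x) + vel η V u r x) * velSlope η V u r x
        = a * velSlope η V u r x := fun r hr => by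
    filter_upwards [hCa r, hmM r hr, integrable_shift (μ := expLaw η) (hz.meas r) (hCz r),
      (hmM r hr).mono fun x _ => ae_add_of_absolutelyContinuous expLaw_absolutelyContinuous
        (hmM r hr) x] with x h1 h2 h3 h4
    refine ⟨_, (abs_le.mp h1).1, ?_, rfl⟩
    have h5 : vel η V u r x ≤ V m := by
      calc vel η V u r x ≤ ∫ _, V m ∂expLaw η :=
            integral_mono_ae h3 (integrable_const _) (h4.mono fun a h => hVa h.1)
        _ = V m := by simp
    linarith [hA _ h2]
  -- This bound serves only to place `p` in `L¹` uniformly in time, so that the cutoffs can be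
  -- removed; its size does not enter the final estimate.
  have hpL : ∀ r ∈ Icc 0 T, ∫⁻ x, ‖velSlope η V u r x‖ₑ ≤ ENNReal.ofReal (L * C) := fun r hr => by
    rw [ENNReal.ofReal_mul hL0]
    refine (lintegral_le_mul_totalVariation (S := {a | |a| ≤ Cu}) hη hV.continuous (hp.meas r)
      (hCp r) (hWp r) (fun _ => rfl) (hu.meas r) (hCu r) (hCz r) (hCu r)
      fun a ha b hb => hL a b ha hb).trans ?_
    gcongr
    exact hTV r hr
  have hpi : ∀ r ∈ Icc 0 T, Integrable (velSlope η V u r) := fun r hr =>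
    ⟨hp.meas r, (hpL r hr).trans_lt ENNReal.ofReal_lt_top⟩
  have heq : ∀ r ∈ Icc 0 T, ENNReal.ofReal (∫ x, |velSlope η V u r x|)
      = ∫⁻ x, ‖velSlope η V u r x‖ₑ := fun r hr =>
    ofReal_integral_norm_eq_lintegral_enorm (hpi r hr)
  have hp1 : ∀ r ∈ Icc 0 T, ∫ x, |velSlope η V u r x| ≤ max (L * C) 0 := fun r hr => by
    refine (ENNReal.ofReal_le_ofReal_iff (le_max_right _ _)).mp ((heq r hr).trans_le ?_)
    exact (hpL r hr).trans (ENNReal.ofReal_le_ofReal (le_max_left _ _))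
  have hs' : s ∈ Icc 0 T := ⟨hs, hst.trans ht⟩
  have ht' : t ∈ Icc 0 T := ⟨hs.trans hst, ht⟩
  calc totalVariation (vel η V u t) ≤ ∫⁻ x, ‖velSlope η V u t x‖ₑ :=
        totalVariation_le_lintegral (hp.meas t) (hCp t) (hWp t)
    _ ≤ ∫⁻ x, ‖velSlope η V u s x‖ₑ := by
        rw [← heq t ht', ← heq s hs']
        exact ENNReal.ofReal_le_ofReal
          (hpl.integral_abs_le hη hW hp hN hWp hCa0 hsign hpi hp1 hs hst ht)
    _ ≤ totalVariation (vel η V u s) :=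
        lintegral_le_totalVariation (hp.meas s) (hCp s) (hCW s) (hWp s)

/-- A `C¹` function is Lipschitz on `[0, M]` with constant the `L^∞` norm of its derivative on
`(0, M)`. -/
lemma abs_sub_le_eLpNorm_deriv (hV : ContDiff ℝ 1 V) {M : ℝ} :
    eLpNorm (deriv V) ⊤ (volume.restrict (Ioo 0 M)) ≠ ⊤ ∧
    ∀ a ∈ Icc 0 M, ∀ b ∈ Icc 0 M, |V a - V b|
      ≤ (eLpNorm (deriv V) ⊤ (volume.restrict (Ioo 0 M))).toReal * |a - b| := by
  have hdV := hV.continuous_deriv le_rfl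
  obtain ⟨B, -, hB⟩ := exists_bound_of_continuous hdV M
  have hfin : eLpNorm (deriv V) ⊤ (volume.restrict (Ioo 0 M)) ≠ ⊤ := by
    rw [eLpNorm_exponent_top]
    refine (eLpNormEssSup_lt_top_of_ae_bound (C := B) ?_).ne
    filter_upwards [ae_restrict_mem measurableSet_Ioo] with x hx
    exact hB x (abs_le.mpr ⟨by linarith [hx.1, hx.2], hx.2.le⟩)
  refine ⟨hfin, fun a ha b hb => ?_⟩
  set L := (eLpNorm (deriv V) ⊤ (volume.restrict (Ioo 0 M))).toReal with hLdef
  rcases (ha.1.trans ha.2).eq_or_lt with h0 | h0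
  · have h1 : a = 0 := le_antisymm (ha.2.trans h0.ge) ha.1
    have h2 : b = 0 := le_antisymm (hb.2.trans h0.ge) hb.1
    simp [h1, h2]
  -- A set of full measure is dense in the open interval. As `V'` is continuous, the essential bound
  -- therefore holds at every point of `[0, M]`.
  have hae : ∀ᵐ x, x ∈ Ioo 0 M → |deriv V x| ≤ L := by
    rw [← ae_restrict_iff' measurableSet_Ioo]
    filter_upwards [ae_le_eLpNormEssSup (f := deriv V) (μ := volume.restrict (Ioo 0 M))] with x hx
    rw [← eLpNorm_exponent_top, ← ENNReal.ofReal_toReal hfin, Real.enorm_eq_ofReal_abs] at hx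
    exact (ENNReal.ofReal_le_ofReal_iff ENNReal.toReal_nonneg).mp hx
  have hcl : IsClosed {x | |deriv V x| ≤ L} := isClosed_le (by fun_prop) continuous_const
  have hIcc : Icc 0 M ⊆ {x | |deriv V x| ≤ L} := by
    rw [← closure_Ioo h0.ne]
    refine closure_minimal (fun x hx => ?_) hcl
    exact closure_minimal (fun y hy => hy.2 hy.1) hcl
      ((Measure.dense_of_ae hae).open_subset_closure_inter isOpen_Ioo hx)
  exact (convex_Icc 0 M).norm_image_sub_le_of_norm_deriv_le
    (fun x _ => hV.differentiable one_ne_zero x) (fun x hx => hIcc hx) hb ha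

end MainEstimate

end NonlocalVelocity

end

/-! ### The theorem -/

open NonlocalVelocity

theorem mainTheorem5
    (V : ℝ → ℝ) (hV : ContDiff ℝ 2 V) (hV' : ∀ x, deriv V x ≤ 0)
    (q₀ : ℝ → ℝ) (hq₀ : MemLp q₀ ⊤ volume) (hq₀_nonneg : ∀ᵐ x, 0 ≤ q₀ x)
    (hq₀_TV : NonlocalVelocity.totalVariation q₀ < ⊤)
    (hVq₀ : ∀ x ∈ Ioo (essInf q₀ volume) (eLpNorm q₀ ⊤ volume).toReal,
      deriv V x * x - V x + V (essInf q₀ volume) ≤ 0)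
    (η T : ℝ) (hη : 0 < η) (hT : 0 < T)
    (q : ℝ → ℝ → ℝ)
    (hq : NonlocalVelocity.IsWeakSolution NonlocalVelocity.expKernel η T V q₀ q) :
    AntitoneOn (fun t => NonlocalVelocity.totalVariation
        (NonlocalVelocity.velocity NonlocalVelocity.expKernel η V q t)) (Icc 0 T) ∧
    ∀ t ∈ Icc 0 T,
      NonlocalVelocity.totalVariation
          (NonlocalVelocity.velocity NonlocalVelocity.expKernel η V q t) ≤
        NonlocalVelocity.totalVariation
          (NonlocalVelocity.velocity NonlocalVelocity.expKernel η V q 0) ∧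
      NonlocalVelocity.totalVariation
          (NonlocalVelocity.velocity NonlocalVelocity.expKernel η V q 0) ≤
        eLpNorm (deriv V) ⊤ (volume.restrict (Ioo 0 (eLpNorm q₀ ⊤ volume).toReal)) *
          NonlocalVelocity.totalVariation q₀ := by
  obtain ⟨hqc, ⟨C, hC⟩, -, hweak⟩ := hq
  have hprob := isProbabilityMeasure_expLaw hη
  have hV1 : ContDiff ℝ 1 V := hV.of_le one_le_two
  have hbound : ∀ t ∈ Icc 0 T, ∀ᵐ x, |q t x| ≤ max C 0 := fun t ht =>
    ae_abs_le_of_ae_time hT hqc (hC.mono fun s hs => ae_abs_le_of_eLpNorm_top_le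
      (le_max_right _ _) (hs.1.trans (ENNReal.ofReal_le_ofReal (le_max_left _ _)))) ht
  have hu : BddCont fun t => q (clamp T t) := bddCont_clamp hT (le_max_right _ _) hqc hbound
  set u : ℝ → ℝ → ℝ := fun t => q (clamp T t) with hudef
  have hut : ∀ t ∈ Icc 0 T, u t = q t := fun t ht => by rw [hudef]; simp only [clamp_of_mem ht]
  have hvel : ∀ t ∈ Icc 0 T, velocity expKernel η V q t = vel η V u t := fun t ht => by
    ext x
    rw [velocity_eq_avg hη, vel, hut t ht]
  have h0T : (0 : ℝ) ∈ Icc 0 T := ⟨le_rfl, hT.le⟩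
  have hW := bddCont_vel hη hV hu
  have hp := bddCont_velSlope hη hV hu
  have hTV : ∀ t ∈ Icc 0 T, totalVariation (u t) ≤ ENNReal.ofReal C := fun t ht => by
    rw [hut t ht]
    exact totalVariation_le_of_ae_time hT hu (hC.mono fun s hs => hs.2) ht
  obtain ⟨hl, hinit⟩ := balanceLaw_of_weak hT hu hW (q₀ := q₀) fun φ h1 h2 h3 => by
    refine Eq.trans ?_ (hweak φ h1 h2 h3)
    congr 1
    refine setIntegral_congr_fun measurableSet_Ioo fun t ht => ?_
    have ht' := Ioo_subset_Icc_self ht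
    simp only [hut t ht', hvel t ht']
  have hq₀l : LocallyIntegrable q₀ volume := hq₀.locallyIntegrable le_top
  have hu0 : u 0 =ᵐ[volume] q₀ := ae_eq_of_integral_test (hu.locallyIntegrable 0) hq₀l hinit
  set M := (eLpNorm q₀ ⊤ volume).toReal with hM
  set m := essInf q₀ volume with hm
  have hM0 : 0 ≤ M := ENNReal.toReal_nonneg
  have hq₀M : ∀ᵐ x, |q₀ x| ≤ M :=
    ae_abs_le_of_eLpNorm_top_le hM0 (by rw [hM, ENNReal.ofReal_toReal hq₀.2.ne])
  have hbelow : IsBoundedUnder (· ≥ ·) (ae volume) q₀ := ⟨0, eventually_map.mpr hq₀_nonneg⟩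
  have habove : IsBoundedUnder (· ≤ ·) (ae volume) q₀ :=
    ⟨M, eventually_map.mpr (hq₀M.mono fun x hx => (le_abs_self _).trans hx)⟩
  have hq₀m : ∀ᵐ x, m ≤ q₀ x := ae_essInf_le hbelow
  have hm0 : 0 ≤ m := le_essInf_of_ae_le 0 hq₀_nonneg habove.isCoboundedUnder_ge
  -- The maximum principle is used with the upper barrier `M` and the lower barrier `m`. Both are
  -- nonnegative, as it requires.
  have hmM : ∀ t ∈ Icc 0 T, ∀ᵐ x, u t x ∈ Icc m M := fun t ht => by
    have h1 := hl.one_sided_bound hη hV hV' hu (.inl rfl) hM0 (by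
      filter_upwards [hu0, hq₀M] with x h1 h2
      linarith [le_abs_self (q₀ x)]) ht
    have h2 := hl.one_sided_bound hη hV hV' hu (.inr rfl) hm0 (by
      filter_upwards [hu0, hq₀m] with x h1 h2
      linarith) ht
    filter_upwards [h1, h2] with x h1 h2 using ⟨by linarith, by linarith⟩
  have hA : ∀ x ∈ Icc m M, deriv V x * x - V x + V m ≤ 0 := by
    intro x hx
    have hc : IsClosed {x : ℝ | deriv V x * x - V x + V m ≤ 0} := by
      have := hV1.continuous_deriv le_rfl
      have := hV.continuous
      exact isClosed_le (f := fun x => deriv V x * x - V x + V m) (by fun_prop) continuous_const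
    -- If `m = M` the open interval is empty and the assumption is void. The inequality then reads
    -- `V'(m) m ≤ 0`, which follows from the signs of `V'` and `m`. Otherwise it passes to the end
    -- points by continuity.
    rcases (hx.1.trans hx.2).eq_or_lt with h | h
    · have : x = m := le_antisymm (hx.2.trans h.ge) hx.1
      rw [this]
      linarith [mul_nonpos_of_nonpos_of_nonneg (hV' m) hm0]
    · rw [← closure_Ioo h.ne] at hx
      exact closure_minimal hVq₀ hc hx
  have hanti : AntitoneOn (fun t => totalVariation (velocity expKernel η V q t)) (Icc 0 T) := by
    intro s hs t ht hst
    simp only [hvel s hs, hvel t ht]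
    exact hl.totalVariation_vel_le hη hV hV' hu hmM hA hTV hs.1 hst ht.2
  refine ⟨hanti, fun t ht => ⟨hanti h0T ht ht.1, ?_⟩⟩
  obtain ⟨hfin, hL⟩ := abs_sub_le_eLpNorm_deriv hV1 (M := M)
  obtain ⟨Cp, -, hCp⟩ := hp.bdd
  obtain ⟨Cu, -, hCu⟩ := hu.bdd
  obtain ⟨Cz, -, hCz⟩ := (hu.comp hV1.locallyLipschitz).bdd
  -- The weak formulation fixes the initial value only up to a null set, which the total variation
  -- does not see.
  rw [hvel 0 h0T, ← totalVariation_congr_ae hu0]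
  calc totalVariation (vel η V u 0) ≤ ∫⁻ x, ‖velSlope η V u 0 x‖ₑ :=
        totalVariation_le_lintegral (hp.meas 0) (hCp 0) (vel_sub hη hV hu 0)
    _ ≤ ENNReal.ofReal (eLpNorm (deriv V) ⊤ (volume.restrict (Ioo 0 M))).toReal
        * totalVariation (u 0) :=
        lintegral_le_mul_totalVariation (S := Icc 0 M) hη hV.continuous (hp.meas 0) (hCp 0)
          (vel_sub hη hV hu 0) (fun _ => rfl) (hu.meas 0) (hCu 0) (hCz 0)
          ((hmM 0 h0T).mono fun x hx => ⟨hm0.trans hx.1, hx.2⟩) hL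
    _ = _ := by rw [ENNReal.ofReal_toReal hfin]
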